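/- **Notation.** For $\operatorname{Im} w>0$ and $x\in\mathbb C$ let $$\vartheta_1(x;w)=-\sum_{n\in\mathbb Z} e^{\pi i w(n+\frac12)^2+2\pi i(n+\frac12)(x+\frac12)},\quad \vartheta_2(x;w)=\sum_{n\in\mathbb Z} e^{\pi i w(n+\frac12)^2+2\pi i(n+\frac12)x},$$ $$\vartheta_3(x;w)=\sum_{n\in\mathbb Z} e^{\pi i wn^2+2\pi i nx},\quad \vartheta_4(x;w)=\sum_{n\in\mathbb Z} e^{\pi i wn^2+2\pi i n(x+\frac12)}.$$ Let $y>0$, $r\in\mathbb R\setminus\frac12\mathbb Z$, $v\in\mathbb R\setminus y\mathbb Z$, and write $\vartheta_j(x)=\vartheta_j(x;iy)$, with $'$ the derivative in $x$. For $j=1,3$ put $$R_j=\frac{\vartheta_j(-\frac12iv+r)}{\vartheta_j(\frac12iv+r)},\qquad \Delta_j=\frac{\vartheta_j'}{\vartheta_j}\left(-\tfrac12iv+r\right)-\frac{\vartheta_j'}{\vartheta_j}\left(\tfrac12iv+r\right),$$ and put $\alpha_2=\sqrt{\vartheta_3(2r)\vartheta_3(0)}$, $s_2=\vartheta_3(2r)\vartheta_1(iv)$,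 $u_2=\vartheta_1(-\frac12iv+r)\,\vartheta_3(-\frac12iv+r)\,\vartheta_1(\frac12iv+r)\,\vartheta_3(\frac12iv+r)$. For $n\in\mathbb Z$, $z\in\mathbb C$ let $\mu_n=ivn+\frac{z}{\Delta_3-\Delta_1}$, $E_a=\exp\left(\frac{a\Delta_3}{\Delta_3-\Delta_1}z\right)$ and $$F_n=\alpha_2E_n\vartheta_2(\mu_n-\tfrac12iv),\qquad f_n=\vartheta_3(-\tfrac12iv+r)R_3^nE_{n+\frac12}\vartheta_2(\mu_n+r),$$ $$g_n=\vartheta_1(\tfrac12iv+r)R_1^{-n}E_{n+\frac12}\vartheta_4(\mu_n-r),\qquad G_n=\alpha_2\tfrac{\vartheta_1(iv)}{\vartheta_3(0)}R_1^{-n}R_3^nE_n\vartheta_4(\mu_n-\tfrac12iv),$$ $$H_n=\tfrac{u_2}{\alpha_2s_2}R_1^{-n}R_3^{-n}E_n\vartheta_4(\mu_n-\tfrac12iv-2r),\qquad \widetilde G_n=-i\alpha_2\tfrac{\vartheta_1(iv)}{\vartheta_3(0)}E_n\vartheta_4(\mu_n-\tfrac12iv).$$ Let $\varrho_n=\lim_{z\to0}\frac12\frac{G_n}{\widetilde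 G_n}$, let $*$ be complex conjugation, and, evaluating everything at $z=0$, let $q_n=f_nf_n^*+g_ng_n^*$ and $$\gamma_n=\begin{pmatrix}\frac{H_n+H_n^*}{F_n}\\ \frac1i\frac{H_n-H_n^*}{F_n}\\ n-2\frac{\partial\log F_n}{\partial z}\end{pmatrix},\qquad T_n=\frac1{q_n}\begin{pmatrix}f_n^*g_n+f_ng_n^*\\ \frac1i(f_n^*g_n-f_ng_n^*)\\ f_nf_n^*-g_ng_n^*\end{pmatrix},$$ $$\widetilde N_n=\frac1{q_n}\begin{pmatrix}(f_n^{*2}-g_n^{*2})\varrho_n+(f_n^2-g_n^2)\varrho_n^*\\ \frac1i[(f_n^{*2}+g_n^{*2})\varrho_n-(f_n^2+g_n^2)\varrho_n^*]\\ -2(f_n^*g_n^*\varrho_n+f_ng_n\varrho_n^*)\end{pmatrix},\qquad \widetilde B_n=\frac1{q_n}\begin{pmatrix}\frac1i[-(f_n^{*2}-g_n^{*2})\varrho_n+(f_n^2-g_n^2)\varrho_n^*]\\ (f_n^{*2}+g_n^{*2})\varrho_n+(f_n^2+g_n^2)\varrho_n^*\\ \frac2i(f_n^*g_n^*\varrho_n-f_ng_n\varrho_n^*)\end{pmatrix}.$$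 For $k\in\mathbb N$, $m\in\mathbb Z$ put $$\Lambda=e^{\pi im(4r+1)}(R_1R_3)^{-k}-1,\qquad \Xi=\frac{(\Delta_3+\Delta_1)k-4\pi im}{\Delta_3-\Delta_1}.$$ A *$k$-Kaleidocycle with torsion angle $\lambda\in(0,\pi)$* is a tuple of unit vectors $(b_0,\dots,b_k)$ in $\mathbb R^3$ with $\langle b_{n-1},b_n\rangle=\cos\lambda$ for $1\le n\le k$, $\sum_{n=0}^{k-1}b_{n+1}\times b_n=0$ and $b_k=\pm b_0$. **Theorem.** Let $k\in\mathbb N$, $m\in\mathbb Z\setminus\{0\}$, $y>0$, $r\in\mathbb R\setminus\frac12\mathbb Z$ and $v\in\mathbb R\setminus y\mathbb Z$ satisfy $kv=my$. 1. The conditions $\Lambda=0$, $\Xi=0$ hold if and only if $\Lambda=0$, $\frac{\partial}{\partial r}\Lambda=0$ (derivative in real $r$ with $k,m,v,y$ fixed). 2. Suppose $\Lambda=0$ and $\Xi=0$. Then the number $\lambda=\frac1i\log(R_1R_3^{-1})$ (principal logarithm) is real, the limits $\varrho_n$ exist, and the vectors $\gamma_n,T_n,\widetilde N_n,\widetilde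 B_n$ are real. For all $n\in\mathbb Z$ one has $|\gamma_{n+1}-\gamma_n|=1$, $\gamma_{n+1}-\gamma_n=T_n$, $\Phi_n=[T_n,\widetilde N_n,\widetilde B_n]\in \mathrm{SO}(3)$, and with some $\kappa_n\in(-\pi,\pi)$ $$\Phi_{n+1}=\Phi_n\begin{pmatrix}1&0&0\\0&\cos\lambda&\sin\lambda\\0&-\sin\lambda&\cos\lambda\end{pmatrix}\begin{pmatrix}\cos\kappa_{n+1}&-\sin\kappa_{n+1}&0\\ \sin\kappa_{n+1}&\cos\kappa_{n+1}&0\\0&0&1\end{pmatrix},$$ that is, $\gamma$ has unit segment length and constant signed torsion angle $\lambda$. Moreover $\gamma$ is closed with period $k$, i.e. $\gamma_{n+k}=\gamma_n$ for all $n$, and $(\widetilde B_0,\dots,\widetilde B_k)$ is a $k$-Kaleidocycle with torsion angle $|\lambda|$ (so with torsion angle $\lambda$ when $\lambda>0$). -/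

import Mathlib

open Filter Topology

noncomputable section

namespace Kaleidocycle

/-! ### Elliptic theta functions -/

/-- `ϑ₁(x; w)`. -/
def theta1 (x w : ℂ) : ℂ :=
  -∑' n : ℤ, Complex.exp (Real.pi * Complex.I * w * ((n : ℂ) + 1 / 2) ^ 2
    + 2 * Real.pi * Complex.I * ((n : ℂ) + 1 / 2) * (x + 1 / 2))

/-- `ϑ₂(x; w)`. -/
def theta2 (x w : ℂ) : ℂ :=
  ∑' n : ℤ, Complex.exp (Real.pi * Complex.I * w * ((n : ℂ) + 1 / 2) ^ 2
    + 2 * Real.pi * Complex.I * ((n : ℂ) + 1 / 2) * x)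

/-- `ϑ₃(x; w)`. -/
def theta3 (x w : ℂ) : ℂ :=
  ∑' n : ℤ, Complex.exp (Real.pi * Complex.I * w * (n : ℂ) ^ 2
    + 2 * Real.pi * Complex.I * (n : ℂ) * x)

/-- `ϑ₄(x; w)`. -/
def theta4 (x w : ℂ) : ℂ :=
  ∑' n : ℤ, Complex.exp (Real.pi * Complex.I * w * (n : ℂ) ^ 2
    + 2 * Real.pi * Complex.I * (n : ℂ) * (x + 1 / 2))

/-- The modulus `w = i y`. -/
def modulus (y : ℝ) : ℂ := Complex.I * y

/-! ### Constants built from theta functions -/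

/-- The point `-iv/2 + r`. -/
def ptMinus (v r : ℝ) : ℂ := -(1 / 2) * Complex.I * v + r

/-- The point `iv/2 + r`. -/
def ptPlus (v r : ℝ) : ℂ := 1 / 2 * Complex.I * v + r

/-- `R₁ = ϑ₁(-iv/2 + r; iy) / ϑ₁(iv/2 + r; iy)`. -/
def R1 (v r y : ℝ) : ℂ := theta1 (ptMinus v r) (modulus y) / theta1 (ptPlus v r) (modulus y)

/-- `R₃ = ϑ₃(-iv/2 + r; iy) / ϑ₃(iv/2 + r; iy)`. -/
def R3 (v r y : ℝ) : ℂ := theta3 (ptMinus v r) (modulus y) / theta3 (ptPlus v r) (modulus y)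

/-- `Δ₁ = d₁(-iv/2 + r) - d₁(iv/2 + r)`, where `d₁ = ϑ₁' / ϑ₁` at modulus `iy`. -/
def Delta1 (v r y : ℝ) : ℂ :=
  logDeriv (fun x => theta1 x (modulus y)) (ptMinus v r)
    - logDeriv (fun x => theta1 x (modulus y)) (ptPlus v r)

/-- `Δ₃ = d₃(-iv/2 + r) - d₃(iv/2 + r)`, where `d₃ = ϑ₃' / ϑ₃` at modulus `iy`. -/
def Delta3 (v r y : ℝ) : ℂ :=
  logDeriv (fun x => theta3 x (modulus y)) (ptMinus v r)
    - logDeriv (fun x => theta3 x (modulus y)) (ptPlus v r)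

/-- `α₂ = √(ϑ₃(2r) ϑ₃(0))`, the principal square root. -/
def alpha2 (r y : ℝ) : ℂ :=
  (theta3 (2 * r) (modulus y) * theta3 0 (modulus y)) ^ (1 / 2 : ℂ)

/-- `s₂ = ϑ₃(2r) ϑ₁(iv)`. -/
def s2 (v r y : ℝ) : ℂ := theta3 (2 * r) (modulus y) * theta1 (Complex.I * v) (modulus y)

/-- `u₂ = ϑ₁(-iv/2 + r) ϑ₃(-iv/2 + r) ϑ₁(iv/2 + r) ϑ₃(iv/2 + r)`. -/
def u2 (v r y : ℝ) : ℂ :=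
  theta1 (ptMinus v r) (modulus y) * theta3 (ptMinus v r) (modulus y)
    * theta1 (ptPlus v r) (modulus y) * theta3 (ptPlus v r) (modulus y)

/-! ### The tau functions, indexed by `n`, in the complex variable `z` -/

/-- `μₙ = ivn + z / (Δ₃ - Δ₁)`. -/
def mu (v r y : ℝ) (n : ℤ) (z : ℂ) : ℂ :=
  Complex.I * v * n + z / (Delta3 v r y - Delta1 v r y)

/-- `exp (a Δ₃ z / (Δ₃ - Δ₁))`. -/
def expFactor (v r y : ℝ) (a z : ℂ) : ℂ :=
  Complex.exp (a * Delta3 v r y / (Delta3 v r y - Delta1 v r y) * z)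

/-- The function `Fₙ(z)`. -/
def tauF (v r y : ℝ) (n : ℤ) (z : ℂ) : ℂ :=
  alpha2 r y * expFactor v r y n z
    * theta2 (mu v r y n z - 1 / 2 * Complex.I * v) (modulus y)

/-- The function `fₙ(z)`. -/
def tauSmallF (v r y : ℝ) (n : ℤ) (z : ℂ) : ℂ :=
  theta3 (ptMinus v r) (modulus y) * R3 v r y ^ n * expFactor v r y (n + 1 / 2) z
    * theta2 (mu v r y n z + r) (modulus y)

/-- The function `gₙ(z)`. -/
def tauSmallG (v r y : ℝ) (n : ℤ) (z : ℂ) : ℂ :=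
  theta1 (ptPlus v r) (modulus y) * R1 v r y ^ (-n) * expFactor v r y (n + 1 / 2) z
    * theta4 (mu v r y n z - r) (modulus y)

/-- The function `Gₙ(z)`. -/
def tauG (v r y : ℝ) (n : ℤ) (z : ℂ) : ℂ :=
  alpha2 r y * (theta1 (Complex.I * v) (modulus y) / theta3 0 (modulus y))
    * R1 v r y ^ (-n) * R3 v r y ^ n * expFactor v r y n z
    * theta4 (mu v r y n z - 1 / 2 * Complex.I * v) (modulus y)

/-- The function `Hₙ(z)`. -/
def tauH (v r y : ℝ) (n : ℤ) (z : ℂ) : ℂ :=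
  u2 v r y / (alpha2 r y * s2 v r y)
    * R1 v r y ^ (-n) * R3 v r y ^ (-n) * expFactor v r y n z
    * theta4 (mu v r y n z - 1 / 2 * Complex.I * v - 2 * r) (modulus y)

/-- The function `G̃ₙ(z)`. -/
def tauGtilde (v r y : ℝ) (n : ℤ) (z : ℂ) : ℂ :=
  -Complex.I * alpha2 r y * (theta1 (Complex.I * v) (modulus y) / theta3 0 (modulus y))
    * expFactor v r y n z
    * theta4 (mu v r y n z - 1 / 2 * Complex.I * v) (modulus y)

/-! ### Frame and position vectors in terms of values of tau functions -/

open scoped ComplexConjugate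

/-- The tangent vector. -/
def tangentVec (f g : ℂ) : Fin 3 → ℂ :=
  (1 / (f * conj f + g * conj g)) •
    ![conj f * g + f * conj g,
      1 / Complex.I * (conj f * g - f * conj g),
      f * conj f - g * conj g]

/-- The normal vector. -/
def normalVec (f g ρ : ℂ) : Fin 3 → ℂ :=
  (1 / (f * conj f + g * conj g)) •
    ![(conj f ^ 2 - conj g ^ 2) * ρ + (f ^ 2 - g ^ 2) * conj ρ,
      1 / Complex.I * ((conj f ^ 2 + conj g ^ 2) * ρ - (f ^ 2 + g ^ 2) * conj ρ),
      -2 * (conj f * conj g * ρ + f * g * conj ρ)]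

/-- The binormal vector. -/
def binormalVec (f g ρ : ℂ) : Fin 3 → ℂ :=
  (1 / (f * conj f + g * conj g)) •
    ![1 / Complex.I * (-(conj f ^ 2 - conj g ^ 2) * ρ + (f ^ 2 - g ^ 2) * conj ρ),
      (conj f ^ 2 + conj g ^ 2) * ρ + (f ^ 2 + g ^ 2) * conj ρ,
      2 / Complex.I * (conj f * conj g * ρ - f * g * conj ρ)]

/-- The position vector of the `n`-th vertex; `L` stands for `∂ log Fₙ / ∂z`. -/
def positionVec (n : ℤ) (H F L : ℂ) : Fin 3 → ℂ :=
  ![(H + conj H) / F, 1 / Complex.I * ((H - conj H) / F), n - 2 * L]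

/-! ### Discrete curves, frames and Kaleidocycles -/

/-- Euclidean three-space. -/
abbrev E3 : Type := EuclideanSpace ℝ (Fin 3)

/-- The cross product on Euclidean three-space. -/
def cross (a b : E3) : E3 := WithLp.toLp 2 (crossProduct a.ofLp b.ofLp)

/-- The matrix `[T, N, B]` with the three given columns. -/
def frameMatrix (T N B : E3) : Matrix (Fin 3) (Fin 3) ℝ :=
  !![T 0, N 0, B 0; T 1, N 1, B 1; T 2, N 2, B 2]

/-- `M₁(θ)`. -/
def M1 (θ : ℝ) : Matrix (Fin 3) (Fin 3) ℝ :=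
  !![1, 0, 0; 0, Real.cos θ, -Real.sin θ; 0, Real.sin θ, Real.cos θ]

/-- `M₃(θ)`. -/
def M3 (θ : ℝ) : Matrix (Fin 3) (Fin 3) ℝ :=
  !![Real.cos θ, -Real.sin θ, 0; Real.sin θ, Real.cos θ, 0; 0, 0, 1]

/-- `γ` is a discrete curve with tangents `T`, and `[T, N, B]` is a discrete Frenet frame of it in
`SO(3)` with signed curvature angles `κₙ ∈ (-π, π)` and constant (signed) torsion angle `lam`:
`Φₙ₊₁ = Φₙ M₁(-lam) M₃(κₙ₊₁)`. -/
structure HasConstantTorsion (γ T N B : ℤ → E3) (lam : ℝ) : Prop where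
  tangent : ∀ n, γ (n + 1) - γ n = T n
  frame : ∀ n, frameMatrix (T n) (N n) (B n) ∈ Matrix.specialOrthogonalGroup (Fin 3) ℝ
  frenet : ∃ κ : ℤ → ℝ, (∀ n, -Real.pi < κ n ∧ κ n < Real.pi) ∧
    ∀ n, frameMatrix (T (n + 1)) (N (n + 1)) (B (n + 1))
      = frameMatrix (T n) (N n) (B n) * (M1 (-lam) * M3 (κ (n + 1)))

/-- `γ` has unit segment length. -/
def IsUnitLength (γ : ℤ → E3) : Prop := ∀ n, ‖γ (n + 1) - γ n‖ = 1

/-- `γ` is closed with period `k`. -/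
def IsClosedWithPeriod (γ : ℤ → E3) (k : ℕ) : Prop := ∀ n, γ (n + k) = γ n

/-- `(B₀, …, B_k)` is a point of the configuration space of `k`-Kaleidocycles with torsion
angle `lam ∈ (0, π)`. -/
structure IsKaleidocycle (k : ℕ) (lam : ℝ) (B : Fin (k + 1) → E3) : Prop where
  angle_pos : 0 < lam
  angle_lt_pi : lam < Real.pi
  unit : ∀ i, ‖B i‖ = 1
  angle : ∀ i : Fin k, inner ℝ (B i.castSucc) (B i.succ) = Real.cos lam
  balance : ∑ i : Fin k, cross (B i.succ) (B i.castSucc) = 0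
  ends : B (Fin.last k) = B 0 ∨ B (Fin.last k) = -B 0

/-! ### The closure conditions -/

/-- `Λ = exp (πi m (4r + 1)) (R₁ R₃)⁻ᵏ - 1`. -/
def closureLambda (k : ℕ) (m : ℤ) (v y r : ℝ) : ℂ :=
  Complex.exp (Real.pi * Complex.I * m * (4 * r + 1)) * (R1 v r y * R3 v r y) ^ (-(k : ℤ)) - 1

/-- `Ξ = ((Δ₃ + Δ₁) k - 4πi m) / (Δ₃ - Δ₁)`. -/
def closureXi (k : ℕ) (m : ℤ) (v y r : ℝ) : ℂ :=
  ((Delta3 v r y + Delta1 v r y) * k - 4 * Real.pi * Complex.I * m)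
    / (Delta3 v r y - Delta1 v r y)

end Kaleidocycle

end

/-! Everything rests on quadratic relations between theta functions. Splitting `ℤ × ℤ` by parity
turns a product of theta values at `x + z` and `x - z` with modulus `iy` into a bilinear form in
theta values with modulus `2iy` (`thetaChar_mul_thetaChar`). The three-term relations
`theta_three_term_3214` and `theta_three_term_1234` are then Plücker relations among vectors in a
plane.

They produce the curve: `qₙ = Fₙ Fₙ₊₁` (`tauSmall_norm_sq`), the increment of `Hₙ / Fₙ` is `fₙ* gₙ /
qₙ` (`position_planar_step`), and differentiating the relation behind the first formula in the half
step `iv/2` gives the increment of the third coordinate (`position_axial_step`). So the edge `γₙ₊₁ -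
γₙ` is the image `Tₙ` of the spinor `(fₙ, gₙ)` under the Hopf map.

For the torsion, `ρₙ = (i/2)(R₃/R₁)ⁿ` has modulus `1/2` and satisfies `ρₙ₊₁ = ρₙ e^{-iλ}`, while a
change of phase of `ρ` rotates `N` and `B` about `T`. The crux is `binormalVec_rho_succ`: the
spinors of edges `n` and `n + 1`, used with the same `ρₙ₊₁`, give the same binormal, because both
have one closed form in theta values at the common vertex. Hence `Bₙ₊₁ = sin λ Nₙ + cos λ Bₙ`, and
what is left of the frame change is a rotation in the plane of `T` and `N`. Its angle is not `π`
because consecutive spinors are not orthogonal (`tauSmall_inner_ne_zero`).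

Nondegeneracy comes from locating the zeros of `ϑ₁` (`thetaZerosInLattice`): for `y ≥ 1` one term of
the sine series dominates, and smaller `y` follow by doubling. This also yields `ϑ₁'(0) ≠ 0`, `Δ₃ ≠
Δ₁` and `λ ≠ 0, π`.

For closure, `kv = my` makes `n ↦ n + k` a shift by `m` quasi-periods. The multipliers of `Hₙ / Fₙ`
cancel when `Λ = 0`, and the third coordinate changes by `-Ξ`. The binormal picks up the sign
`(-1)ᵐ`, and the Kaleidocycle balance sum telescopes because `Bₙ₊₁ × Bₙ = sin λ (γₙ₊₁ - γₙ)`. The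
two forms of the closure conditions agree because the logarithmic derivative of `Λ + 1` in `r` is
`-(Δ₃ - Δ₁) Ξ`. -/

namespace Kaleidocycle

/-! ### Theta functions with characteristics -/

/-- The theta function with characteristics `a`, `b` and modulus `i y`. -/
noncomputable def thetaChar (a b x : ℂ) (y : ℝ) : ℂ :=
  ∑' n : ℤ, Complex.exp (-Real.pi * y * (n + a) ^ 2 + 2 * Real.pi * Complex.I * (n + a) * (x + b))

/-- Expanding `(n + a)²` splits off a factor free of `n` and shifts the argument by `iya`.
Summability and differentiability are then inherited from `jacobiTheta₂`. -/
theorem exp_char_eq_jacobiTheta₂_term (a b x : ℂ) (y : ℝ) (n : ℤ) :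
    Complex.exp (-Real.pi * y * (n + a) ^ 2 + 2 * Real.pi * Complex.I * (n + a) * (x + b)) =
      Complex.exp (-Real.pi * y * a ^ 2 + 2 * Real.pi * Complex.I * a * (x + b)) *
        jacobiTheta₂_term n (x + b + Complex.I * y * a) (Complex.I * y) := by
  rw [jacobiTheta₂_term, ← Complex.exp_add]
  congr 1
  linear_combination (-2 * Real.pi * n * y * a - Real.pi * n ^ 2 * y) * Complex.I_sq

theorem I_mul_im_pos {y : ℝ} (hy : 0 < y) : 0 < (Complex.I * y : ℂ).im := by simpa using hy

theorem thetaChar_eq_jacobiTheta₂ (a b x : ℂ) (y : ℝ) :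
    thetaChar a b x y =
      Complex.exp (-Real.pi * y * a ^ 2 + 2 * Real.pi * Complex.I * a * (x + b)) *
        jacobiTheta₂ (x + b + Complex.I * y * a) (Complex.I * y) := by
  rw [thetaChar, jacobiTheta₂, ← tsum_mul_left]
  exact tsum_congr fun n => exp_char_eq_jacobiTheta₂_term a b x y n

theorem summable_thetaChar (a b x : ℂ) {y : ℝ} (hy : 0 < y) :
    Summable fun n : ℤ => Complex.exp
      (-Real.pi * y * (n + a) ^ 2 + 2 * Real.pi * Complex.I * (n + a) * (x + b)) := by
  simp_rw [exp_char_eq_jacobiTheta₂_term]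
  exact ((summable_jacobiTheta₂_term_iff _ _).2 (I_mul_im_pos hy)).mul_left _

theorem differentiable_thetaChar (a b : ℂ) {y : ℝ} (hy : 0 < y) :
    Differentiable ℂ fun x => thetaChar a b x y := by
  intro x
  simp_rw [thetaChar_eq_jacobiTheta₂]
  refine DifferentiableAt.mul (by fun_prop) ?_
  exact (differentiableAt_jacobiTheta₂_fst _ (I_mul_im_pos hy)).comp x
    (f := fun x => x + b + Complex.I * y * a) (by fun_prop)

theorem thetaChar_add_int_left (a b x : ℂ) (y : ℝ) (m : ℤ) :
    thetaChar (a + m) b x y = thetaChar a b x y := by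
  rw [thetaChar, thetaChar, ← (Equiv.addRight m).tsum_eq
    (fun n : ℤ => Complex.exp
      (-Real.pi * y * (n + a) ^ 2 + 2 * Real.pi * Complex.I * (n + a) * (x + b)))]
  refine tsum_congr fun n => ?_
  congr 1
  simp only [Equiv.coe_addRight]
  push_cast
  ring

theorem thetaChar_neg (a b x : ℂ) (y : ℝ) :
    thetaChar a b (-x) y = thetaChar (-a) (-b) x y := by
  rw [thetaChar, thetaChar, ← (Equiv.neg ℤ).tsum_eq]
  refine tsum_congr fun n => ?_
  congr 1
  simp only [Equiv.neg_apply]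
  push_cast
  ring

theorem exp_two_pi_I_mul_int_add (n : ℤ) (a c : ℂ) :
    Complex.exp (c + 2 * Real.pi * Complex.I * (n + a)) =
      Complex.exp (2 * Real.pi * Complex.I * a) * Complex.exp c := by
  rw [← Complex.exp_add, Complex.exp_eq_exp_iff_exists_int]
  exact ⟨n, by ring⟩

theorem thetaChar_arg_add_one (a b x : ℂ) (y : ℝ) :
    thetaChar a b (x + 1) y = Complex.exp (2 * Real.pi * Complex.I * a) * thetaChar a b x y := by
  rw [thetaChar, thetaChar, ← tsum_mul_left]
  refine tsum_congr fun n => ?_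
  rw [← exp_two_pi_I_mul_int_add n]
  congr 1
  ring

theorem thetaChar_add_one_right (a b x : ℂ) (y : ℝ) :
    thetaChar a (b + 1) x y = Complex.exp (2 * Real.pi * Complex.I * a) * thetaChar a b x y := by
  rw [← thetaChar_arg_add_one, thetaChar, thetaChar]
  refine tsum_congr fun n => ?_
  congr 1
  ring

/-- Completing the square: a shift by `c` periods is absorbed by the characteristic `a`. Integral
`c` gives quasi-periodicity, and `c = 1/2` passes between the four theta functions. -/
theorem thetaChar_add_modulus (a b x c : ℂ) (y : ℝ) :
    thetaChar a b (x + c * (Complex.I * y)) y =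
      Complex.exp (Real.pi * y * c ^ 2 - 2 * Real.pi * Complex.I * c * (x + b)) *
        thetaChar (a + c) b x y := by
  rw [thetaChar, thetaChar, ← tsum_mul_left]
  refine tsum_congr fun n => ?_
  rw [← Complex.exp_add]
  congr 1
  linear_combination (2 * Real.pi * (n + a) * c * y) * Complex.I_sq

/-- Sums over `ℤ × ℤ` split according to the parity of the difference of the coordinates. -/
theorem hasSum_int_prod_parity {f : ℤ × ℤ → ℂ} {A B : ℂ}
    (h₀ : HasSum (fun p : ℤ × ℤ => f (p.1 + p.2, p.1 - p.2)) A)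
    (h₁ : HasSum (fun p : ℤ × ℤ => f (p.1 + p.2 + 1, p.1 - p.2)) B) : HasSum f (A + B) := by
  have i₀ : Function.Injective fun p : ℤ × ℤ => (p.1 + p.2, p.1 - p.2) := by
    rintro ⟨a, b⟩ ⟨c, d⟩ h
    simp only [Prod.mk.injEq] at h ⊢
    omega
  have i₁ : Function.Injective fun p : ℤ × ℤ => (p.1 + p.2 + 1, p.1 - p.2) := by
    rintro ⟨a, b⟩ ⟨c, d⟩ h
    simp only [Prod.mk.injEq] at h ⊢
    omega
  refine (i₀.hasSum_range_iff.2 h₀).add_isCompl ?_ (i₁.hasSum_range_iff.2 h₁)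
  constructor
  · rw [Set.disjoint_left]
    rintro _ ⟨⟨a, b⟩, rfl⟩ ⟨⟨c, d⟩, h⟩
    simp only [Prod.mk.injEq] at h
    omega
  · rw [codisjoint_iff_le_sup]
    rintro ⟨a, b⟩ -
    rcases Int.even_or_odd' (a + b) with ⟨c, h | h⟩
    · exact Or.inl ⟨(c, a - c), by simp only [Prod.mk.injEq]; omega⟩
    · exact Or.inr ⟨(c, a - c - 1), by simp only [Prod.mk.injEq]; omega⟩

theorem hasSum_mul_of_summable {f g : ℤ → ℂ} (hf : Summable f) (hg : Summable g) :
    HasSum (fun p : ℤ × ℤ => f p.1 * g p.2) ((∑' n, f n) * ∑' n, g n) := by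
  rw [tsum_mul_tsum_of_summable_norm hf.norm hg.norm]
  exact (summable_mul_of_summable_norm hf.norm hg.norm).hasSum

/-- The addition formula expressing products of theta functions by theta functions of twice the
modulus. -/
theorem thetaChar_mul_thetaChar (a b a' b' x z : ℂ) {y : ℝ} (hy : 0 < y) :
    thetaChar a b (x + z) y * thetaChar a' b' (x - z) y =
      thetaChar ((a + a') / 2) (b + b') (2 * x) (2 * y) *
          thetaChar ((a - a') / 2) (b - b') (2 * z) (2 * y) +
        thetaChar ((a + a' + 1) / 2) (b + b') (2 * x) (2 * y) *
          thetaChar ((a - a' + 1) / 2) (b - b') (2 * z) (2 * y) := by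
  have h2 : 0 < 2 * y := by positivity
  have h := hasSum_mul_of_summable (summable_thetaChar a b (x + z) hy)
    (summable_thetaChar a' b' (x - z) hy)
  have h₀ := hasSum_mul_of_summable (summable_thetaChar ((a + a') / 2) (b + b') (2 * x) h2)
    (summable_thetaChar ((a - a') / 2) (b - b') (2 * z) h2)
  have h₁ := hasSum_mul_of_summable (summable_thetaChar ((a + a' + 1) / 2) (b + b') (2 * x) h2)
    (summable_thetaChar ((a - a' + 1) / 2) (b - b') (2 * z) h2)
  simp only [← Complex.exp_add] at h h₀ h₁
  simp only [thetaChar]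
  -- With indices `(p + q, p - q)` the parallelogram identity replaces the two squares by `2(p +
  -- (a+a')/2)² + 2(q + (a-a')/2)²`, so the double sum separates. The other parity class adds `1/2`
  -- to both characteristics.
  refine h.unique (hasSum_int_prod_parity ?_ ?_)
  · convert h₀ using 3
    push_cast
    ring
  · convert h₁ using 3
    push_cast
    ring

/-! ### The four theta functions at modulus `i y` -/

theorem theta1_eq (x : ℂ) (y : ℝ) : theta1 x (modulus y) = -thetaChar (1 / 2) (1 / 2) x y := by
  rw [theta1, thetaChar, modulus]
  congr 1
  refine tsum_congr fun n => ?_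
  congr 1
  linear_combination Real.pi * y * (n + 1 / 2) ^ 2 * Complex.I_sq

theorem theta2_eq (x : ℂ) (y : ℝ) : theta2 x (modulus y) = thetaChar (1 / 2) 0 x y := by
  rw [theta2, thetaChar, modulus]
  refine tsum_congr fun n => ?_
  congr 1
  linear_combination Real.pi * y * (n + 1 / 2) ^ 2 * Complex.I_sq

theorem theta3_eq (x : ℂ) (y : ℝ) : theta3 x (modulus y) = thetaChar 0 0 x y := by
  rw [theta3, thetaChar, modulus]
  refine tsum_congr fun n => ?_
  congr 1
  linear_combination Real.pi * y * n ^ 2 * Complex.I_sq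

theorem theta4_eq (x : ℂ) (y : ℝ) : theta4 x (modulus y) = thetaChar 0 (1 / 2) x y := by
  rw [theta4, thetaChar, modulus]
  refine tsum_congr fun n => ?_
  congr 1
  linear_combination Real.pi * y * n ^ 2 * Complex.I_sq

theorem exp_two_pi_I_half : Complex.exp (2 * Real.pi * Complex.I * (1 / 2)) = -1 := by
  rw [← Complex.exp_pi_mul_I]
  congr 1
  ring

theorem thetaChar_half_add_one (b x : ℂ) (y : ℝ) :
    thetaChar (1 / 2) (b + 1) x y = -thetaChar (1 / 2) b x y := by
  rw [thetaChar_add_one_right, exp_two_pi_I_half, neg_one_mul]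

theorem thetaChar_zero_add_one (b x : ℂ) (y : ℝ) :
    thetaChar 0 (b + 1) x y = thetaChar 0 b x y := by
  rw [thetaChar_add_one_right]
  simp

theorem thetaChar_one (b x : ℂ) (y : ℝ) : thetaChar 1 b x y = thetaChar 0 b x y := by
  simpa using thetaChar_add_int_left 0 b x y 1

theorem thetaChar_neg_half (b x : ℂ) (y : ℝ) :
    thetaChar (-(1 / 2)) b x y = thetaChar (1 / 2) b x y := by
  rw [← thetaChar_add_int_left (-(1 / 2)) b x y 1]
  norm_num

section

variable {y : ℝ} (x z : ℂ)

theorem differentiable_theta1 (hy : 0 < y) : Differentiable ℂ fun x => theta1 x (modulus y) := by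
  simp_rw [theta1_eq]
  exact (differentiable_thetaChar _ _ hy).neg

theorem differentiable_theta2 (hy : 0 < y) : Differentiable ℂ fun x => theta2 x (modulus y) := by
  simp_rw [theta2_eq]
  exact differentiable_thetaChar _ _ hy

theorem differentiable_theta3 (hy : 0 < y) : Differentiable ℂ fun x => theta3 x (modulus y) := by
  simp_rw [theta3_eq]
  exact differentiable_thetaChar _ _ hy

theorem differentiable_theta4 (hy : 0 < y) : Differentiable ℂ fun x => theta4 x (modulus y) := by
  simp_rw [theta4_eq]
  exact differentiable_thetaChar _ _ hy

/-! ### Parity and periodicity -/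

theorem theta1_neg : theta1 (-x) (modulus y) = -theta1 x (modulus y) := by
  have h := thetaChar_half_add_one (-(1 / 2)) x y
  norm_num at h
  rw [theta1_eq, theta1_eq, thetaChar_neg, thetaChar_neg_half]
  norm_num
  rw [h]

theorem theta2_neg : theta2 (-x) (modulus y) = theta2 x (modulus y) := by
  rw [theta2_eq, theta2_eq, thetaChar_neg, thetaChar_neg_half, neg_zero]

theorem theta3_neg : theta3 (-x) (modulus y) = theta3 x (modulus y) := by
  rw [theta3_eq, theta3_eq, thetaChar_neg, neg_zero]

theorem theta4_neg : theta4 (-x) (modulus y) = theta4 x (modulus y) := by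
  have h := thetaChar_zero_add_one (-(1 / 2)) x y
  norm_num at h
  rw [theta4_eq, theta4_eq, thetaChar_neg, neg_zero]
  norm_num
  rw [h]

theorem theta1_zero : theta1 0 (modulus y) = 0 := by
  have h := theta1_neg (y := y) 0
  rw [neg_zero] at h
  exact self_eq_neg.1 h

theorem theta1_add_one : theta1 (x + 1) (modulus y) = -theta1 x (modulus y) := by
  rw [theta1_eq, theta1_eq, thetaChar_arg_add_one, exp_two_pi_I_half, neg_one_mul]

theorem thetaChar_arg_add (a b c x : ℂ) (y : ℝ) :
    thetaChar a b (x + c) y = thetaChar a (b + c) x y := by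
  rw [thetaChar, thetaChar]
  refine tsum_congr fun n => ?_
  congr 1
  ring

theorem theta1_add_half : theta1 (x + 1 / 2) (modulus y) = theta2 x (modulus y) := by
  have h := thetaChar_half_add_one 0 x y
  rw [theta1_eq, theta2_eq, thetaChar_arg_add, ← neg_eq_iff_eq_neg.2 h]
  norm_num

theorem theta2_add_half : theta2 (x + 1 / 2) (modulus y) = -theta1 x (modulus y) := by
  rw [theta1_eq, theta2_eq, thetaChar_arg_add, neg_neg, zero_add]

theorem theta3_add_half : theta3 (x + 1 / 2) (modulus y) = theta4 x (modulus y) := by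
  rw [theta3_eq, theta4_eq, thetaChar_arg_add, zero_add]

theorem theta4_add_half : theta4 (x + 1 / 2) (modulus y) = theta3 x (modulus y) := by
  have h := thetaChar_zero_add_one 0 x y
  rw [theta3_eq, theta4_eq, thetaChar_arg_add, ← h]
  norm_num

theorem theta1_add_modulus (m : ℤ) : theta1 (x + m * modulus y) (modulus y) =
    Complex.exp (Real.pi * y * m ^ 2 - 2 * Real.pi * Complex.I * m * (x + 1 / 2)) *
      theta1 x (modulus y) := by
  rw [theta1_eq, theta1_eq, modulus, thetaChar_add_modulus, thetaChar_add_int_left, mul_neg]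

theorem theta2_add_modulus (m : ℤ) : theta2 (x + m * modulus y) (modulus y) =
    Complex.exp (Real.pi * y * m ^ 2 - 2 * Real.pi * Complex.I * m * x) *
      theta2 x (modulus y) := by
  rw [theta2_eq, theta2_eq, modulus, thetaChar_add_modulus, thetaChar_add_int_left, add_zero]

theorem theta4_add_modulus (m : ℤ) : theta4 (x + m * modulus y) (modulus y) =
    Complex.exp (Real.pi * y * m ^ 2 - 2 * Real.pi * Complex.I * m * (x + 1 / 2)) *
      theta4 x (modulus y) := by
  rw [theta4_eq, theta4_eq, modulus, thetaChar_add_modulus, thetaChar_add_int_left]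

theorem theta4_add_half_modulus : theta4 (x + 1 / 2 * modulus y) (modulus y) =
    -Complex.exp (Real.pi * y * (1 / 2) ^ 2 - 2 * Real.pi * Complex.I * (1 / 2) * (x + 1 / 2)) *
      theta1 x (modulus y) := by
  rw [theta4_eq, theta1_eq, modulus, thetaChar_add_modulus, zero_add, neg_mul_neg]

/-! ### Complex conjugation -/

open scoped ComplexConjugate

theorem conj_thetaChar (a b : ℝ) (x : ℂ) (y : ℝ) :
    conj (thetaChar a b x y) = thetaChar (-a) b (conj x) y := by
  rw [thetaChar, thetaChar, Complex.conj_tsum, ← (Equiv.neg ℤ).tsum_eq]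
  refine tsum_congr fun n => ?_
  rw [← Complex.exp_conj]
  congr 1
  simp [Complex.conj_ofNat]
  ring

theorem conj_theta1 : conj (theta1 x (modulus y)) = theta1 (conj x) (modulus y) := by
  have h := conj_thetaChar (1 / 2) (1 / 2) x y
  push_cast at h
  rw [theta1_eq, theta1_eq, map_neg, h, thetaChar_neg_half]

theorem conj_theta2 : conj (theta2 x (modulus y)) = theta2 (conj x) (modulus y) := by
  have h := conj_thetaChar (1 / 2) 0 x y
  push_cast at h
  rw [theta2_eq, theta2_eq, h, thetaChar_neg_half]

theorem conj_theta3 : conj (theta3 x (modulus y)) = theta3 (conj x) (modulus y) := by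
  have h := conj_thetaChar 0 0 x y
  push_cast at h
  rw [theta3_eq, theta3_eq, h, neg_zero]

theorem conj_theta4 : conj (theta4 x (modulus y)) = theta4 (conj x) (modulus y) := by
  have h := conj_thetaChar 0 (1 / 2) x y
  push_cast at h
  rw [theta4_eq, theta4_eq, h, neg_zero]

/-! ### Addition formulas with doubled modulus -/

/-- This and the next five products are instances of `thetaChar_mul_thetaChar`. Resulting
characteristics outside `{0, 1/2}` are reduced by periodicity, which is where the minus signs arise.
-/
theorem theta1_mul_theta1 (hy : 0 < y) :
    theta1 (x + z) (modulus y) * theta1 (x - z) (modulus y) =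
      theta3 (2 * x) (modulus (2 * y)) * theta2 (2 * z) (modulus (2 * y)) -
        theta2 (2 * x) (modulus (2 * y)) * theta3 (2 * z) (modulus (2 * y)) := by
  have h := thetaChar_mul_thetaChar (1 / 2) (1 / 2) (1 / 2) (1 / 2) x z hy
  have h₁ := thetaChar_half_add_one 0 (2 * x) (2 * y)
  have h₂ := thetaChar_zero_add_one 0 (2 * x) (2 * y)
  have h₃ := thetaChar_one 1 (2 * x) (2 * y)
  norm_num at h h₁ h₂ h₃
  simp only [theta1_eq, theta2_eq, theta3_eq, neg_mul_neg]
  norm_num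
  rw [h, h₁, h₃, h₂]
  ring

theorem theta2_mul_theta2 (hy : 0 < y) :
    theta2 (x + z) (modulus y) * theta2 (x - z) (modulus y) =
      theta2 (2 * x) (modulus (2 * y)) * theta3 (2 * z) (modulus (2 * y)) +
        theta3 (2 * x) (modulus (2 * y)) * theta2 (2 * z) (modulus (2 * y)) := by
  have h := thetaChar_mul_thetaChar (1 / 2) 0 (1 / 2) 0 x z hy
  have h₃ := thetaChar_one 0 (2 * x) (2 * y)
  norm_num at h h₃
  simp only [theta2_eq, theta3_eq]
  norm_num
  rw [h, h₃]

theorem theta3_mul_theta3 (hy : 0 < y) :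
    theta3 (x + z) (modulus y) * theta3 (x - z) (modulus y) =
      theta3 (2 * x) (modulus (2 * y)) * theta3 (2 * z) (modulus (2 * y)) +
        theta2 (2 * x) (modulus (2 * y)) * theta2 (2 * z) (modulus (2 * y)) := by
  have h := thetaChar_mul_thetaChar 0 0 0 0 x z hy
  norm_num at h
  simp only [theta2_eq, theta3_eq]
  norm_num
  rw [h]

theorem theta4_mul_theta4 (hy : 0 < y) :
    theta4 (x + z) (modulus y) * theta4 (x - z) (modulus y) =
      theta3 (2 * x) (modulus (2 * y)) * theta3 (2 * z) (modulus (2 * y)) -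
        theta2 (2 * x) (modulus (2 * y)) * theta2 (2 * z) (modulus (2 * y)) := by
  have h := thetaChar_mul_thetaChar 0 (1 / 2) 0 (1 / 2) x z hy
  have h₁ := thetaChar_half_add_one 0 (2 * x) (2 * y)
  have h₂ := thetaChar_zero_add_one 0 (2 * x) (2 * y)
  norm_num at h h₁ h₂
  simp only [theta2_eq, theta3_eq, theta4_eq]
  norm_num
  rw [h, h₁, h₂]
  ring

theorem theta1_mul_theta2 (hy : 0 < y) :
    theta1 (x + z) (modulus y) * theta2 (x - z) (modulus y) =
      theta1 (2 * x) (modulus (2 * y)) * theta4 (2 * z) (modulus (2 * y)) +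
        theta4 (2 * x) (modulus (2 * y)) * theta1 (2 * z) (modulus (2 * y)) := by
  have h := thetaChar_mul_thetaChar (1 / 2) (1 / 2) (1 / 2) 0 x z hy
  have h₃ := thetaChar_one (1 / 2) (2 * x) (2 * y)
  norm_num at h h₃
  simp only [theta1_eq, theta2_eq, theta4_eq]
  norm_num
  rw [h, h₃]
  ring

theorem theta3_mul_theta4 (hy : 0 < y) :
    theta3 (x + z) (modulus y) * theta4 (x - z) (modulus y) =
      theta4 (2 * x) (modulus (2 * y)) * theta4 (2 * z) (modulus (2 * y)) -
        theta1 (2 * x) (modulus (2 * y)) * theta1 (2 * z) (modulus (2 * y)) := by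
  have h := thetaChar_mul_thetaChar 0 0 0 (1 / 2) x z hy
  have h₁ := thetaChar_half_add_one (-(1 / 2)) (2 * z) (2 * y)
  have h₂ := thetaChar_zero_add_one (-(1 / 2)) (2 * z) (2 * y)
  norm_num at h h₁ h₂
  simp only [theta1_eq, theta3_eq, theta4_eq]
  norm_num
  rw [h, h₁, h₂]
  ring

end

/-! ### Three-term relations -/

/-- To each argument `t` attach the vector `(ϑ₃(2t), ϑ₂(2t))` at modulus `2iy`. After sign changes
and swaps of entries every product is a 2×2 determinant of two such vectors, and the claim is their
Plücker relation. -/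
theorem theta_three_term_3214 {y : ℝ} (hy : 0 < y) (x u z w : ℂ) :
    theta3 (x + u) (modulus y) * theta3 (x - u) (modulus y) *
          (theta2 (z + w) (modulus y) * theta2 (z - w) (modulus y)) +
        theta1 (w + u) (modulus y) * theta1 (w - u) (modulus y) *
          (theta4 (z + x) (modulus y) * theta4 (z - x) (modulus y)) =
      theta3 (x + w) (modulus y) * theta3 (x - w) (modulus y) *
        (theta2 (z + u) (modulus y) * theta2 (z - u) (modulus y)) := by
  simp only [theta1_mul_theta1 _ _ hy, theta2_mul_theta2 _ _ hy, theta3_mul_theta3 _ _ hy,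
    theta4_mul_theta4 _ _ hy]
  ring

/-- The same Plücker mechanism, now with the vectors `(ϑ₁(2t), ϑ₄(2t))` at modulus `2iy`. -/
theorem theta_three_term_1234 {y : ℝ} (hy : 0 < y) (p q s u : ℂ) :
    theta1 (p - s) (modulus y) * theta2 (p + s) (modulus y) *
          (theta3 (u + q) (modulus y) * theta4 (u - q) (modulus y)) -
        theta1 (p - q) (modulus y) * theta2 (p + q) (modulus y) *
          (theta3 (u + s) (modulus y) * theta4 (u - s) (modulus y)) =
      theta1 (q - s) (modulus y) * theta2 (q + s) (modulus y) *
        (theta3 (u + p) (modulus y) * theta4 (u - p) (modulus y)) := by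
  have h : ∀ x z, theta1 (x - z) (modulus y) * theta2 (x + z) (modulus y) =
      theta1 (2 * x) (modulus (2 * y)) * theta4 (2 * z) (modulus (2 * y)) -
        theta4 (2 * x) (modulus (2 * y)) * theta1 (2 * z) (modulus (2 * y)) := by
    intro x z
    have := theta1_mul_theta2 x (-z) hy
    rw [mul_neg, theta1_neg, theta4_neg, sub_neg_eq_add, ← sub_eq_add_neg] at this
    rw [this]
    ring
  simp only [h, theta3_mul_theta4 _ _ hy]
  ring

/-- Needed to see that `(R₁/R₃)² ≠ 1`, that is, that the torsion is not degenerate. -/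
theorem theta_three_term_31 {y : ℝ} (hy : 0 < y) (x z : ℂ) :
    theta3 x (modulus y) ^ 2 * theta1 z (modulus y) ^ 2 -
        theta1 x (modulus y) ^ 2 * theta3 z (modulus y) ^ 2 =
      -theta3 0 (modulus y) ^ 2 * (theta1 (x + z) (modulus y) * theta1 (x - z) (modulus y)) := by
  have h₁ := fun x => theta1_mul_theta1 x 0 hy
  have h₃ := fun x => theta3_mul_theta3 x 0 hy
  simp only [add_zero, sub_zero, mul_zero] at h₁ h₃
  simp only [sq, h₁, h₃, neg_mul, mul_zero, theta1_mul_theta1 x z hy]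
  ring

/-! ### Positivity on the imaginary axis -/

/-- For real `a` and `b = 0`, every term on the imaginary axis is the exponential of a real number.
This is the source of the positivity of `Fₙ(0)`. -/
theorem thetaChar_imaginary_pos (a t : ℝ) {y : ℝ} (hy : 0 < y) :
    ∃ p : ℝ, 0 < p ∧ thetaChar a 0 (Complex.I * t) y = p := by
  have e : ∀ n : ℤ, Complex.exp (-Real.pi * y * (n + (a : ℂ)) ^ 2 +
      2 * Real.pi * Complex.I * (n + (a : ℂ)) * (Complex.I * t + 0)) =
      ((Real.exp (-Real.pi * y * (n + a) ^ 2 - 2 * Real.pi * (n + a) * t) : ℝ) : ℂ) := by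
    intro n
    rw [Complex.ofReal_exp]
    congr 1
    push_cast
    linear_combination (2 * Real.pi * (n + a) * t) * Complex.I_sq
  have h := summable_thetaChar a 0 (Complex.I * t) hy
  simp_rw [e] at h
  refine ⟨∑' n : ℤ, Real.exp (-Real.pi * y * (n + a) ^ 2 - 2 * Real.pi * (n + a) * t), ?_, ?_⟩
  · exact (Complex.summable_ofReal.1 h).tsum_pos (fun n => (Real.exp_pos _).le) 0 (Real.exp_pos _)
  · rw [thetaChar, Complex.ofReal_tsum]
    exact tsum_congr e

theorem theta2_imaginary_pos (t : ℝ) {y : ℝ} (hy : 0 < y) :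
    ∃ p : ℝ, 0 < p ∧ theta2 (Complex.I * t) (modulus y) = p := by
  have h := thetaChar_imaginary_pos (1 / 2) t hy
  push_cast at h
  rwa [theta2_eq]

theorem theta3_imaginary_pos (t : ℝ) {y : ℝ} (hy : 0 < y) :
    ∃ p : ℝ, 0 < p ∧ theta3 (Complex.I * t) (modulus y) = p := by
  have h := thetaChar_imaginary_pos 0 t hy
  push_cast at h
  rwa [theta3_eq]

theorem theta2_zero_ne_zero {y : ℝ} (hy : 0 < y) : theta2 0 (modulus y) ≠ 0 := by
  obtain ⟨p, hp, h⟩ := theta2_imaginary_pos 0 hy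
  rw [Complex.ofReal_zero, mul_zero] at h
  rw [h]
  exact_mod_cast hp.ne'

theorem theta3_zero_ne_zero {y : ℝ} (hy : 0 < y) : theta3 0 (modulus y) ≠ 0 := by
  obtain ⟨p, hp, h⟩ := theta3_imaginary_pos 0 hy
  rw [Complex.ofReal_zero, mul_zero] at h
  rw [h]
  exact_mod_cast hp.ne'

/-! ### Zeros of the theta functions -/

/-- The tail is at most `‖f 0‖ r / (1 - r)`, which for `r < 1/2` is too small to cancel a nonzero
leading term. -/
theorem eq_zero_of_hasSum_zero_of_geometric {f : ℕ → ℂ} {r : ℝ} (hr : 0 ≤ r) (hr' : r < 1 / 2)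
    (hf : HasSum f 0) (h : ∀ n, ‖f n‖ ≤ ‖f 0‖ * r ^ n) : f 0 = 0 := by
  have h1 : HasSum (fun n => f (n + 1)) (-f 0) := by
    rw [hasSum_nat_add_iff 1]
    simpa using hf
  have h2 : HasSum (fun n => ‖f 0‖ * r ^ (n + 1)) (‖f 0‖ * (r * (1 - r)⁻¹)) := by
    simp_rw [pow_succ']
    exact ((hasSum_geometric_of_lt_one hr (by linarith)).mul_left _).mul_left _
  have h3 := tsum_of_norm_bounded h2 fun n => h (n + 1)
  rw [h1.tsum_eq, norm_neg] at h3
  have h4 : r * (1 - r)⁻¹ < 1 := by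
    rw [← div_eq_mul_inv, div_lt_one (by linarith)]
    linarith
  have h5 := norm_nonneg (f 0)
  exact norm_eq_zero.1 (by nlinarith)

/-- Each step adds `2 cos((2n+2)w) sin w`. Keeping the factor `sin w` allows the harmonics to be
compared with the first term even near its zeros. -/
theorem norm_sin_odd_mul_le (w : ℂ) (n : ℕ) :
    ‖Complex.sin ((2 * n + 1) * w)‖ ≤
      (2 * n + 1) * Real.exp (2 * n * |w.im|) * ‖Complex.sin w‖ := by
  induction n with
  | zero => simp
  | succ n ih =>
    have e : Complex.sin ((2 * (n + 1 : ℕ) + 1) * w) =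
        Complex.sin ((2 * n + 1) * w) + 2 * Complex.cos ((2 * (n + 1 : ℕ)) * w) * Complex.sin w := by
      have := Complex.sin_sub_sin ((2 * (n + 1 : ℕ) + 1) * w) ((2 * n + 1) * w)
      rw [← sub_eq_iff_eq_add', this]
      push_cast
      ring_nf
    have hc : ‖2 * Complex.cos ((2 * (n + 1 : ℕ)) * w)‖ ≤
        2 * Real.exp (2 * (n + 1 : ℕ) * |w.im|) := by
      rw [Complex.two_cos]
      refine (norm_add_le _ _).trans ?_
      rw [Complex.norm_exp, Complex.norm_exp, two_mul (Real.exp _)]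
      have hn : (0 : ℝ) ≤ 2 * (n + 1 : ℕ) := by positivity
      refine add_le_add (Real.exp_le_exp.2 ?_) (Real.exp_le_exp.2 ?_)
      · have := mul_le_mul_of_nonneg_left (neg_abs_le w.im) hn
        simp at this ⊢
        linarith
      · have := mul_le_mul_of_nonneg_left (le_abs_self w.im) hn
        simp at this ⊢
        linarith
    rw [e]
    refine (norm_add_le _ _).trans ?_
    rw [norm_mul]
    have h1 : Real.exp (2 * n * |w.im|) ≤ Real.exp (2 * (n + 1 : ℕ) * |w.im|) := by
      apply Real.exp_le_exp.2
      push_cast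
      nlinarith [abs_nonneg w.im]
    calc _ ≤ (2 * n + 1) * Real.exp (2 * (n + 1 : ℕ) * |w.im|) * ‖Complex.sin w‖ +
          2 * Real.exp (2 * (n + 1 : ℕ) * |w.im|) * ‖Complex.sin w‖ := by
          gcongr
          exact ih.trans (by gcongr)
      _ = _ := by push_cast; ring

theorem hasSum_theta1 (x : ℂ) {y : ℝ} (hy : 0 < y) :
    HasSum (fun n : ℕ => 2 * (-1) ^ n * Complex.exp (-Real.pi * y * (n + 1 / 2) ^ 2) *
      Complex.sin ((2 * n + 1) * (Real.pi * x))) (theta1 x (modulus y)) := by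
  have h := (summable_thetaChar (1 / 2) (1 / 2) x hy).hasSum
  rw [theta1_eq, thetaChar]
  -- The indices `n` and `-(n + 1)` carry opposite half-integers; pairing them turns exponentials
  -- into sines.
  refine Eq.subst (motive := fun f => HasSum f _) (funext fun n => ?_) h.nat_add_neg_add_one.neg
  have e : ∀ s : ℂ, Complex.exp (Real.pi * Complex.I / 2 * (2 * n + 1) + s) =
      (-1) ^ n * Complex.I * Complex.exp s := by
    intro s
    have : (Real.pi * Complex.I / 2 * (2 * n + 1) : ℂ) =
        n * (Real.pi * Complex.I) + Real.pi / 2 * Complex.I := by ring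
    rw [Complex.exp_add, this, Complex.exp_add, Complex.exp_nat_mul, Complex.exp_pi_mul_I,
      Complex.exp_pi_div_two_mul_I]
  have e' : ∀ s : ℂ, Complex.exp (-(Real.pi * Complex.I / 2 * (2 * n + 1)) + s) =
      -((-1) ^ n * Complex.I) * Complex.exp s := by
    intro s
    have h1 := e (-(Real.pi * Complex.I / 2 * (2 * n + 1)))
    rw [add_neg_cancel, Complex.exp_zero] at h1
    have h2 : ((-1 : ℂ) ^ n * Complex.I) * ((-1) ^ n * Complex.I) = -1 := by
      rw [mul_mul_mul_comm, ← mul_pow, Complex.I_mul_I]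
      simp
    rw [Complex.exp_add]
    linear_combination ((-1) ^ n * Complex.I * Complex.exp s) * h1 +
      Complex.exp (-(Real.pi * Complex.I / 2 * (2 * n + 1))) * Complex.exp s * h2
  have a1 : Complex.exp (-Real.pi * y * (((n : ℕ) : ℤ) + 1 / 2) ^ 2 +
      2 * Real.pi * Complex.I * (((n : ℕ) : ℤ) + 1 / 2) * (x + 1 / 2)) =
      (-1) ^ n * Complex.I * (Complex.exp (-Real.pi * y * (n + 1 / 2) ^ 2) *
        Complex.exp ((2 * n + 1) * (Real.pi * x) * Complex.I)) := by
    rw [← Complex.exp_add, ← e]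
    congr 1
    push_cast
    ring
  have a2 : Complex.exp (-Real.pi * y * (((-(n + 1 : ℕ) : ℤ) : ℂ) + 1 / 2) ^ 2 +
      2 * Real.pi * Complex.I * (((-(n + 1 : ℕ) : ℤ) : ℂ) + 1 / 2) * (x + 1 / 2)) =
      -((-1) ^ n * Complex.I) * (Complex.exp (-Real.pi * y * (n + 1 / 2) ^ 2) *
        Complex.exp (-((2 * n + 1) * (Real.pi * x)) * Complex.I)) := by
    rw [← Complex.exp_add, ← e']
    congr 1
    push_cast
    ring
  have hs := Complex.two_sin ((2 * n + 1) * (Real.pi * x))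
  push_cast at a1 a2 ⊢
  rw [a1, a2]
  linear_combination -(-1) ^ n * Complex.exp (-Real.pi * y * (n + 1 / 2) ^ 2) * hs

theorem exp_neg_pi_lt : Real.exp (-Real.pi) < 1 / 6 := by
  have h : (6 : ℝ) < Real.exp Real.pi := by
    have h1 := Real.pi_gt_three
    have h2 : Real.exp 1 ^ 3 ≤ Real.exp Real.pi := by
      rw [← Real.exp_nat_mul]
      exact Real.exp_le_exp.2 (by push_cast; linarith)
    have h3 := Real.exp_one_gt_d9
    have h4 : (2 : ℝ) ^ 3 < Real.exp 1 ^ 3 := by gcongr; linarith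
    linarith
  rw [Real.exp_neg, one_div]
  exact inv_strictAnti₀ (by norm_num) h

theorem two_mul_add_one_le_three_pow (n : ℕ) : (2 * n + 1 : ℝ) ≤ 3 ^ n := by
  induction n with
  | zero => simp
  | succ n ih =>
    rw [pow_succ]
    push_cast
    linarith [(Nat.cast_nonneg n : (0 : ℝ) ≤ n)]

/-- In this strip the growth `e^{2πn|Im x|}` cancels at most the cross term of `(n + 1/2)²`, leaving
`e^{-πyn²} ≤ e^{-πn}`. With `2n + 1 ≤ 3ⁿ` the sine series is dominated geometrically with ratio
`3e^{-π} < 1/2`, so a zero of `ϑ₁` is a zero of `sin πx`. -/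
theorem theta1_zero_of_abs_im_le {y : ℝ} (hy : 1 ≤ y) {x : ℂ} (hx : |x.im| ≤ y / 2)
    (h : theta1 x (modulus y) = 0) : ∃ j : ℤ, x = j := by
  have hy' : 0 < y := by linarith
  have hs := hasSum_theta1 x hy'
  rw [h] at hs
  have hpi := Real.pi_pos
  have h0 := eq_zero_of_hasSum_zero_of_geometric (r := 3 * Real.exp (-Real.pi)) (by positivity)
    (by linarith [exp_neg_pi_lt]) hs ?_
  · simp only [pow_zero, mul_one, Nat.cast_zero, mul_zero, zero_add, one_mul, mul_eq_zero,
      Complex.exp_ne_zero, or_false, OfNat.ofNat_ne_zero, false_or] at h0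
    obtain ⟨k, hk⟩ := Complex.sin_eq_zero_iff.1 h0
    refine ⟨k, ?_⟩
    have : (Real.pi : ℂ) ≠ 0 := by exact_mod_cast hpi.ne'
    rw [mul_comm] at hk
    exact mul_right_cancel₀ this hk
  · intro n
    have e : ∀ n : ℕ, ‖Complex.exp (-Real.pi * y * (n + 1 / 2) ^ 2)‖ =
        Real.exp (-Real.pi * y * (n + 1 / 2) ^ 2) := by
      intro n
      rw [← Complex.norm_of_nonneg (Real.exp_pos (-Real.pi * y * (n + 1 / 2) ^ 2)).le]
      congr 1
      push_cast
      rfl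
    have h1 := norm_sin_odd_mul_le (Real.pi * x) n
    have him : (Real.pi * x : ℂ).im = Real.pi * x.im := by simp
    rw [him, abs_mul, abs_of_pos hpi] at h1
    have h2 : Real.exp (-Real.pi * y * (n + 1 / 2) ^ 2) *
        Real.exp (2 * n * (Real.pi * |x.im|)) ≤
        Real.exp (-Real.pi * y * (0 + 1 / 2) ^ 2) * Real.exp (-Real.pi) ^ n := by
      rw [← Real.exp_nat_mul, ← Real.exp_add, ← Real.exp_add]
      apply Real.exp_le_exp.2
      have hn : (0 : ℝ) ≤ n := Nat.cast_nonneg n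
      have hn2 : (n : ℝ) ≤ n ^ 2 := by exact_mod_cast Nat.le_self_pow two_ne_zero n
      have h3 : 2 * n * (Real.pi * |x.im|) ≤ 2 * n * (Real.pi * (y / 2)) := by gcongr
      have h4 : Real.pi * n ≤ Real.pi * y * n ^ 2 := by
        calc Real.pi * n = Real.pi * 1 * n := by ring
          _ ≤ Real.pi * y * n ^ 2 := by gcongr
      nlinarith
    simp only [norm_mul, norm_pow, norm_neg, norm_one, one_pow, mul_one, e, pow_zero]
    calc ‖(2 : ℂ)‖ * Real.exp (-Real.pi * y * (n + 1 / 2) ^ 2) *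
          ‖Complex.sin ((2 * n + 1) * (Real.pi * x))‖ ≤
        ‖(2 : ℂ)‖ * Real.exp (-Real.pi * y * (n + 1 / 2) ^ 2) *
          ((2 * n + 1) * Real.exp (2 * n * (Real.pi * |x.im|)) *
            ‖Complex.sin (Real.pi * x)‖) := by gcongr
      _ = ‖(2 : ℂ)‖ * (Real.exp (-Real.pi * y * (n + 1 / 2) ^ 2) *
          Real.exp (2 * n * (Real.pi * |x.im|))) * (2 * n + 1) *
            ‖Complex.sin (Real.pi * x)‖ := by ring
      _ ≤ ‖(2 : ℂ)‖ * (Real.exp (-Real.pi * y * (0 + 1 / 2) ^ 2) * Real.exp (-Real.pi) ^ n) *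
          3 ^ n * ‖Complex.sin (Real.pi * x)‖ := by
        gcongr
        exact two_mul_add_one_le_three_pow n
      _ = _ := by
        rw [mul_pow]
        simp only [Nat.cast_zero, mul_zero, zero_add, one_mul]
        ring

/-- Every zero of `ϑ₁` at modulus `i y` is a lattice point. -/
def ThetaZerosInLattice (y : ℝ) : Prop :=
  ∀ x : ℂ, theta1 x (modulus y) = 0 → ∃ j m : ℤ, x = j + m * modulus y

theorem thetaZerosInLattice_of_one_le {y : ℝ} (hy : 1 ≤ y) : ThetaZerosInLattice y := by
  intro x hx
  have hy' : 0 < y := by linarith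
  have hm := abs_sub_round (x.im / y)
  set m := round (x.im / y)
  have h1 := theta1_add_modulus (y := y) (x - m * modulus y) m
  rw [sub_add_cancel, hx, eq_comm, mul_eq_zero] at h1
  have hm' : |(x - m * modulus y).im| ≤ y / 2 := by
    have e : (x - m * modulus y).im = (x.im / y - m) * y := by
      simp [modulus]
      field_simp
    rw [e, abs_mul, abs_of_pos hy']
    nlinarith
  obtain ⟨j, hj⟩ := theta1_zero_of_abs_im_le hy hm' (h1.resolve_left (Complex.exp_ne_zero _))
  exact ⟨j, m, by rw [← hj]; ring⟩

theorem ne_lattice_of_im {x : ℂ} {y t : ℝ} (hx : x.im = t * y) (hy : 0 < y)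
    (ht : ∀ m : ℤ, t ≠ m) (j m : ℤ) : x ≠ j + m * modulus y := by
  intro h
  have := congrArg Complex.im h
  simp [modulus, hx] at this
  exact ht m (this.resolve_right hy.ne')

/-- A real zero of `ϑ₄` would give a zero of `ϑ₁` with imaginary part `-y/2`, strictly between rows
of the lattice. -/
theorem theta4_zero_ne_zero_of_zeros {y : ℝ} (hy : 0 < y) (h : ThetaZerosInLattice y) (x : ℝ) :
    theta4 x (modulus y) ≠ 0 := by
  intro h0
  have h1 := theta4_add_half_modulus (y := y) (x - 1 / 2 * modulus y)
  rw [sub_add_cancel, h0, eq_comm, mul_eq_zero, neg_eq_zero] at h1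
  obtain ⟨j, m, hjm⟩ := h _ (h1.resolve_left (Complex.exp_ne_zero _))
  refine ne_lattice_of_im (t := -1 / 2) ?_ hy ?_ j m hjm
  · simp [modulus]
    ring
  · intro m hm
    have h2 : (-1 : ℝ) = 2 * m := by linarith
    have h3 : (-1 : ℤ) = 2 * m := by exact_mod_cast h2
    omega

theorem theta1_add_int_eq_zero_iff (x : ℂ) (y : ℝ) (j : ℤ) :
    theta1 (x + j) (modulus y) = 0 ↔ theta1 x (modulus y) = 0 := by
  have h : ∀ x, theta1 (x + 1) (modulus y) = 0 ↔ theta1 x (modulus y) = 0 := by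
    intro x
    rw [theta1_add_one, neg_eq_zero]
  induction j using Int.induction_on with
  | zero => simp
  | succ i ih =>
    refine Iff.trans ?_ ih
    rw [Int.cast_add, Int.cast_one, ← add_assoc, h]
  | pred i ih =>
    refine Iff.trans ?_ ih
    rw [← h (x + _), Int.cast_sub, Int.cast_one, add_assoc, sub_add_cancel]

theorem theta1_add_lattice_eq_zero_iff (x : ℂ) (y : ℝ) (j m : ℤ) :
    theta1 (x + (j + m * modulus y)) (modulus y) = 0 ↔ theta1 x (modulus y) = 0 := by
  rw [← add_assoc, theta1_add_modulus, mul_eq_zero, or_iff_right (Complex.exp_ne_zero _),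
    theta1_add_int_eq_zero_iff]

/-- From `ϑ₁(x) ϑ₂(x) = ϑ₁(2x; 2iy) ϑ₄(0; 2iy)`, a zero `x` of `ϑ₁` has `2x` in the lattice of
modulus `2iy`. The spurious points, congruent to `1/2`, are excluded since `ϑ₁(1/2) = ϑ₂(0) > 0`. -/
theorem ThetaZerosInLattice.of_two_mul {y : ℝ} (hy : 0 < y) (h : ThetaZerosInLattice (2 * y)) :
    ThetaZerosInLattice y := by
  intro x hx
  have h1 := theta1_mul_theta2 x 0 hy
  rw [add_zero, sub_zero, hx, zero_mul, mul_zero, theta1_zero, mul_zero, add_zero, eq_comm,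
    mul_eq_zero] at h1
  have h4 := theta4_zero_ne_zero_of_zeros (by positivity) h 0
  rw [Complex.ofReal_zero] at h4
  obtain ⟨j, m, hjm⟩ := h _ (h1.resolve_right h4)
  have h2 : modulus (2 * y) = 2 * modulus y := by
    simp only [modulus]
    push_cast
    ring
  rw [h2] at hjm
  rcases Int.even_or_odd' j with ⟨l, hl | hl⟩
  · refine ⟨l, m, ?_⟩
    rw [hl] at hjm
    push_cast at hjm
    linear_combination hjm / 2
  · exfalso
    have e : x = 1 / 2 + (l + m * modulus y) := by
      rw [hl] at hjm
      push_cast at hjm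
      linear_combination hjm / 2
    rw [e, theta1_add_lattice_eq_zero_iff] at hx
    have := theta1_add_half (y := y) 0
    rw [zero_add, hx] at this
    exact theta2_zero_ne_zero hy this.symm

theorem thetaZerosInLattice {y : ℝ} (hy : 0 < y) : ThetaZerosInLattice y := by
  obtain ⟨N, hN⟩ := pow_unbounded_of_one_lt (1 / y) (one_lt_two : (1 : ℝ) < 2)
  have key : ∀ N : ℕ, ∀ y : ℝ, 0 < y → 1 ≤ 2 ^ N * y → ThetaZerosInLattice y := by
    intro N
    induction N with
    | zero => exact fun y _ h => thetaZerosInLattice_of_one_le (by simpa using h)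
    | succ N ih =>
      intro y hy h
      refine ThetaZerosInLattice.of_two_mul hy (ih (2 * y) (by positivity) ?_)
      rw [← mul_assoc, ← pow_succ]
      exact h
  refine key N y hy ?_
  rw [div_lt_iff₀ hy] at hN
  exact hN.le

theorem theta4_real_ne_zero {y : ℝ} (hy : 0 < y) (x : ℝ) : theta4 x (modulus y) ≠ 0 :=
  theta4_zero_ne_zero_of_zeros hy (thetaZerosInLattice hy) x

theorem theta1_ne_zero_of_re {y : ℝ} (hy : 0 < y) {x : ℂ} (h : ∀ j : ℤ, x.re ≠ j) :
    theta1 x (modulus y) ≠ 0 := by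
  intro h0
  obtain ⟨j, m, hjm⟩ := thetaZerosInLattice hy x h0
  apply h j
  rw [hjm]
  simp [modulus]

theorem theta1_imaginary_ne_zero {y v : ℝ} (hy : 0 < y) (h : ∀ j : ℤ, v ≠ y * j) :
    theta1 (Complex.I * v) (modulus y) ≠ 0 := by
  intro h0
  obtain ⟨j, m, hjm⟩ := thetaZerosInLattice hy _ h0
  apply h m
  have := congrArg Complex.im hjm
  simp [modulus] at this
  rw [this, mul_comm]

theorem theta3_add_half_modulus (x : ℂ) (y : ℝ) : theta3 (x + 1 / 2 * modulus y) (modulus y) =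
    Complex.exp (Real.pi * y * (1 / 2) ^ 2 - 2 * Real.pi * Complex.I * (1 / 2) * (x + 0)) *
      theta2 x (modulus y) := by
  rw [theta3_eq, theta2_eq, modulus, thetaChar_add_modulus, zero_add]

theorem theta3_ne_zero_of_re {y : ℝ} (hy : 0 < y) {x : ℂ} (h : ∀ j : ℤ, x.re ≠ j + 1 / 2) :
    theta3 x (modulus y) ≠ 0 := by
  intro h0
  have h1 := theta3_add_half_modulus (x - 1 / 2 * modulus y) y
  rw [sub_add_cancel, h0, eq_comm, mul_eq_zero, or_iff_right (Complex.exp_ne_zero _),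
    ← theta1_add_half] at h1
  refine theta1_ne_zero_of_re hy (fun j hj => h (j - 1) ?_) h1
  simp [modulus] at hj
  push_cast
  linarith

/-! ### Derivatives -/

/-- The `z`-derivative at `0` of `theta3_mul_theta4`; the term with `ϑ₄(2z)` drops out by evenness.
-/
theorem theta_wronskian_34 {y : ℝ} (hy : 0 < y) (x : ℂ) :
    deriv (fun x => theta3 x (modulus y)) x * theta4 x (modulus y) -
        theta3 x (modulus y) * deriv (fun x => theta4 x (modulus y)) x =
      -2 * theta1 (2 * x) (modulus (2 * y)) *
        deriv (fun x => theta1 x (modulus (2 * y))) 0 := by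
  have hy2 : 0 < 2 * y := by positivity
  have h3 : HasDerivAt (fun z => theta3 (x + z) (modulus y))
      (deriv (fun x => theta3 x (modulus y)) x) 0 := by
    have := (differentiable_theta3 hy (x + 0)).hasDerivAt.comp_const_add x 0
    simpa using this
  have h4 : HasDerivAt (fun z => theta4 (x - z) (modulus y))
      (-deriv (fun x => theta4 x (modulus y)) x) 0 := by
    have := (differentiable_theta4 hy (x - 0)).hasDerivAt.comp_const_sub x 0
    simpa using this
  have h1 : HasDerivAt (fun z => theta1 (2 * z) (modulus (2 * y)))
      (deriv (fun x => theta1 x (modulus (2 * y))) 0 * 2) 0 := by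
    have h := (differentiable_theta1 hy2 (2 * 0)).hasDerivAt
    have := h.comp (0 : ℂ) ((hasDerivAt_id (0 : ℂ)).const_mul 2)
    simpa [Function.comp_def] using this
  have h4' : HasDerivAt (fun z => theta4 (2 * z) (modulus (2 * y))) 0 0 := by
    have hd : deriv (fun x => theta4 x (modulus (2 * y))) 0 = 0 := by
      have e : (fun x => theta4 (-x) (modulus (2 * y))) = fun x => theta4 x (modulus (2 * y)) :=
        funext fun x => theta4_neg x
      have := deriv_comp_neg (fun x => theta4 x (modulus (2 * y))) 0
      rw [e, neg_zero] at this
      exact self_eq_neg.1 this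
    have h := (differentiable_theta4 hy2 (2 * 0)).hasDerivAt
    have := h.comp (0 : ℂ) ((hasDerivAt_id (0 : ℂ)).const_mul 2)
    rw [mul_zero, hd, zero_mul] at this
    exact this
  have hl := h3.mul h4
  have hr := (h4'.const_mul (theta4 (2 * x) (modulus (2 * y)))).sub
    (h1.const_mul (theta1 (2 * x) (modulus (2 * y))))
  have e : (fun z => theta3 (x + z) (modulus y)) * (fun z => theta4 (x - z) (modulus y)) =
      (fun z => theta4 (2 * x) (modulus (2 * y)) * theta4 (2 * z) (modulus (2 * y))) -
        fun z => theta1 (2 * x) (modulus (2 * y)) * theta1 (2 * z) (modulus (2 * y)) :=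
    funext fun z => theta3_mul_theta4 x z hy
  have h := hl.unique (e ▸ hr)
  simp only [add_zero, sub_zero] at h
  linear_combination h

/-- Otherwise the Wronskian of `ϑ₃` and `ϑ₄` at half the modulus vanishes and `ϑ₃/ϑ₄` is constant on
`ℝ`. The half-period exchanges the two functions, so `ϑ₃(0)² = ϑ₄(0)²`; but their difference is
`2ϑ₂(0)²` at the original modulus. -/
theorem deriv_theta1_zero_ne_zero {y : ℝ} (hy : 0 < y) :
    deriv (fun x => theta1 x (modulus y)) 0 ≠ 0 := by
  intro h0
  obtain ⟨w, rfl⟩ : ∃ w, y = 2 * w := ⟨y / 2, by ring⟩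
  have hw : 0 < w := by linarith
  have hW : ∀ x, deriv (fun x => theta3 x (modulus w)) x * theta4 x (modulus w) -
      theta3 x (modulus w) * deriv (fun x => theta4 x (modulus w)) x = 0 := by
    intro x
    rw [theta_wronskian_34 hw, h0, mul_zero]
  have hd : ∀ t : ℝ, HasDerivAt
      (fun t : ℝ => theta3 t (modulus w) / theta4 t (modulus w)) 0 t := by
    intro t
    have h3 := (differentiable_theta3 hw t).hasDerivAt.comp_ofReal
    have h4 := (differentiable_theta4 hw t).hasDerivAt.comp_ofReal
    have := h3.div h4 (theta4_real_ne_zero hw t)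
    rw [hW, zero_div] at this
    exact this
  have hc := is_const_of_deriv_eq_zero (fun t => (hd t).differentiableAt) (fun t => (hd t).deriv)
    0 (1 / 2 : ℝ)
  have e3 := theta3_add_half (y := w) 0
  have e4 := theta4_add_half (y := w) 0
  have n4 := theta4_real_ne_zero hw 0
  have n3 := theta3_zero_ne_zero hw
  rw [zero_add] at e3 e4
  push_cast at hc n4
  rw [e3, e4, div_eq_div_iff n4 n3] at hc
  have p3 := theta3_mul_theta3 0 0 hw
  have p4 := theta4_mul_theta4 0 0 hw
  simp only [add_zero, sub_zero, mul_zero] at p3 p4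
  have : theta2 0 (modulus (2 * w)) * theta2 0 (modulus (2 * w)) = 0 := by
    linear_combination (hc - p3 + p4) / 2
  exact theta2_zero_ne_zero hy (mul_self_eq_zero.1 this)

open scoped ComplexConjugate

section

variable {y v r : ℝ}

/-! ### Nonvanishing and conjugation of the constants -/

theorem ptPlus_re : (ptPlus v r).re = r := by simp [ptPlus]

theorem ptMinus_re : (ptMinus v r).re = r := by simp [ptMinus]

theorem conj_ptPlus : conj (ptPlus v r) = ptMinus v r := by
  simp [ptPlus, ptMinus, Complex.conj_ofNat]

theorem conj_ptMinus : conj (ptMinus v r) = ptPlus v r := by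
  simp [ptPlus, ptMinus, Complex.conj_ofNat]

theorem ne_int_of_ne_half (hr : ∀ j : ℤ, r ≠ (j : ℝ) / 2) (j : ℤ) : r ≠ j := by
  have := hr (2 * j)
  push_cast at this
  intro h
  exact this (by linarith)

theorem ne_int_add_half_of_ne_half (hr : ∀ j : ℤ, r ≠ (j : ℝ) / 2) (j : ℤ) : r ≠ j + 1 / 2 := by
  have := hr (2 * j + 1)
  push_cast at this
  intro h
  exact this (by linarith)

theorem theta1_ptPlus_ne_zero (hy : 0 < y) (hr : ∀ j : ℤ, r ≠ (j : ℝ) / 2) :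
    theta1 (ptPlus v r) (modulus y) ≠ 0 :=
  theta1_ne_zero_of_re hy fun j => by rw [ptPlus_re]; exact ne_int_of_ne_half hr j

theorem theta1_ptMinus_ne_zero (hy : 0 < y) (hr : ∀ j : ℤ, r ≠ (j : ℝ) / 2) :
    theta1 (ptMinus v r) (modulus y) ≠ 0 :=
  theta1_ne_zero_of_re hy fun j => by rw [ptMinus_re]; exact ne_int_of_ne_half hr j

theorem theta3_ptPlus_ne_zero (hy : 0 < y) (hr : ∀ j : ℤ, r ≠ (j : ℝ) / 2) :
    theta3 (ptPlus v r) (modulus y) ≠ 0 :=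
  theta3_ne_zero_of_re hy fun j => by rw [ptPlus_re]; exact ne_int_add_half_of_ne_half hr j

theorem theta3_ptMinus_ne_zero (hy : 0 < y) (hr : ∀ j : ℤ, r ≠ (j : ℝ) / 2) :
    theta3 (ptMinus v r) (modulus y) ≠ 0 :=
  theta3_ne_zero_of_re hy fun j => by rw [ptMinus_re]; exact ne_int_add_half_of_ne_half hr j

theorem theta1_two_mul_ne_zero (hy : 0 < y) (hr : ∀ j : ℤ, r ≠ (j : ℝ) / 2) :
    theta1 (2 * r) (modulus y) ≠ 0 :=
  theta1_ne_zero_of_re hy fun j h => hr j (by simp at h; linarith)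

theorem theta3_real_ne_zero (hy : 0 < y) (x : ℝ) : theta3 x (modulus y) ≠ 0 := by
  have h := theta3_add_half (y := y) (x - 1 / 2)
  rw [sub_add_cancel] at h
  rw [h]
  simpa using theta4_real_ne_zero hy (x - 1 / 2)

theorem theta3_two_mul_ne_zero (hy : 0 < y) : theta3 (2 * r) (modulus y) ≠ 0 := by
  simpa using theta3_real_ne_zero hy (2 * r)

theorem R1_ne_zero (hy : 0 < y) (hr : ∀ j : ℤ, r ≠ (j : ℝ) / 2) : R1 v r y ≠ 0 :=
  div_ne_zero (theta1_ptMinus_ne_zero hy hr) (theta1_ptPlus_ne_zero hy hr)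

theorem R3_ne_zero (hy : 0 < y) (hr : ∀ j : ℤ, r ≠ (j : ℝ) / 2) : R3 v r y ≠ 0 :=
  div_ne_zero (theta3_ptMinus_ne_zero hy hr) (theta3_ptPlus_ne_zero hy hr)

/-- Numerator and denominator are evaluated at conjugate points, so `R₁` is unimodular. -/
theorem conj_R1 : conj (R1 v r y) = (R1 v r y)⁻¹ := by
  rw [R1, map_div₀, conj_theta1, conj_theta1, conj_ptPlus, conj_ptMinus, inv_div]

theorem conj_R3 : conj (R3 v r y) = (R3 v r y)⁻¹ := by
  rw [R3, map_div₀, conj_theta3, conj_theta3, conj_ptPlus, conj_ptMinus, inv_div]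

theorem ofReal_re_of_conj {z : ℂ} (h : conj z = z) : ((z.re : ℝ) : ℂ) = z :=
  Complex.conj_eq_iff_re.1 h

/-- A three-term relation at the points `r` and `0` writes the product, times `ϑ₂(0)²`, as the sum
of squares of the real numbers `ϑ₃(r)ϑ₂(r)` and `ϑ₁(r)ϑ₄(r)`. Hence `α₂` is a positive real. -/
theorem theta3_mul_theta3_zero_pos (hy : 0 < y) (hr : ∀ j : ℤ, r ≠ (j : ℝ) / 2) :
    ∃ s : ℝ, 0 < s ∧ theta3 (2 * r) (modulus y) * theta3 0 (modulus y) = s := by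
  have h := theta_three_term_3214 hy r 0 0 r
  rw [add_zero, sub_zero, zero_add, zero_sub, theta2_neg, theta4_neg, sub_self, ← two_mul,
    add_zero, sub_zero] at h
  have e1 := ofReal_re_of_conj (z := theta1 r (modulus y))
    (by rw [conj_theta1, Complex.conj_ofReal])
  have e2 := ofReal_re_of_conj (z := theta2 r (modulus y))
    (by rw [conj_theta2, Complex.conj_ofReal])
  have e3 := ofReal_re_of_conj (z := theta3 r (modulus y))
    (by rw [conj_theta3, Complex.conj_ofReal])
  have e4 := ofReal_re_of_conj (z := theta4 r (modulus y))
    (by rw [conj_theta4, Complex.conj_ofReal])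
  have n1 : theta1 r (modulus y) ≠ 0 :=
    theta1_ne_zero_of_re hy fun j => by simpa using ne_int_of_ne_half hr j
  have n4 := theta4_real_ne_zero hy r
  rw [← e1] at n1
  rw [← e4] at n4
  obtain ⟨p, hp, e⟩ := theta2_imaginary_pos 0 hy
  rw [Complex.ofReal_zero, mul_zero] at e
  rw [e, ← e1, ← e2, ← e3, ← e4] at h
  set c1 := (theta1 r (modulus y)).re
  set c2 := (theta2 r (modulus y)).re
  set c3 := (theta3 r (modulus y)).re
  set c4 := (theta4 r (modulus y)).re
  have m1 : c1 ≠ 0 := by exact_mod_cast n1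
  have m4 : c4 ≠ 0 := by exact_mod_cast n4
  have hp' : (p : ℂ) ≠ 0 := by exact_mod_cast hp.ne'
  refine ⟨((c3 * c2) ^ 2 + (c1 * c4) ^ 2) / p ^ 2, by positivity, ?_⟩
  push_cast
  rw [eq_div_iff (pow_ne_zero 2 hp')]
  linear_combination -h

theorem alpha2_pos (hy : 0 < y) (hr : ∀ j : ℤ, r ≠ (j : ℝ) / 2) :
    ∃ s : ℝ, 0 < s ∧ alpha2 r y = s := by
  obtain ⟨s, hs, h⟩ := theta3_mul_theta3_zero_pos hy hr
  refine ⟨s ^ (1 / 2 : ℝ), by positivity, ?_⟩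
  rw [alpha2, h, Complex.ofReal_cpow hs.le]
  norm_num

theorem alpha2_sq : alpha2 r y ^ 2 = theta3 (2 * r) (modulus y) * theta3 0 (modulus y) := by
  rw [alpha2, ← Complex.cpow_nat_mul]
  norm_num

theorem alpha2_ne_zero (hy : 0 < y) (hr : ∀ j : ℤ, r ≠ (j : ℝ) / 2) : alpha2 r y ≠ 0 := by
  obtain ⟨s, hs, h⟩ := alpha2_pos hy hr
  rw [h]
  exact_mod_cast hs.ne'

/-! ### The tau functions at `z = 0` -/

/-- The point `ivn - iv/2`. -/
noncomputable def vertexPt (v : ℝ) (n : ℤ) : ℂ := Complex.I * v * n - 1 / 2 * Complex.I * v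

theorem theta2_vertexPt_pos (hy : 0 < y) (n : ℤ) :
    ∃ p : ℝ, 0 < p ∧ theta2 (vertexPt v n) (modulus y) = p := by
  have := theta2_imaginary_pos (v * n - 1 / 2 * v) hy
  convert this using 5
  rw [vertexPt]
  push_cast
  ring

theorem theta2_vertexPt_ne_zero (hy : 0 < y) (n : ℤ) :
    theta2 (vertexPt v n) (modulus y) ≠ 0 := by
  obtain ⟨s, hs, h⟩ := theta2_vertexPt_pos (v := v) hy n
  rw [h]
  exact_mod_cast hs.ne'

theorem tauF_zero (n : ℤ) :
    tauF v r y n 0 = alpha2 r y * theta2 (vertexPt v n) (modulus y) := by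
  simp [tauF, expFactor, mu, vertexPt]

theorem tauH_zero (n : ℤ) :
    tauH v r y n 0 = u2 v r y / (alpha2 r y * s2 v r y) * R1 v r y ^ (-n) * R3 v r y ^ (-n) *
      theta4 (vertexPt v n - 2 * r) (modulus y) := by
  simp [tauH, expFactor, mu, vertexPt]

theorem tauSmallF_zero (n : ℤ) :
    tauSmallF v r y n 0 = theta3 (ptMinus v r) (modulus y) * R3 v r y ^ n *
      theta2 (Complex.I * v * n + r) (modulus y) := by
  simp [tauSmallF, expFactor, mu]

theorem tauSmallG_zero (n : ℤ) :
    tauSmallG v r y n 0 = theta1 (ptPlus v r) (modulus y) * R1 v r y ^ (-n) *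
      theta4 (Complex.I * v * n - r) (modulus y) := by
  simp [tauSmallG, expFactor, mu]

/-- Conjugation inverts `R₃`, swaps the points `±iv/2 + r`, and sends `ivn + r` to `-(ivn - r)`; the
evenness of `ϑ₂` removes the sign. -/
theorem conj_tauSmallF_zero (n : ℤ) :
    conj (tauSmallF v r y n 0) = theta3 (ptPlus v r) (modulus y) * R3 v r y ^ (-n) *
      theta2 (Complex.I * v * n - r) (modulus y) := by
  rw [tauSmallF_zero, map_mul, map_mul, map_zpow₀, conj_R3, conj_theta3, conj_ptMinus,
    conj_theta2, ← theta2_neg (Complex.I * v * n - r), inv_zpow']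
  congr 2
  simp
  ring

theorem conj_tauSmallG_zero (n : ℤ) :
    conj (tauSmallG v r y n 0) = theta1 (ptMinus v r) (modulus y) * R1 v r y ^ n *
      theta4 (Complex.I * v * n + r) (modulus y) := by
  rw [tauSmallG_zero, map_mul, map_mul, map_zpow₀, conj_R1, conj_theta1, conj_ptPlus,
    conj_theta4, ← theta4_neg (Complex.I * v * n + r), inv_zpow', neg_neg]
  congr 2
  simp
  ring

theorem tauF_zero_pos (hy : 0 < y) (hr : ∀ j : ℤ, r ≠ (j : ℝ) / 2) (n : ℤ) :
    ∃ p : ℝ, 0 < p ∧ tauF v r y n 0 = p := by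
  obtain ⟨s, hs, h⟩ := alpha2_pos hy hr
  obtain ⟨p, hp, h'⟩ := theta2_vertexPt_pos (v := v) hy n
  exact ⟨s * p, by positivity, by rw [tauF_zero, h, h', Complex.ofReal_mul]⟩

theorem tauF_zero_ne_zero (hy : 0 < y) (hr : ∀ j : ℤ, r ≠ (j : ℝ) / 2) (n : ℤ) :
    tauF v r y n 0 ≠ 0 := by
  obtain ⟨s, hs, h⟩ := tauF_zero_pos (v := v) hy hr n
  rw [h]
  exact_mod_cast hs.ne'

theorem vertexPt_succ (n : ℤ) :
    vertexPt v (n + 1) = Complex.I * v * n + 1 / 2 * Complex.I * v := by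
  rw [vertexPt]
  push_cast
  ring

/-- At `a = ivn` this becomes `qₙ = Fₙ Fₙ₊₁`. The point `a` is left free because
`Delta3_sub_Delta1_ne_zero` needs another value. -/
theorem theta_norm_sq_identity (hy : 0 < y) (a : ℂ) :
    theta3 (ptPlus v r) (modulus y) * theta3 (ptMinus v r) (modulus y) *
          (theta2 (a + r) (modulus y) * theta2 (a - r) (modulus y)) +
        theta1 (ptPlus v r) (modulus y) * theta1 (ptMinus v r) (modulus y) *
          (theta4 (a + r) (modulus y) * theta4 (a - r) (modulus y)) =
      theta3 (2 * r) (modulus y) * theta3 0 (modulus y) *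
        (theta2 (a + 1 / 2 * Complex.I * v) (modulus y) *
          theta2 (a - 1 / 2 * Complex.I * v) (modulus y)) := by
  have h := theta_three_term_3214 hy r (1 / 2 * Complex.I * v) a r
  rw [show (r : ℂ) + 1 / 2 * Complex.I * v = ptPlus v r by rw [ptPlus]; ring,
    show (r : ℂ) - 1 / 2 * Complex.I * v = ptMinus v r by rw [ptMinus]; ring,
    sub_self, ← two_mul] at h
  exact h

theorem tauSmall_norm_sq (hy : 0 < y) (hr : ∀ j : ℤ, r ≠ (j : ℝ) / 2) (n : ℤ) :
    tauSmallF v r y n 0 * conj (tauSmallF v r y n 0) +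
        tauSmallG v r y n 0 * conj (tauSmallG v r y n 0) =
      tauF v r y n 0 * tauF v r y (n + 1) 0 := by
  have h := theta_norm_sq_identity (v := v) (r := r) hy (Complex.I * v * n)
  have h3 : R3 v r y ^ n * R3 v r y ^ (-n) = 1 := by
    rw [zpow_neg, mul_inv_cancel₀ (zpow_ne_zero _ (R3_ne_zero hy hr))]
  have h1 : R1 v r y ^ n * R1 v r y ^ (-n) = 1 := by
    rw [zpow_neg, mul_inv_cancel₀ (zpow_ne_zero _ (R1_ne_zero hy hr))]
  rw [conj_tauSmallF_zero, conj_tauSmallG_zero, tauSmallF_zero, tauSmallG_zero, tauF_zero,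
    tauF_zero, vertexPt_succ, vertexPt]
  have ha := alpha2_sq (r := r) (y := y)
  rw [← ha] at h
  linear_combination h +
    theta3 (ptPlus v r) (modulus y) * theta3 (ptMinus v r) (modulus y) *
          (theta2 (Complex.I * v * n + r) (modulus y) *
            theta2 (Complex.I * v * n - r) (modulus y)) * h3 +
    theta1 (ptPlus v r) (modulus y) * theta1 (ptMinus v r) (modulus y) *
          (theta4 (Complex.I * v * n + r) (modulus y) *
            theta4 (Complex.I * v * n - r) (modulus y)) * h1

/-! ### The position vector -/

theorem s2_ne_zero (hy : 0 < y) (hv : ∀ j : ℤ, v ≠ y * j) : s2 v r y ≠ 0 :=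
  mul_ne_zero (theta3_two_mul_ne_zero hy) (theta1_imaginary_ne_zero hy hv)

/-- The four arguments are solved for so that `q - s = iv` and `u + p = 2r`, which reproduces `s₂`,
while `p - s` and `u + q` both equal `iv/2 + r`. -/
theorem theta_position_identity (hy : 0 < y) (a : ℂ) :
    theta1 (ptPlus v r) (modulus y) * theta3 (ptPlus v r) (modulus y) *
          (theta4 (a + 1 / 2 * Complex.I * v - 2 * r) (modulus y) *
            theta2 (a - 1 / 2 * Complex.I * v) (modulus y)) -
        theta1 (ptMinus v r) (modulus y) * theta3 (ptMinus v r) (modulus y) *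
          (theta4 (a - 1 / 2 * Complex.I * v - 2 * r) (modulus y) *
            theta2 (a + 1 / 2 * Complex.I * v) (modulus y)) =
      s2 v r y * (theta2 (a - r) (modulus y) * theta4 (a - r) (modulus y)) := by
  have h := theta_three_term_1234 hy ((r + a) / 2) ((a - r) / 2 + 1 / 2 * Complex.I * v)
    ((a - r) / 2 - 1 / 2 * Complex.I * v) ((3 * r - a) / 2)
  rw [← theta4_neg ((3 * r - a) / 2 - ((a - r) / 2 + 1 / 2 * Complex.I * v)),
    ← theta4_neg ((3 * r - a) / 2 - ((a - r) / 2 - 1 / 2 * Complex.I * v)),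
    ← theta4_neg ((3 * r - a) / 2 - (r + a) / 2)] at h
  rw [s2, ptPlus, ptMinus]
  ring_nf at h ⊢
  linear_combination h

theorem position_planar_step (hy : 0 < y) (hr : ∀ j : ℤ, r ≠ (j : ℝ) / 2)
    (hv : ∀ j : ℤ, v ≠ y * j) (n : ℤ) :
    tauH v r y (n + 1) 0 / tauF v r y (n + 1) 0 - tauH v r y n 0 / tauF v r y n 0 =
      conj (tauSmallF v r y n 0) * tauSmallG v r y n 0 /
        (tauF v r y n 0 * tauF v r y (n + 1) 0) := by
  have hF := tauF_zero_ne_zero (v := v) hy hr n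
  have hF' := tauF_zero_ne_zero (v := v) hy hr (n + 1)
  have key : tauH v r y (n + 1) 0 * tauF v r y n 0 - tauH v r y n 0 * tauF v r y (n + 1) 0 =
      conj (tauSmallF v r y n 0) * tauSmallG v r y n 0 := by
    have h := theta_position_identity (v := v) (r := r) hy (Complex.I * v * n)
    have h3 : R3 v r y ^ (-(n + 1)) = R3 v r y ^ (-n) * (R3 v r y)⁻¹ := by
      rw [neg_add, zpow_add₀ (R3_ne_zero hy hr), zpow_neg_one]
    have h1 : R1 v r y ^ (-(n + 1)) = R1 v r y ^ (-n) * (R1 v r y)⁻¹ := by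
      rw [neg_add, zpow_add₀ (R1_ne_zero hy hr), zpow_neg_one]
    have ha := alpha2_ne_zero hy hr
    have hs := s2_ne_zero (r := r) hy hv
    have n1 := theta1_ptPlus_ne_zero (v := v) hy hr
    have n2 := theta1_ptMinus_ne_zero (v := v) hy hr
    have n3 := theta3_ptPlus_ne_zero (v := v) hy hr
    have n4 := theta3_ptMinus_ne_zero (v := v) hy hr
    rw [conj_tauSmallF_zero, tauSmallG_zero, tauF_zero, tauF_zero, tauH_zero, tauH_zero, h1, h3,
      vertexPt_succ, vertexPt, u2]
    generalize R1 v r y ^ (-n) = a at *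
    generalize R3 v r y ^ (-n) = b at *
    rw [R1, R3, inv_div, inv_div]
    generalize Complex.I * v * n + 1 / 2 * Complex.I * v = p at *
    generalize Complex.I * v * n - 1 / 2 * Complex.I * v = q at *
    generalize Complex.I * v * n - r = c at *
    generalize p - 2 * r = p' at *
    generalize q - 2 * r = q' at *
    field_simp
    linear_combination a * b * h
  rw [div_sub_div _ _ hF' hF, ← key, mul_comm (tauF v r y n 0)]
  ring

/-! ### The third coordinate of the position vector -/

/-- The norm identity holds with any `u` in place of `iv/2`, so it can be differentiated in `u`. The
logarithmic derivatives of `ϑⱼ(r + u) ϑⱼ(r - u)` at `u = iv/2` are `-Δⱼ`. -/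
theorem theta_derivative_identity (hy : 0 < y) (hr : ∀ j : ℤ, r ≠ (j : ℝ) / 2) (a : ℂ) :
    theta3 (ptPlus v r) (modulus y) * theta3 (ptMinus v r) (modulus y) *
          (theta2 (a + r) (modulus y) * theta2 (a - r) (modulus y)) * Delta3 v r y +
        theta1 (ptPlus v r) (modulus y) * theta1 (ptMinus v r) (modulus y) *
          (theta4 (a + r) (modulus y) * theta4 (a - r) (modulus y)) * Delta1 v r y =
      -(theta3 (2 * r) (modulus y) * theta3 0 (modulus y) *
        (deriv (fun x => theta2 x (modulus y)) (a + 1 / 2 * Complex.I * v) *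
            theta2 (a - 1 / 2 * Complex.I * v) (modulus y) -
          theta2 (a + 1 / 2 * Complex.I * v) (modulus y) *
            deriv (fun x => theta2 x (modulus y)) (a - 1 / 2 * Complex.I * v))) := by
  have add : ∀ {θ : ℂ → ℂ}, Differentiable ℂ θ → ∀ c u : ℂ,
      HasDerivAt (fun u => θ (c + u)) (deriv θ (c + u)) u := fun hθ c u =>
    (hθ (c + u)).hasDerivAt.comp_const_add c u
  have sub : ∀ {θ : ℂ → ℂ}, Differentiable ℂ θ → ∀ c u : ℂ,
      HasDerivAt (fun u => θ (c - u)) (-deriv θ (c - u)) u := fun hθ c u =>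
    (hθ (c - u)).hasDerivAt.comp_const_sub c u
  have d1 := differentiable_theta1 hy
  have d2 := differentiable_theta2 hy
  have d3 := differentiable_theta3 hy
  set b := 1 / 2 * Complex.I * v with hb
  have hl := (((add d3 r b).mul (sub d3 r b)).mul_const
    (theta2 (a + r) (modulus y) * theta2 (a - r) (modulus y))).add
    (((add d1 r b).mul (sub d1 r b)).mul_const
      (theta4 (a + r) (modulus y) * theta4 (a - r) (modulus y)))
  have hr' := ((add d2 a b).mul (sub d2 a b)).const_mul
    (theta3 (2 * r) (modulus y) * theta3 0 (modulus y))
  have e : ∀ u, theta3 (r + u) (modulus y) * theta3 (r - u) (modulus y) *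
          (theta2 (a + r) (modulus y) * theta2 (a - r) (modulus y)) +
        theta1 (r + u) (modulus y) * theta1 (r - u) (modulus y) *
          (theta4 (a + r) (modulus y) * theta4 (a - r) (modulus y)) =
      theta3 (2 * r) (modulus y) * theta3 0 (modulus y) *
        (theta2 (a + u) (modulus y) * theta2 (a - u) (modulus y)) := by
    intro u
    have h := theta_three_term_3214 hy r u a r
    rw [sub_self, ← two_mul] at h
    exact h
  have h := hl.unique (hr'.congr_of_eventuallyEq (Filter.Eventually.of_forall e))
  have ep : (r : ℂ) + b = ptPlus v r := by rw [ptPlus, hb]; ring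
  have em : (r : ℂ) - b = ptMinus v r := by rw [ptMinus, hb]; ring
  rw [ep, em] at h
  have n1 := theta1_ptPlus_ne_zero (v := v) hy hr
  have n2 := theta1_ptMinus_ne_zero (v := v) hy hr
  have n3 := theta3_ptPlus_ne_zero (v := v) hy hr
  have n4 := theta3_ptMinus_ne_zero (v := v) hy hr
  have e3 : theta3 (ptPlus v r) (modulus y) * theta3 (ptMinus v r) (modulus y) * Delta3 v r y =
      theta3 (ptPlus v r) (modulus y) * deriv (fun x => theta3 x (modulus y)) (ptMinus v r) -
        deriv (fun x => theta3 x (modulus y)) (ptPlus v r) *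
          theta3 (ptMinus v r) (modulus y) := by
    rw [Delta3, logDeriv_apply, logDeriv_apply]
    field_simp
  have e1 : theta1 (ptPlus v r) (modulus y) * theta1 (ptMinus v r) (modulus y) * Delta1 v r y =
      theta1 (ptPlus v r) (modulus y) * deriv (fun x => theta1 x (modulus y)) (ptMinus v r) -
        deriv (fun x => theta1 x (modulus y)) (ptPlus v r) *
          theta1 (ptMinus v r) (modulus y) := by
    rw [Delta1, logDeriv_apply, logDeriv_apply]
    field_simp
  linear_combination -h + (theta2 (a + r) (modulus y) * theta2 (a - r) (modulus y)) * e3 +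
    (theta4 (a + r) (modulus y) * theta4 (a - r) (modulus y)) * e1

theorem Delta3_sub_Delta1_ne_zero (hy : 0 < y) (hr : ∀ j : ℤ, r ≠ (j : ℝ) / 2)
    (hv : ∀ j : ℤ, v ≠ y * j) : Delta3 v r y - Delta1 v r y ≠ 0 := by
  intro h0
  -- This `a` puts `a - iv/2` at the zero `1/2` of `ϑ₂`: the norm identity then has right side zero,
  -- and eliminating with it makes a multiple of `Δ₃ - Δ₁` equal to a product of nonzero theta
  -- constants, including `ϑ₁'(0)`.
  have hd := theta_derivative_identity (v := v) hy hr (1 / 2 * Complex.I * v + 1 / 2)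
  have hn := theta_norm_sq_identity (v := v) (r := r) hy (1 / 2 * Complex.I * v + 1 / 2)
  have e1 : 1 / 2 * Complex.I * v + 1 / 2 - 1 / 2 * Complex.I * v = (0 : ℂ) + 1 / 2 := by ring
  have e2 : 1 / 2 * Complex.I * v + 1 / 2 + 1 / 2 * Complex.I * v = Complex.I * v + 1 / 2 := by
    ring
  have e3 : deriv (fun x => theta2 x (modulus y)) ((0 : ℂ) + 1 / 2) =
      -deriv (fun x => theta1 x (modulus y)) 0 := by
    rw [← deriv_comp_add_const, ← deriv.fun_neg]
    congr 1
    funext x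
    exact theta2_add_half x
  rw [e1, e2, theta2_add_half, theta2_add_half, theta1_zero] at hn hd
  rw [e3] at hd
  have k : theta3 (2 * r) (modulus y) * theta3 0 (modulus y) *
      (theta1 (Complex.I * v) (modulus y) * deriv (fun x => theta1 x (modulus y)) 0) = 0 := by
    linear_combination -hd + Delta3 v r y * hn -
      theta1 (ptPlus v r) (modulus y) * theta1 (ptMinus v r) (modulus y) *
          (theta4 (1 / 2 * Complex.I * v + 1 / 2 + r) (modulus y) *
            theta4 (1 / 2 * Complex.I * v + 1 / 2 - r) (modulus y)) * h0
  have k1 := theta3_two_mul_ne_zero (r := r) hy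
  have k2 := theta3_zero_ne_zero hy
  have k3 := theta1_imaginary_ne_zero hy hv
  have k4 := deriv_theta1_zero_ne_zero hy
  exact mul_ne_zero (mul_ne_zero k1 k2) (mul_ne_zero k3 k4) k

theorem logDeriv_tauF_zero (hy : 0 < y) (hr : ∀ j : ℤ, r ≠ (j : ℝ) / 2) (n : ℤ) :
    logDeriv (tauF v r y n) 0 =
      (n * Delta3 v r y + logDeriv (fun x => theta2 x (modulus y)) (vertexPt v n)) /
        (Delta3 v r y - Delta1 v r y) := by
  have ha := alpha2_ne_zero hy hr
  have h2 := theta2_vertexPt_ne_zero (v := v) hy n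
  set D := Delta3 v r y - Delta1 v r y with hD
  have hm : HasDerivAt (fun z : ℂ => mu v r y n z - 1 / 2 * Complex.I * v) D⁻¹ 0 := by
    simp only [mu]
    have := (((hasDerivAt_id (0 : ℂ)).div_const D).const_add
      (Complex.I * v * n)).sub_const (1 / 2 * Complex.I * v)
    simpa [one_div] using this
  have hm0 : mu v r y n 0 - 1 / 2 * Complex.I * v = vertexPt v n := by simp [mu, vertexPt]
  have ht : HasDerivAt (fun z : ℂ => theta2 (mu v r y n z - 1 / 2 * Complex.I * v) (modulus y))
      (deriv (fun x => theta2 x (modulus y)) (vertexPt v n) * D⁻¹) 0 := by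
    have := (differentiable_theta2 hy (mu v r y n 0 - 1 / 2 * Complex.I * v)).hasDerivAt.comp
      (0 : ℂ) hm
    rw [hm0] at this
    exact this
  have he : HasDerivAt (fun z : ℂ => expFactor v r y n z) (n * Delta3 v r y / D) 0 := by
    simp only [expFactor]
    have := ((hasDerivAt_id (0 : ℂ)).const_mul (n * Delta3 v r y / D)).cexp
    simpa using this
  have hF : HasDerivAt (tauF v r y n)
      (alpha2 r y * (n * Delta3 v r y / D) * theta2 (vertexPt v n) (modulus y) +
        alpha2 r y * (deriv (fun x => theta2 x (modulus y)) (vertexPt v n) * D⁻¹)) 0 := by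
    have := (he.const_mul (alpha2 r y)).mul ht
    have e0 : expFactor v r y n 0 = 1 := by simp [expFactor]
    rw [hm0, e0, mul_one] at this
    exact this
  rw [logDeriv_apply, hF.deriv, tauF_zero, logDeriv_apply]
  field_simp

theorem position_axial_step (hy : 0 < y) (hr : ∀ j : ℤ, r ≠ (j : ℝ) / 2)
    (hv : ∀ j : ℤ, v ≠ y * j) (n : ℤ) :
    (((n + 1 : ℤ) : ℂ) - 2 * logDeriv (tauF v r y (n + 1)) 0) -
        (n - 2 * logDeriv (tauF v r y n) 0) =
      (tauSmallF v r y n 0 * conj (tauSmallF v r y n 0) -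
        tauSmallG v r y n 0 * conj (tauSmallG v r y n 0)) /
        (tauF v r y n 0 * tauF v r y (n + 1) 0) := by
  have hq := tauSmall_norm_sq (v := v) hy hr n
  have hF := tauF_zero_ne_zero (v := v) hy hr n
  have hF' := tauF_zero_ne_zero (v := v) hy hr (n + 1)
  have hD := Delta3_sub_Delta1_ne_zero hy hr hv
  have h2 := theta2_vertexPt_ne_zero (v := v) hy n
  have h2' := theta2_vertexPt_ne_zero (v := v) hy (n + 1)
  have hd := theta_derivative_identity (v := v) hy hr (Complex.I * v * n)
  have h3 : R3 v r y ^ n * R3 v r y ^ (-n) = 1 := by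
    rw [zpow_neg, mul_inv_cancel₀ (zpow_ne_zero _ (R3_ne_zero hy hr))]
  have h1 : R1 v r y ^ n * R1 v r y ^ (-n) = 1 := by
    rw [zpow_neg, mul_inv_cancel₀ (zpow_ne_zero _ (R1_ne_zero hy hr))]
  have ha := alpha2_sq (r := r) (y := y)
  -- `|f|²Δ₃ + |g|²Δ₁` and `q = |f|² + |g|²` are two linear equations; together they determine `(Δ₃
  -- - Δ₁)(|f|² - |g|²)`.
  have key : (tauSmallF v r y n 0 * conj (tauSmallF v r y n 0)) * Delta3 v r y +
      (tauSmallG v r y n 0 * conj (tauSmallG v r y n 0)) * Delta1 v r y =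
      -(tauF v r y n 0 * tauF v r y (n + 1) 0 *
        (logDeriv (fun x => theta2 x (modulus y)) (vertexPt v (n + 1)) -
          logDeriv (fun x => theta2 x (modulus y)) (vertexPt v n))) := by
    rw [← vertexPt_succ, ← ha] at hd
    change _ = -(_ * (_ * theta2 (vertexPt v n) (modulus y) - _ * deriv _ (vertexPt v n))) at hd
    have hl : theta2 (vertexPt v n) (modulus y) * theta2 (vertexPt v (n + 1)) (modulus y) *
        (logDeriv (fun x => theta2 x (modulus y)) (vertexPt v (n + 1)) -
          logDeriv (fun x => theta2 x (modulus y)) (vertexPt v n)) =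
        deriv (fun x => theta2 x (modulus y)) (vertexPt v (n + 1)) *
            theta2 (vertexPt v n) (modulus y) -
          theta2 (vertexPt v (n + 1)) (modulus y) *
            deriv (fun x => theta2 x (modulus y)) (vertexPt v n) := by
      rw [logDeriv_apply, logDeriv_apply]
      field_simp
    rw [conj_tauSmallF_zero, conj_tauSmallG_zero, tauSmallF_zero, tauSmallG_zero, tauF_zero,
      tauF_zero]
    linear_combination hd + alpha2 r y ^ 2 * hl +
      theta3 (ptPlus v r) (modulus y) * theta3 (ptMinus v r) (modulus y) *
          (theta2 (Complex.I * v * n + r) (modulus y) *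
            theta2 (Complex.I * v * n - r) (modulus y)) * Delta3 v r y * h3 +
      theta1 (ptPlus v r) (modulus y) * theta1 (ptMinus v r) (modulus y) *
          (theta4 (Complex.I * v * n + r) (modulus y) *
            theta4 (Complex.I * v * n - r) (modulus y)) * Delta1 v r y * h1
  rw [logDeriv_tauF_zero hy hr, logDeriv_tauF_zero hy hr, eq_div_iff (mul_ne_zero hF hF')]
  generalize logDeriv (fun x => theta2 x (modulus y)) (vertexPt v (n + 1)) = L' at *
  generalize logDeriv (fun x => theta2 x (modulus y)) (vertexPt v n) = L at *
  push_cast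
  rw [← mul_right_inj' hD]
  have c : (Delta3 v r y - Delta1 v r y) *
      ((n + 1 - 2 * (((n + 1) * Delta3 v r y + L') / (Delta3 v r y - Delta1 v r y)) -
        (n - 2 * ((n * Delta3 v r y + L) / (Delta3 v r y - Delta1 v r y)))) *
        (tauF v r y n 0 * tauF v r y (n + 1) 0)) =
      ((Delta3 v r y - Delta1 v r y) - 2 * (Delta3 v r y + L' - L)) *
        (tauF v r y n 0 * tauF v r y (n + 1) 0) := by
    field_simp
    ring
  rw [c]
  linear_combination -2 * key + (Delta3 v r y + Delta1 v r y) * hq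

/-! ### The binormal vector in terms of theta functions -/

/-- The value at `z = 0` of `(1/2) Gₙ / G̃ₙ`. -/
noncomputable def rho (v r y : ℝ) (n : ℤ) : ℂ := Complex.I / 2 * (R3 v r y / R1 v r y) ^ n

/-- The complex number formed by the first two components of the binormal vector. -/
noncomputable def planarBinormal (f g ρ : ℂ) : ℂ :=
  2 * Complex.I * (ρ * conj f ^ 2 + conj ρ * g ^ 2) / (f * conj f + g * conj g)

theorem binormalVec_zero (f g ρ : ℂ) :
    binormalVec f g ρ 0 = (planarBinormal f g ρ + conj (planarBinormal f g ρ)) / 2 := by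
  simp [binormalVec, planarBinormal, Complex.conj_ofNat]
  ring

theorem binormalVec_one (f g ρ : ℂ) :
    binormalVec f g ρ 1 =
      (planarBinormal f g ρ - conj (planarBinormal f g ρ)) / (2 * Complex.I) := by
  simp [binormalVec, planarBinormal, Complex.conj_ofNat]
  rw [mul_comm (conj f) f, mul_comm (conj g) g]
  generalize f * conj f + g * conj g = q
  rw [div_eq_mul_inv _ (2 * Complex.I), mul_inv, Complex.inv_I]
  ring_nf
  simp only [Complex.I_sq]
  ring

theorem binormalVec_two (f g ρ : ℂ) :
    binormalVec f g ρ 2 = -2 * Complex.I * (conj f * conj g * ρ - f * g * conj ρ) /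
      (f * conj f + g * conj g) := by
  simp [binormalVec, div_eq_mul_inv]
  ring

/-- The closed form of the complex number formed by the first two components of the binormal. -/
noncomputable def thetaPlanarBinormal (v r y : ℝ) (n : ℤ) : ℂ :=
  -((R1 v r y * R3 v r y) ^ (-n) * theta3 0 (modulus y) ^ 2 *
    theta2 (vertexPt v n - 2 * r) (modulus y)) /
      (alpha2 r y ^ 2 * theta2 (vertexPt v n) (modulus y))

/-- The closed form of the third component of the binormal. -/
noncomputable def thetaAxialBinormal (v r y : ℝ) (n : ℤ) : ℂ :=
  theta1 (2 * r) (modulus y) * theta3 0 (modulus y) * theta4 (vertexPt v n) (modulus y) /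
      (alpha2 r y ^ 2 * theta2 (vertexPt v n) (modulus y))

theorem conj_rho (n : ℤ) :
    conj (rho v r y n) = -(Complex.I / 2) * ((R3 v r y / R1 v r y) ^ n)⁻¹ := by
  simp only [rho, map_mul, map_zpow₀, map_div₀, conj_R1, conj_R3, ← inv_zpow, Complex.conj_I,
    Complex.conj_ofNat, inv_div, div_inv_eq_mul]
  rw [inv_mul_eq_div, neg_div]

theorem theta_binormal_identity (hy : 0 < y) (x z : ℂ) :
    theta3 x (modulus y) ^ 2 * theta2 z (modulus y) ^ 2 -
        theta1 x (modulus y) ^ 2 * theta4 z (modulus y) ^ 2 =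
      theta3 0 (modulus y) ^ 2 *
        (theta2 (z + x) (modulus y) * theta2 (z - x) (modulus y)) := by
  have h := theta_three_term_3214 hy 0 x z 0
  rw [zero_add, zero_sub, add_zero, sub_zero, theta3_neg, theta1_neg, add_zero, sub_zero] at h
  linear_combination h

/-- The arguments are chosen so that `u + p = 0` and `q - s = -2c`. Taking `c = r`, the values `b =
-iv/2` and `b = iv/2` give the axial binormal at the two ends of an edge. -/
theorem theta_axial_identity (hy : 0 < y) (a b c : ℂ) :
    theta3 (c - b) (modulus y) * theta1 (c + b) (modulus y) *
          (theta2 (a - c) (modulus y) * theta4 (a + c) (modulus y)) +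
        theta3 (c + b) (modulus y) * theta1 (c - b) (modulus y) *
          (theta2 (a + c) (modulus y) * theta4 (a - c) (modulus y)) =
      theta1 (2 * c) (modulus y) * theta3 0 (modulus y) *
        (theta2 (a - b) (modulus y) * theta4 (a + b) (modulus y)) := by
  have h := theta_three_term_1234 hy (-((a + b) / 2)) (-(c + (a - b) / 2)) (c - (a - b) / 2)
    ((a + b) / 2)
  rw [show -((a + b) / 2) - (c - (a - b) / 2) = -(c + b) by ring,
    show -((a + b) / 2) + (c - (a - b) / 2) = -(a - c) by ring,
    show (a + b) / 2 + -(c + (a - b) / 2) = -(c - b) by ring,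
    show (a + b) / 2 - -(c + (a - b) / 2) = a + c by ring,
    show -((a + b) / 2) - -(c + (a - b) / 2) = c - b by ring,
    show -((a + b) / 2) + -(c + (a - b) / 2) = -(a + c) by ring,
    show (a + b) / 2 + (c - (a - b) / 2) = c + b by ring,
    show (a + b) / 2 - (c - (a - b) / 2) = a - c by ring,
    show -(c + (a - b) / 2) - (c - (a - b) / 2) = -(2 * c) by ring,
    show -(c + (a - b) / 2) + (c - (a - b) / 2) = -(a - b) by ring,
    show (a + b) / 2 + -((a + b) / 2) = 0 by ring,
    show (a + b) / 2 - -((a + b) / 2) = a + b by ring] at h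
  simp only [theta1_neg, theta2_neg, theta3_neg] at h
  linear_combination -h

/-- The point `iv/2 + r` produces a factor `ϑ₂` at vertex `n + 1`, which cancels that of `Fₙ₊₁` in
`qₙ`, so only vertex `n` survives. -/
theorem planarBinormal_rho (hy : 0 < y) (hr : ∀ j : ℤ, r ≠ (j : ℝ) / 2) (n : ℤ) :
    planarBinormal (tauSmallF v r y n 0) (tauSmallG v r y n 0) (rho v r y n) =
      thetaPlanarBinormal v r y n := by
  have h := theta_binormal_identity hy (ptPlus v r) (Complex.I * v * n - r)
  rw [show Complex.I * v * n - r + ptPlus v r = vertexPt v (n + 1) by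
      rw [vertexPt_succ, ptPlus]; ring,
    show Complex.I * v * n - r - ptPlus v r = vertexPt v n - 2 * r by
      rw [vertexPt, ptPlus]; ring] at h
  have m1 := zpow_ne_zero n (R1_ne_zero (v := v) hy hr)
  have m3 := zpow_ne_zero n (R3_ne_zero (v := v) hy hr)
  have ha := alpha2_ne_zero hy hr
  have h2 := theta2_vertexPt_ne_zero (v := v) hy n
  have h2' := theta2_vertexPt_ne_zero (v := v) hy (n + 1)
  rw [planarBinormal, tauSmall_norm_sq hy hr, thetaPlanarBinormal, conj_tauSmallF_zero,
    tauSmallG_zero, conj_rho, rho, tauF_zero, tauF_zero, mul_zpow, div_zpow, zpow_neg, zpow_neg]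
  generalize R1 v r y ^ n = a at *
  generalize R3 v r y ^ n = b at *
  have hI := Complex.I_sq
  generalize theta2 (vertexPt v n - 2 * r) (modulus y) = q' at *
  generalize Complex.I * v * n - r = c at *
  field_simp
  linear_combination -h + (theta3 (ptPlus v r) (modulus y) ^ 2 * theta2 c (modulus y) ^ 2 -
        theta1 (ptPlus v r) (modulus y) ^ 2 * theta4 c (modulus y) ^ 2) * hI

/-- With the next phase the ratios `R₁`, `R₃` move the constants to `-iv/2 + r`; now `Fₙ` cancels
and vertex `n + 1` survives. -/
theorem planarBinormal_rho_succ (hy : 0 < y) (hr : ∀ j : ℤ, r ≠ (j : ℝ) / 2) (n : ℤ) :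
    planarBinormal (tauSmallF v r y n 0) (tauSmallG v r y n 0) (rho v r y (n + 1)) =
      thetaPlanarBinormal v r y (n + 1) := by
  have h := theta_binormal_identity hy (ptMinus v r) (Complex.I * v * n - r)
  rw [show Complex.I * v * n - r + ptMinus v r = vertexPt v n by
      rw [vertexPt, ptMinus]; ring,
    show Complex.I * v * n - r - ptMinus v r = vertexPt v (n + 1) - 2 * r by
      rw [vertexPt_succ, ptMinus]; ring] at h
  have m1 := zpow_ne_zero n (R1_ne_zero (v := v) hy hr)
  have m3 := zpow_ne_zero n (R3_ne_zero (v := v) hy hr)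
  have n1 := theta1_ptPlus_ne_zero (v := v) hy hr
  have n2 := theta1_ptMinus_ne_zero (v := v) hy hr
  have n3 := theta3_ptPlus_ne_zero (v := v) hy hr
  have n4 := theta3_ptMinus_ne_zero (v := v) hy hr
  have ha := alpha2_ne_zero hy hr
  have h2 := theta2_vertexPt_ne_zero (v := v) hy n
  have h2' := theta2_vertexPt_ne_zero (v := v) hy (n + 1)
  have z1 : R1 v r y ^ (n + 1) = R1 v r y ^ n * R1 v r y := zpow_add_one₀ (R1_ne_zero hy hr) n
  have z3 : R3 v r y ^ (n + 1) = R3 v r y ^ n * R3 v r y := zpow_add_one₀ (R3_ne_zero hy hr) n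
  rw [planarBinormal, tauSmall_norm_sq hy hr, thetaPlanarBinormal, conj_tauSmallF_zero,
    tauSmallG_zero, conj_rho, rho, tauF_zero, tauF_zero, mul_zpow, div_zpow, zpow_neg, zpow_neg,
    zpow_neg, zpow_neg, z1, z3]
  generalize R1 v r y ^ n = a at *
  generalize R3 v r y ^ n = b at *
  rw [R1, R3]
  have hI := Complex.I_sq
  generalize theta2 (vertexPt v (n + 1) - 2 * r) (modulus y) = q' at *
  generalize Complex.I * v * n - r = c at *
  field_simp
  linear_combination -h + (theta3 (ptMinus v r) (modulus y) ^ 2 * theta2 c (modulus y) ^ 2 -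
        theta1 (ptMinus v r) (modulus y) ^ 2 * theta4 c (modulus y) ^ 2) * hI

theorem binormalVec_two_rho (hy : 0 < y) (hr : ∀ j : ℤ, r ≠ (j : ℝ) / 2) (n : ℤ) :
    binormalVec (tauSmallF v r y n 0) (tauSmallG v r y n 0) (rho v r y n) 2 =
      thetaAxialBinormal v r y n := by
  have h := theta_axial_identity hy (Complex.I * v * n) (-(1 / 2 * Complex.I * v)) r
  rw [sub_neg_eq_add, sub_neg_eq_add, ← sub_eq_add_neg, ← sub_eq_add_neg,
    show (r : ℂ) + 1 / 2 * Complex.I * v = ptPlus v r by rw [ptPlus]; ring,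
    show (r : ℂ) - 1 / 2 * Complex.I * v = ptMinus v r by rw [ptMinus]; ring,
    ← vertexPt_succ, ← vertexPt] at h
  have m1 := zpow_ne_zero n (R1_ne_zero (v := v) hy hr)
  have m3 := zpow_ne_zero n (R3_ne_zero (v := v) hy hr)
  have ha := alpha2_ne_zero hy hr
  have h2 := theta2_vertexPt_ne_zero (v := v) hy n
  have h2' := theta2_vertexPt_ne_zero (v := v) hy (n + 1)
  rw [binormalVec_two, tauSmall_norm_sq hy hr, thetaAxialBinormal, conj_tauSmallF_zero,
    conj_tauSmallG_zero, tauSmallF_zero,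
    tauSmallG_zero, conj_rho, rho, tauF_zero, tauF_zero, div_zpow, zpow_neg, zpow_neg]
  generalize R1 v r y ^ n = a at *
  generalize R3 v r y ^ n = b at *
  have hI := Complex.I_sq
  generalize Complex.I * v * n - r = c at *
  generalize Complex.I * v * n + r = c' at *
  generalize theta1 (2 * r) (modulus y) = q' at *
  field_simp
  linear_combination h - (theta3 (ptPlus v r) (modulus y) * theta1 (ptMinus v r) (modulus y) *
          (theta2 c (modulus y) * theta4 c' (modulus y)) +
        theta3 (ptMinus v r) (modulus y) * theta1 (ptPlus v r) (modulus y) *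
          (theta2 c' (modulus y) * theta4 c (modulus y))) * hI

theorem binormalVec_two_rho_succ (hy : 0 < y) (hr : ∀ j : ℤ, r ≠ (j : ℝ) / 2) (n : ℤ) :
    binormalVec (tauSmallF v r y n 0) (tauSmallG v r y n 0) (rho v r y (n + 1)) 2 =
      thetaAxialBinormal v r y (n + 1) := by
  have h := theta_axial_identity hy (Complex.I * v * n) (1 / 2 * Complex.I * v) r
  rw [show (r : ℂ) + 1 / 2 * Complex.I * v = ptPlus v r by rw [ptPlus]; ring,
    show (r : ℂ) - 1 / 2 * Complex.I * v = ptMinus v r by rw [ptMinus]; ring,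
    ← vertexPt_succ, ← vertexPt] at h
  have m1 := zpow_ne_zero n (R1_ne_zero (v := v) hy hr)
  have m3 := zpow_ne_zero n (R3_ne_zero (v := v) hy hr)
  have n1 := theta1_ptPlus_ne_zero (v := v) hy hr
  have n2 := theta1_ptMinus_ne_zero (v := v) hy hr
  have n3 := theta3_ptPlus_ne_zero (v := v) hy hr
  have n4 := theta3_ptMinus_ne_zero (v := v) hy hr
  have ha := alpha2_ne_zero hy hr
  have h2 := theta2_vertexPt_ne_zero (v := v) hy n
  have h2' := theta2_vertexPt_ne_zero (v := v) hy (n + 1)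
  have z1 : R1 v r y ^ (n + 1) = R1 v r y ^ n * R1 v r y := zpow_add_one₀ (R1_ne_zero hy hr) n
  have z3 : R3 v r y ^ (n + 1) = R3 v r y ^ n * R3 v r y := zpow_add_one₀ (R3_ne_zero hy hr) n
  rw [binormalVec_two, tauSmall_norm_sq hy hr, thetaAxialBinormal, conj_tauSmallF_zero,
    conj_tauSmallG_zero, tauSmallF_zero,
    tauSmallG_zero, conj_rho, rho, tauF_zero, tauF_zero, div_zpow, zpow_neg, zpow_neg, z1, z3]
  generalize R1 v r y ^ n = a at *
  generalize R3 v r y ^ n = b at *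
  rw [R1, R3]
  have hI := Complex.I_sq
  generalize Complex.I * v * n - r = c at *
  generalize Complex.I * v * n + r = c' at *
  generalize theta1 (2 * r) (modulus y) = q' at *
  field_simp
  linear_combination h - (theta3 (ptMinus v r) (modulus y) * theta1 (ptPlus v r) (modulus y) *
          (theta2 c (modulus y) * theta4 c' (modulus y)) +
        theta3 (ptPlus v r) (modulus y) * theta1 (ptMinus v r) (modulus y) *
          (theta2 c' (modulus y) * theta4 c (modulus y))) * hI

/-- The closed forms depend only on the vertex, so the two edges meeting there share the binormal.
In particular `Bₙ₊₁` is orthogonal to `Tₙ` as well as to `Tₙ₊₁`. -/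
theorem binormalVec_rho_succ (hy : 0 < y) (hr : ∀ j : ℤ, r ≠ (j : ℝ) / 2) (n : ℤ) (i : Fin 3) :
    binormalVec (tauSmallF v r y (n + 1) 0) (tauSmallG v r y (n + 1) 0) (rho v r y (n + 1)) i =
      binormalVec (tauSmallF v r y n 0) (tauSmallG v r y n 0) (rho v r y (n + 1)) i := by
  fin_cases i
  · simp only [Fin.zero_eta, binormalVec_zero, planarBinormal_rho hy hr,
      planarBinormal_rho_succ hy hr]
  · simp only [Fin.mk_one, binormalVec_one, planarBinormal_rho hy hr,
      planarBinormal_rho_succ hy hr]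
  · simp only [Fin.reduceFinMk, binormalVec_two_rho hy hr, binormalVec_two_rho_succ hy hr]

/-- The Hermitian product of consecutive spinors is `ϑ₃(2r) ϑ₃(iv)` times the square of `ϑ₂` at the
common vertex. By `tangentVec_dot` its nonvanishing rules out antiparallel tangents. -/
theorem tauSmall_inner_ne_zero (hy : 0 < y) (hr : ∀ j : ℤ, r ≠ (j : ℝ) / 2) (n : ℤ) :
    conj (tauSmallF v r y n 0) * tauSmallF v r y (n + 1) 0 +
      conj (tauSmallG v r y n 0) * tauSmallG v r y (n + 1) 0 ≠ 0 := by
  have h := theta_three_term_3214 hy (ptMinus v r) 0 (vertexPt v (n + 1)) (ptPlus v r)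
  rw [show vertexPt v (n + 1) + ptPlus v r = Complex.I * v * (n + 1 : ℤ) + r by
      rw [vertexPt, ptPlus]; ring,
    show vertexPt v (n + 1) - ptPlus v r = Complex.I * v * n - r by
      rw [vertexPt_succ, ptPlus]; ring,
    show vertexPt v (n + 1) - ptMinus v r = Complex.I * v * (n + 1 : ℤ) - r by
      rw [vertexPt, ptMinus]; ring,
    show vertexPt v (n + 1) + ptMinus v r = Complex.I * v * n + r by
      rw [vertexPt_succ, ptMinus]; ring,
    show ptMinus v r + ptPlus v r = 2 * r by rw [ptMinus, ptPlus]; ring,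
    show ptMinus v r - ptPlus v r = -(Complex.I * v) by rw [ptMinus, ptPlus]; ring,
    theta3_neg, add_zero, sub_zero, add_zero, sub_zero, add_zero, sub_zero] at h
  have m1 := zpow_ne_zero n (R1_ne_zero (v := v) hy hr)
  have m3 := zpow_ne_zero n (R3_ne_zero (v := v) hy hr)
  have n2 := theta1_ptMinus_ne_zero (v := v) hy hr
  have n3 := theta3_ptPlus_ne_zero (v := v) hy hr
  have z1 : R1 v r y ^ (n + 1) = R1 v r y ^ n * R1 v r y := zpow_add_one₀ (R1_ne_zero hy hr) n
  have z3 : R3 v r y ^ (n + 1) = R3 v r y ^ n * R3 v r y := zpow_add_one₀ (R3_ne_zero hy hr) n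
  have e : conj (tauSmallF v r y n 0) * tauSmallF v r y (n + 1) 0 +
      conj (tauSmallG v r y n 0) * tauSmallG v r y (n + 1) 0 =
      theta3 (2 * r) (modulus y) * theta3 (Complex.I * v) (modulus y) *
        (theta2 (vertexPt v (n + 1)) (modulus y) * theta2 (vertexPt v (n + 1)) (modulus y)) := by
    rw [← h, conj_tauSmallF_zero, conj_tauSmallG_zero, tauSmallF_zero, tauSmallG_zero,
      zpow_neg, zpow_neg, z1, z3]
    generalize R1 v r y ^ n = a at *
    generalize R3 v r y ^ n = b at *
    rw [R1, R3]
    generalize Complex.I * v * n - r = c at *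
    generalize Complex.I * v * n + r = c' at *
    generalize Complex.I * v * (n + 1 : ℤ) - r = d at *
    generalize Complex.I * v * (n + 1 : ℤ) + r = d' at *
    field_simp
  rw [e]
  have h2 := theta2_vertexPt_ne_zero (v := v) hy (n + 1)
  obtain ⟨p, hp, h3⟩ := theta3_imaginary_pos v hy
  have hp' : (p : ℂ) ≠ 0 := by exact_mod_cast hp.ne'
  rw [h3]
  exact mul_ne_zero (mul_ne_zero (theta3_two_mul_ne_zero hy) hp') (mul_ne_zero h2 h2)

/-! ### The torsion angle -/

/-- Equality would force `ϑ₃(0)² ϑ₁(2r) ϑ₁(iv) = 0` by `theta_three_term_31`. Squaring handles the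
angles `0` and `π` at once. -/
theorem R1_div_R3_sq_ne_one (hy : 0 < y) (hr : ∀ j : ℤ, r ≠ (j : ℝ) / 2)
    (hv : ∀ j : ℤ, v ≠ y * j) : (R1 v r y * (R3 v r y)⁻¹) ^ 2 ≠ 1 := by
  intro h1
  have h := theta_three_term_31 hy (ptPlus v r) (ptMinus v r)
  rw [show ptPlus v r + ptMinus v r = 2 * r by rw [ptMinus, ptPlus]; ring,
    show ptPlus v r - ptMinus v r = Complex.I * v by rw [ptMinus, ptPlus]; ring] at h
  have n1 := theta1_ptPlus_ne_zero (v := v) hy hr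
  have n3 := theta3_ptPlus_ne_zero (v := v) hy hr
  have n4 := theta3_ptMinus_ne_zero (v := v) hy hr
  have k1 := theta1_two_mul_ne_zero hy hr
  have k2 := theta3_zero_ne_zero hy
  have k3 := theta1_imaginary_ne_zero hy hv
  rw [R1, R3] at h1
  field_simp at h1
  have : theta3 0 (modulus y) ^ 2 *
      (theta1 (2 * r) (modulus y) * theta1 (Complex.I * v) (modulus y)) = 0 := by
    linear_combination h - h1
  exact mul_ne_zero (pow_ne_zero 2 k2) (mul_ne_zero k1 k3) this

end

open scoped ComplexConjugate

/-! ### Algebra of the frame vectors -/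

theorem conj_tangentVec (f g : ℂ) (i : Fin 3) : conj (tangentVec f g i) = tangentVec f g i := by
  fin_cases i <;> simp [tangentVec] <;> ring

theorem conj_normalVec (f g ρ : ℂ) (i : Fin 3) : conj (normalVec f g ρ i) = normalVec f g ρ i := by
  fin_cases i <;> simp [normalVec, Complex.conj_ofNat] <;> ring

theorem conj_binormalVec (f g ρ : ℂ) (i : Fin 3) :
    conj (binormalVec f g ρ i) = binormalVec f g ρ i := by
  fin_cases i <;> simp [binormalVec, Complex.conj_ofNat] <;> ring

theorem tangentVec_dot (f g f' g' : ℂ) (hq : f * conj f + g * conj g ≠ 0)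
    (hq' : f' * conj f' + g' * conj g' ≠ 0) :
    tangentVec f g 0 * tangentVec f' g' 0 + tangentVec f g 1 * tangentVec f' g' 1 +
        tangentVec f g 2 * tangentVec f' g' 2 =
      2 * ((conj f * f' + conj g * g') * conj (conj f * f' + conj g * g')) /
        ((f * conj f + g * conj g) * (f' * conj f' + g' * conj g')) - 1 := by
  have hI := Complex.I_sq
  have hI0 := Complex.I_ne_zero
  simp only [tangentVec, Pi.smul_apply, smul_eq_mul, Matrix.cons_val, map_add, map_mul,
    Complex.conj_conj]
  -- From here on a variable and its conjugate are independent, and the claim is a rational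
  -- identity; the later frame lemmas do the same.
  generalize conj f = F at *
  generalize conj g = G at *
  generalize conj f' = F' at *
  generalize conj g' = G' at *
  field_simp
  rw [hI]
  ring

theorem tangentVec_sq (f g : ℂ) (hq : f * conj f + g * conj g ≠ 0) :
    tangentVec f g 0 ^ 2 + tangentVec f g 1 ^ 2 + tangentVec f g 2 ^ 2 = 1 := by
  have h := tangentVec_dot f g f g hq hq
  have e : 2 * ((conj f * f + conj g * g) * conj (conj f * f + conj g * g)) /
        ((f * conj f + g * conj g) * (f * conj f + g * conj g)) = 2 := by
    simp only [map_add, map_mul, Complex.conj_conj]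
    rw [mul_comm (conj f) f, mul_comm (conj g) g, mul_div_assoc, div_self (mul_ne_zero hq hq),
      mul_one]
  rw [e] at h
  linear_combination h

theorem normalVec_sq (f g ρ : ℂ) (hq : f * conj f + g * conj g ≠ 0)
    (hρ : 4 * (ρ * conj ρ) = 1) :
    normalVec f g ρ 0 ^ 2 + normalVec f g ρ 1 ^ 2 + normalVec f g ρ 2 ^ 2 = 1 := by
  have hI := Complex.I_sq
  have hI0 := Complex.I_ne_zero
  simp only [normalVec, Pi.smul_apply, smul_eq_mul, Matrix.cons_val]
  generalize conj f = F at *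
  generalize conj g = G at *
  generalize conj ρ = P at *
  field_simp
  rw [hI]
  linear_combination -(f * F + g * G) ^ 2 * hρ

theorem binormalVec_sq (f g ρ : ℂ) (hq : f * conj f + g * conj g ≠ 0)
    (hρ : 4 * (ρ * conj ρ) = 1) :
    binormalVec f g ρ 0 ^ 2 + binormalVec f g ρ 1 ^ 2 + binormalVec f g ρ 2 ^ 2 = 1 := by
  have hI := Complex.I_sq
  have hI0 := Complex.I_ne_zero
  simp only [binormalVec, Pi.smul_apply, smul_eq_mul, Matrix.cons_val]
  generalize conj f = F at *
  generalize conj g = G at *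
  generalize conj ρ = P at *
  field_simp
  rw [hI]
  linear_combination -(f * F + g * G) ^ 2 * hρ

theorem tangentVec_dot_normalVec (f g ρ : ℂ) (hq : f * conj f + g * conj g ≠ 0) :
    tangentVec f g 0 * normalVec f g ρ 0 + tangentVec f g 1 * normalVec f g ρ 1 +
      tangentVec f g 2 * normalVec f g ρ 2 = 0 := by
  have hI := Complex.I_sq
  have hI0 := Complex.I_ne_zero
  simp only [tangentVec, normalVec, Pi.smul_apply, smul_eq_mul, Matrix.cons_val]
  generalize conj f = F at *
  generalize conj g = G at *
  generalize conj ρ = P at *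
  field_simp
  rw [hI]
  ring

theorem tangentVec_dot_binormalVec (f g ρ : ℂ) (hq : f * conj f + g * conj g ≠ 0) :
    tangentVec f g 0 * binormalVec f g ρ 0 + tangentVec f g 1 * binormalVec f g ρ 1 +
      tangentVec f g 2 * binormalVec f g ρ 2 = 0 := by
  have hI0 := Complex.I_ne_zero
  simp only [tangentVec, binormalVec, Pi.smul_apply, smul_eq_mul, Matrix.cons_val]
  generalize conj f = F at *
  generalize conj g = G at *
  generalize conj ρ = P at *
  field_simp
  ring

theorem normalVec_dot_binormalVec (f g ρ : ℂ) (hq : f * conj f + g * conj g ≠ 0) :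
    normalVec f g ρ 0 * binormalVec f g ρ 0 + normalVec f g ρ 1 * binormalVec f g ρ 1 +
      normalVec f g ρ 2 * binormalVec f g ρ 2 = 0 := by
  have hI0 := Complex.I_ne_zero
  simp only [normalVec, binormalVec, Pi.smul_apply, smul_eq_mul, Matrix.cons_val]
  generalize conj f = F at *
  generalize conj g = G at *
  generalize conj ρ = P at *
  field_simp
  ring

theorem normalVec_cross_binormalVec (f g ρ : ℂ) (hq : f * conj f + g * conj g ≠ 0)
    (hρ : 4 * (ρ * conj ρ) = 1) :
    normalVec f g ρ 1 * binormalVec f g ρ 2 - normalVec f g ρ 2 * binormalVec f g ρ 1 =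
        tangentVec f g 0 ∧
      normalVec f g ρ 2 * binormalVec f g ρ 0 - normalVec f g ρ 0 * binormalVec f g ρ 2 =
        tangentVec f g 1 ∧
      normalVec f g ρ 0 * binormalVec f g ρ 1 - normalVec f g ρ 1 * binormalVec f g ρ 0 =
        tangentVec f g 2 := by
  have hI := Complex.I_sq
  have hI0 := Complex.I_ne_zero
  simp only [tangentVec, normalVec, binormalVec, Pi.smul_apply, smul_eq_mul, Matrix.cons_val]
  generalize conj f = F at *
  generalize conj g = G at *
  generalize conj ρ = P at *
  refine ⟨?_, ?_, ?_⟩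
  · field_simp
    rw [hI]
    linear_combination -(f * F + g * G) * (f * G + F * g) * hρ
  · field_simp
    linear_combination (f * F + g * G) * (F * g - f * G) * hρ
  · field_simp
    rw [hI]
    linear_combination -(f * F + g * G) * (f * F - g * G) * hρ

/-- Both vectors are real-linear in `ρ`, and the normal is the binormal with `-iρ` in place of `ρ`;
so a phase of `ρ` acts as a rotation of the normal plane. -/
theorem binormalVec_rotate (f g ρ : ℂ) (lam : ℝ) (i : Fin 3) :
    Real.sin lam * normalVec f g ρ i + Real.cos lam * binormalVec f g ρ i =
      binormalVec f g (ρ * Complex.exp (-lam * Complex.I)) i := by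
  have hI := Complex.I_sq
  have hs := Complex.two_sin lam
  have hc := Complex.two_cos lam
  have he : conj (Complex.exp (-lam * Complex.I)) = Complex.exp (lam * Complex.I) := by
    rw [← Complex.exp_conj]
    simp
  have hs' : Complex.sin lam =
      (Complex.exp (-lam * Complex.I) - Complex.exp (lam * Complex.I)) * Complex.I / 2 := by
    rw [← hs]
    ring
  have hc' : Complex.cos lam =
      (Complex.exp (lam * Complex.I) + Complex.exp (-lam * Complex.I)) / 2 := by
    rw [← hc]
    ring
  rw [Complex.ofReal_sin, Complex.ofReal_cos, hs', hc']
  fin_cases i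
  · simp only [Fin.zero_eta, normalVec, binormalVec, Pi.smul_apply, smul_eq_mul, Matrix.cons_val,
      map_mul, he, one_div, Complex.inv_I]
    ring
  · simp only [Fin.mk_one, normalVec, binormalVec, Pi.smul_apply, smul_eq_mul, Matrix.cons_val,
      map_mul, he, one_div, Complex.inv_I]
    ring_nf
    simp only [hI]
    ring
  · simp only [Fin.reduceFinMk, normalVec, binormalVec, Pi.smul_apply, smul_eq_mul,
      Matrix.cons_val, map_mul, he, div_eq_mul_inv, Complex.inv_I]
    ring

/-! ### Frames in Euclidean three-space -/

theorem frameMatrix_mem_specialOrthogonalGroup {T N B : E3}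
    (tt : T 0 ^ 2 + T 1 ^ 2 + T 2 ^ 2 = 1) (nn : N 0 ^ 2 + N 1 ^ 2 + N 2 ^ 2 = 1)
    (bb : B 0 ^ 2 + B 1 ^ 2 + B 2 ^ 2 = 1)
    (tn : T 0 * N 0 + T 1 * N 1 + T 2 * N 2 = 0) (tb : T 0 * B 0 + T 1 * B 1 + T 2 * B 2 = 0)
    (nb : N 0 * B 0 + N 1 * B 1 + N 2 * B 2 = 0)
    (c0 : N 1 * B 2 - N 2 * B 1 = T 0) (c1 : N 2 * B 0 - N 0 * B 2 = T 1)
    (c2 : N 0 * B 1 - N 1 * B 0 = T 2) :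
    frameMatrix T N B ∈ Matrix.specialOrthogonalGroup (Fin 3) ℝ := by
  rw [Matrix.mem_specialOrthogonalGroup_iff, Matrix.mem_orthogonalGroup_iff']
  constructor
  · ext i j
    fin_cases i <;> fin_cases j <;>
      simp [frameMatrix, Matrix.mul_apply, Fin.sum_univ_three] <;> linarith
  · rw [Matrix.det_fin_three]
    simp [frameMatrix]
    linear_combination tt + T 0 * c0 + T 1 * c1 + T 2 * c2

theorem exists_M3_of_mem_specialOrthogonalGroup {Q : Matrix (Fin 3) (Fin 3) ℝ}
    (hQ : Q ∈ Matrix.specialOrthogonalGroup (Fin 3) ℝ) (h02 : Q 0 2 = 0) (h12 : Q 1 2 = 0)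
    (h22 : Q 2 2 = 1) (h00 : Q 0 0 ≠ -1) :
    ∃ κ : ℝ, -Real.pi < κ ∧ κ < Real.pi ∧ Q = M3 κ := by
  rw [Matrix.mem_specialOrthogonalGroup_iff] at hQ
  obtain ⟨ho, hd⟩ := hQ
  have ho' := ho
  rw [Matrix.mem_orthogonalGroup_iff'] at ho
  rw [Matrix.mem_orthogonalGroup_iff] at ho'
  have a22 := congrFun (congrFun ho' 2) 2
  have a00 := congrFun (congrFun ho 0) 0
  have a01 := congrFun (congrFun ho 0) 1
  simp [Matrix.mul_apply, Fin.sum_univ_three, h22] at a22 a00 a01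
  rw [Matrix.det_fin_three, h02, h12, h22] at hd
  -- The third row has norm one and already contains the entry `1`.
  have h20 : Q 2 0 = 0 := by nlinarith [sq_nonneg (Q 2 0), sq_nonneg (Q 2 1)]
  have h21 : Q 2 1 = 0 := by nlinarith [sq_nonneg (Q 2 0), sq_nonneg (Q 2 1)]
  rw [h20] at a00 a01
  have e11 : Q 1 1 = Q 0 0 := by linear_combination -Q 1 1 * a00 + Q 1 0 * a01 + Q 0 0 * hd
  have e01 : Q 0 1 = -Q 1 0 := by linear_combination -Q 0 1 * a00 + Q 0 0 * a01 - Q 1 0 * hd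
  set z : ℂ := ⟨Q 0 0, Q 1 0⟩ with hz
  have hn : ‖z‖ = 1 := by
    rw [← sq_eq_sq₀ (norm_nonneg _) zero_le_one, ← Complex.normSq_eq_norm_sq, Complex.normSq_mk]
    linarith
  have hz0 : z ≠ 0 := norm_pos_iff.1 (by rw [hn]; exact one_pos)
  have hc : Real.cos z.arg = Q 0 0 := by rw [Complex.cos_arg hz0, hn, div_one]
  have hs : Real.sin z.arg = Q 1 0 := by rw [Complex.sin_arg, hn, div_one]
  refine ⟨z.arg, Complex.neg_pi_lt_arg z, lt_of_le_of_ne (Complex.arg_le_pi z) ?_, ?_⟩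
  · intro h
    rw [h, Real.cos_pi] at hc
    exact h00 hc.symm
  · ext i j
    fin_cases i <;> fin_cases j <;> simp [M3, hc, hs, h02, h12, h22, h20, h21, e11, e01]

theorem M1_mem_specialOrthogonalGroup (θ : ℝ) :
    M1 θ ∈ Matrix.specialOrthogonalGroup (Fin 3) ℝ := by
  have h := Real.sin_sq_add_cos_sq θ
  rw [Matrix.mem_specialOrthogonalGroup_iff, Matrix.mem_orthogonalGroup_iff']
  constructor
  · ext i j
    fin_cases i <;> fin_cases j <;>
      simp [M1, Matrix.mul_apply, Fin.sum_univ_three] <;> linarith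
  · rw [Matrix.det_fin_three]
    simp [M1]
    linarith

/-- The frame turned by `M1 (-lam)` has third column `B'`, so the remaining rotation fixes the third
axis. Its top left entry is the inner product of the tangents, which excludes the angle `π`. -/
theorem exists_curvature_of_frames {T N B T' N' B' : E3} {lam : ℝ}
    (hΦ : frameMatrix T N B ∈ Matrix.specialOrthogonalGroup (Fin 3) ℝ)
    (hΦ' : frameMatrix T' N' B' ∈ Matrix.specialOrthogonalGroup (Fin 3) ℝ)
    (hB : ∀ i, B' i = Real.sin lam * N i + Real.cos lam * B i)
    (hT : T 0 * T' 0 + T 1 * T' 1 + T 2 * T' 2 ≠ -1) :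
    ∃ κ : ℝ, (-Real.pi < κ ∧ κ < Real.pi) ∧
      frameMatrix T' N' B' = frameMatrix T N B * (M1 (-lam) * M3 κ) := by
  set P := frameMatrix T N B * M1 (-lam) with hP
  have hPm : P ∈ Matrix.specialOrthogonalGroup (Fin 3) ℝ :=
    mul_mem hΦ (M1_mem_specialOrthogonalGroup _)
  have hPo := (Matrix.mem_orthogonalGroup_iff' _ _).1 hPm.1
  have hPo' := (Matrix.mem_orthogonalGroup_iff _ _).1 hPm.1
  have hPt : P.transpose ∈ Matrix.specialOrthogonalGroup (Fin 3) ℝ := by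
    rw [Matrix.mem_specialOrthogonalGroup_iff, Matrix.mem_orthogonalGroup_iff,
      Matrix.transpose_transpose, Matrix.det_transpose]
    exact ⟨hPo, hPm.2⟩
  have hcol : ∀ i, frameMatrix T' N' B' i 2 = P i 2 := by
    intro i
    have := hB i
    fin_cases i <;>
      simpa [hP, frameMatrix, M1, Matrix.mul_apply, Fin.sum_univ_three, mul_comm] using this
  have hQ2 : ∀ i, (P.transpose * frameMatrix T' N' B') i 2 = (1 : Matrix (Fin 3) (Fin 3) ℝ) i 2 := by
    intro i
    rw [← hPo, Matrix.mul_apply, Matrix.mul_apply]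
    simp only [hcol]
  obtain ⟨κ, h1, h2, h3⟩ := exists_M3_of_mem_specialOrthogonalGroup (mul_mem hPt hΦ')
    (by rw [hQ2]; simp) (by rw [hQ2]; simp) (by rw [hQ2]; simp) (by
      intro h
      apply hT
      rw [← h]
      simp [hP, frameMatrix, M1, Matrix.mul_apply, Fin.sum_univ_three])
  refine ⟨κ, ⟨h1, h2⟩, ?_⟩
  rw [← Matrix.mul_assoc, ← hP, ← h3, ← Matrix.mul_assoc, hPo', Matrix.one_mul]

open scoped ComplexConjugate

section

variable {y v r : ℝ}

/-! ### Logarithmic derivatives and conjugation -/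

theorem conj_logDeriv {θ : ℂ → ℂ} (h : ∀ x, conj (θ x) = θ (conj x)) (x : ℂ) :
    conj (logDeriv θ x) = logDeriv θ (conj x) := by
  have e : (conj ∘ θ ∘ conj) = θ := by
    funext z
    simp [h]
  rw [logDeriv_apply, logDeriv_apply, map_div₀, h]
  congr 1
  have := congrFun (deriv_conj_conj (f := θ)) (conj x)
  rw [e, Function.comp_apply, Function.comp_apply, Complex.conj_conj] at this
  exact this.symm

theorem conj_Delta1 : conj (Delta1 v r y) = -Delta1 v r y := by
  have h := conj_logDeriv (θ := fun x => theta1 x (modulus y)) fun x => conj_theta1 x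
  rw [Delta1, map_sub, h, h, conj_ptPlus, conj_ptMinus, neg_sub]

theorem conj_Delta3 : conj (Delta3 v r y) = -Delta3 v r y := by
  have h := conj_logDeriv (θ := fun x => theta3 x (modulus y)) fun x => conj_theta3 x
  rw [Delta3, map_sub, h, h, conj_ptPlus, conj_ptMinus, neg_sub]

theorem logDeriv_neg_of_even {θ : ℂ → ℂ} (h : ∀ x, θ (-x) = θ x) (x : ℂ) :
    logDeriv θ (-x) = -logDeriv θ x := by
  have h1 := deriv_comp_neg θ x
  simp only [h] at h1
  rw [logDeriv_apply, logDeriv_apply, h, ← neg_div, h1, neg_neg]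

theorem conj_vertexPt (n : ℤ) : conj (vertexPt v n) = -vertexPt v n := by
  simp [vertexPt, Complex.conj_ofNat]
  ring

/-- It is a quotient of purely imaginary numbers: `Δ₁` and `Δ₃` are imaginary, and so is `ϑ₂'/ϑ₂` on
the imaginary axis, by evenness. -/
theorem conj_logDeriv_tauF_zero (hy : 0 < y) (hr : ∀ j : ℤ, r ≠ (j : ℝ) / 2) (n : ℤ) :
    conj (logDeriv (tauF v r y n) 0) = logDeriv (tauF v r y n) 0 := by
  have h := conj_logDeriv (θ := fun x => theta2 x (modulus y)) fun x => conj_theta2 x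
  have h' := logDeriv_neg_of_even (θ := fun x => theta2 x (modulus y)) fun x => theta2_neg x
  rw [logDeriv_tauF_zero hy hr, map_div₀, map_add, map_mul, map_sub, h, conj_vertexPt, h',
    conj_Delta1, conj_Delta3, map_intCast, ← neg_div_neg_eq]
  congr 1 <;> ring

theorem conj_positionVec {n : ℤ} {H F L : ℂ} (hF : conj F = F) (hL : conj L = L) (i : Fin 3) :
    conj (positionVec n H F L i) = positionVec n H F L i := by
  fin_cases i
  · simp [positionVec, hF]
    ring
  · simp [positionVec, hF]
    ring
  · simp [positionVec, hL, Complex.conj_ofNat]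

/-! ### The limit of the quotient of tau functions -/

/-- Zeros of a nontrivial entire function are isolated. This handles vertices where `G̃ₙ(0)` itself
vanishes. -/
theorem theta4_eventually_ne_zero (hy : 0 < y) (x : ℂ) :
    ∀ᶠ z in 𝓝[≠] x, theta4 z (modulus y) ≠ 0 := by
  have ha : ∀ s, AnalyticOnNhd ℂ (fun z => theta4 z (modulus y)) s := fun s z _ =>
    (differentiable_theta4 hy).analyticAt z
  rcases (ha Set.univ x trivial).eventually_eq_zero_or_eventually_ne_zero with h | h
  · exfalso
    have h0 := (ha Set.univ).eqOn_zero_of_preconnected_of_eventuallyEq_zero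
      isPreconnected_univ (Set.mem_univ x) h (Set.mem_univ 0)
    have := theta4_real_ne_zero hy 0
    rw [Complex.ofReal_zero] at this
    exact this h0
  · exact h

theorem tendsto_tauG_div_tauGtilde (hy : 0 < y) (hr : ∀ j : ℤ, r ≠ (j : ℝ) / 2)
    (hv : ∀ j : ℤ, v ≠ y * j) (n : ℤ) :
    Tendsto (fun z : ℂ => 1 / 2 * (tauG v r y n z / tauGtilde v r y n z)) (𝓝[≠] 0)
      (𝓝 (rho v r y n)) := by
  have hD := Delta3_sub_Delta1_ne_zero hy hr hv
  have ht : Tendsto (fun z : ℂ => mu v r y n z - 1 / 2 * Complex.I * v) (𝓝[≠] 0)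
      (𝓝[≠] (vertexPt v n)) := by
    refine tendsto_nhdsWithin_iff.2 ⟨?_, ?_⟩
    · have hc : Continuous fun z : ℂ => mu v r y n z - 1 / 2 * Complex.I * v := by
        simp only [mu]
        fun_prop
      have := hc.tendsto 0
      rw [show mu v r y n 0 - 1 / 2 * Complex.I * v = vertexPt v n by
        simp [mu, vertexPt]] at this
      exact this.mono_left nhdsWithin_le_nhds
    · filter_upwards [self_mem_nhdsWithin] with z hz
      simp only [Set.mem_compl_iff, Set.mem_singleton_iff] at hz ⊢
      rw [mu, vertexPt]
      intro h
      have h' : z / (Delta3 v r y - Delta1 v r y) = 0 := by linear_combination h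
      exact hz ((div_eq_zero_iff.1 h').resolve_right hD)
  -- Away from zeros of `ϑ₄` the quotient does not depend on `z`. The punctured neighbourhoods
  -- correspond because `Δ₃ - Δ₁ ≠ 0` makes `z ↦ μₙ(z)` injective.
  refine tendsto_const_nhds.congr' ?_
  filter_upwards [ht.eventually (theta4_eventually_ne_zero hy (vertexPt v n))] with z hz
  have ha := alpha2_ne_zero hy hr
  have h1 := theta1_imaginary_ne_zero hy hv
  have h0 := theta3_zero_ne_zero hy
  have m1 := zpow_ne_zero n (R1_ne_zero (v := v) hy hr)
  have he : expFactor v r y n z ≠ 0 := Complex.exp_ne_zero _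
  have hI := Complex.I_sq
  have hI0 := Complex.I_ne_zero
  rw [tauG, tauGtilde, rho, div_zpow, zpow_neg]
  generalize R1 v r y ^ n = a at *
  generalize R3 v r y ^ n = b at *
  generalize theta4 (mu v r y n z - 1 / 2 * Complex.I * v) (modulus y) = t at *
  generalize theta1 (Complex.I * v) (modulus y) = t1 at *
  field_simp
  rw [hI]
  ring

/-! ### Derivative of the closure condition -/

theorem hasDerivAt_comp_ofReal_add {θ : ℂ → ℂ} (hθ : Differentiable ℂ θ) (c : ℂ) (r : ℝ) :
    HasDerivAt (fun s : ℝ => θ (c + s)) (deriv θ (c + r)) r :=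
  ((hθ (c + r)).hasDerivAt.comp_const_add c (r : ℂ)).comp_ofReal

theorem hasDerivAt_quotient_logDeriv {θ : ℂ → ℂ} (hθ : Differentiable ℂ θ) {c d : ℂ} {r : ℝ}
    (hc : θ (c + r) ≠ 0) (hd : θ (d + r) ≠ 0) :
    HasDerivAt (fun s : ℝ => θ (c + s) / θ (d + s))
      (θ (c + r) / θ (d + r) * (logDeriv θ (c + r) - logDeriv θ (d + r))) r := by
  have h := (hasDerivAt_comp_ofReal_add hθ c r).div (hasDerivAt_comp_ofReal_add hθ d r) hd
  refine h.congr_deriv ?_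
  rw [logDeriv_apply, logDeriv_apply]
  field_simp

theorem hasDerivAt_R1 (hy : 0 < y) (hr : ∀ j : ℤ, r ≠ (j : ℝ) / 2) :
    HasDerivAt (fun s : ℝ => R1 v s y) (R1 v r y * Delta1 v r y) r :=
  hasDerivAt_quotient_logDeriv (differentiable_theta1 hy) (theta1_ptMinus_ne_zero hy hr)
    (theta1_ptPlus_ne_zero hy hr)

theorem hasDerivAt_R3 (hy : 0 < y) (hr : ∀ j : ℤ, r ≠ (j : ℝ) / 2) :
    HasDerivAt (fun s : ℝ => R3 v s y) (R3 v r y * Delta3 v r y) r :=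
  hasDerivAt_quotient_logDeriv (differentiable_theta3 hy) (theta3_ptMinus_ne_zero hy hr)
    (theta3_ptPlus_ne_zero hy hr)

/-- Both theta arguments in `Rⱼ` move with `r`, so `Rⱼ' = Rⱼ Δⱼ`; the rest is logarithmic
differentiation of `Λ + 1`. -/
theorem hasDerivAt_closureLambda (k : ℕ) (m : ℤ) (hy : 0 < y) (hr : ∀ j : ℤ, r ≠ (j : ℝ) / 2) :
    HasDerivAt (fun s : ℝ => closureLambda k m v y s)
      ((closureLambda k m v y r + 1) *
        (4 * Real.pi * Complex.I * m - (Delta3 v r y + Delta1 v r y) * k)) r := by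
  have n1 := R1_ne_zero (v := v) hy hr
  have n3 := R3_ne_zero (v := v) hy hr
  have hR := (hasDerivAt_R1 (v := v) hy hr).mul (hasDerivAt_R3 (v := v) hy hr)
  have hz := (hasDerivAt_zpow (-(k : ℤ)) (R1 v r y * R3 v r y) (Or.inl (mul_ne_zero n1 n3))).comp r
    hR
  have he : HasDerivAt (fun s : ℝ => Complex.exp (Real.pi * Complex.I * m * (4 * s + 1)))
      (Complex.exp (Real.pi * Complex.I * m * (4 * r + 1)) *
        (4 * Real.pi * Complex.I * m)) r := by
    have h1 : HasDerivAt (fun s : ℂ => Real.pi * Complex.I * m * (4 * s + 1))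
        (4 * Real.pi * Complex.I * m) (r : ℂ) := by
      have := (((hasDerivAt_id (r : ℂ)).const_mul 4).add_const 1).const_mul
        (Real.pi * Complex.I * m : ℂ)
      exact this.congr_deriv (by ring)
    exact h1.cexp.comp_ofReal
  have h := (he.mul hz).sub_const 1
  refine h.congr_deriv ?_
  rw [closureLambda, zpow_sub_one₀ (mul_ne_zero n1 n3)]
  simp only [Function.comp_apply, Pi.mul_apply]
  push_cast
  field_simp
  ring

/-! ### Quasi-periodicity in the index -/

theorem vertexPt_add_period {k : ℕ} {m : ℤ} (hkv : (k : ℝ) * v = m * y) (n : ℤ) :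
    vertexPt v (n + k) = vertexPt v n + m * modulus y := by
  have h : (k : ℂ) * v = m * y := by exact_mod_cast hkv
  rw [vertexPt, vertexPt, modulus]
  push_cast
  linear_combination Complex.I * h

theorem exp_neg_pi_mul_int_sq (m : ℤ) :
    Complex.exp (-(Real.pi * Complex.I * m)) * Complex.exp (-(Real.pi * Complex.I * m)) = 1 := by
  rw [← Complex.exp_add, Complex.exp_eq_one_iff]
  exact ⟨-m, by push_cast; ring⟩

theorem theta2_vertexPt_add_period {k : ℕ} {m : ℤ} (hkv : (k : ℝ) * v = m * y) (n : ℤ) (c : ℂ) :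
    theta2 (vertexPt v (n + k) - c) (modulus y) =
      Complex.exp (Real.pi * y * m ^ 2 - 2 * Real.pi * Complex.I * m * vertexPt v n) *
        Complex.exp (2 * Real.pi * Complex.I * m * c) *
        theta2 (vertexPt v n - c) (modulus y) := by
  rw [vertexPt_add_period hkv, add_sub_right_comm, theta2_add_modulus, ← Complex.exp_add]
  congr 2
  ring

theorem theta4_vertexPt_add_period {k : ℕ} {m : ℤ} (hkv : (k : ℝ) * v = m * y) (n : ℤ) (c : ℂ) :
    theta4 (vertexPt v (n + k) - c) (modulus y) =
      Complex.exp (Real.pi * y * m ^ 2 - 2 * Real.pi * Complex.I * m * vertexPt v n) *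
        Complex.exp (2 * Real.pi * Complex.I * m * c) * Complex.exp (-(Real.pi * Complex.I * m)) *
        theta4 (vertexPt v n - c) (modulus y) := by
  rw [vertexPt_add_period hkv, add_sub_right_comm, theta4_add_modulus, ← Complex.exp_add,
    ← Complex.exp_add]
  congr 2
  ring

theorem exp_mul_of_closureLambda {k : ℕ} {m : ℤ} (hΛ : closureLambda k m v y r = 0) :
    Complex.exp (2 * Real.pi * Complex.I * m * (2 * r)) * (R1 v r y * R3 v r y) ^ (-(k : ℤ)) =
      Complex.exp (-(Real.pi * Complex.I * m)) := by
  have h : Complex.exp (2 * Real.pi * Complex.I * m * (2 * r)) =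
      Complex.exp (Real.pi * Complex.I * m * (4 * r + 1)) *
        Complex.exp (-(Real.pi * Complex.I * m)) := by
    rw [← Complex.exp_add]
    congr 1
    ring
  rw [closureLambda] at hΛ
  rw [h]
  linear_combination Complex.exp (-(Real.pi * Complex.I * m)) * hΛ

/-- The common quasi-period factor cancels in the quotient. What remains is `e^{4πimr}` from the
offset `2r`, the sign `(-1)ᵐ` from `ϑ₄`, and `(R₁R₃)⁻ᵏ`, whose product is `Λ + 1`. -/
theorem tauH_div_tauF_add_period {k : ℕ} {m : ℤ} (hy : 0 < y) (hr : ∀ j : ℤ, r ≠ (j : ℝ) / 2)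
    (hkv : (k : ℝ) * v = m * y) (hΛ : closureLambda k m v y r = 0) (n : ℤ) :
    tauH v r y (n + k) 0 / tauF v r y (n + k) 0 = tauH v r y n 0 / tauF v r y n 0 := by
  have h2 := theta2_vertexPt_add_period hkv n 0
  have h4 := theta4_vertexPt_add_period hkv n (2 * r)
  have he := exp_mul_of_closureLambda hΛ
  have hs := exp_neg_pi_mul_int_sq m
  have n1 := R1_ne_zero (v := v) hy hr
  have n3 := R3_ne_zero (v := v) hy hr
  rw [sub_zero, sub_zero, mul_zero, Complex.exp_zero, mul_one] at h2
  have e1 : R1 v r y ^ (-(n + k)) * R3 v r y ^ (-(n + k)) =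
      R1 v r y ^ (-n) * R3 v r y ^ (-n) * (R1 v r y * R3 v r y) ^ (-(k : ℤ)) := by
    rw [neg_add, zpow_add₀ n1, zpow_add₀ n3, mul_zpow]
    ring
  have hE : Complex.exp
      (Real.pi * y * m ^ 2 - 2 * Real.pi * Complex.I * m * vertexPt v n) ≠ 0 :=
    Complex.exp_ne_zero _
  rw [tauH_zero, tauH_zero, tauF_zero, tauF_zero, h2, h4]
  generalize Complex.exp
      (Real.pi * y * m ^ 2 - 2 * Real.pi * Complex.I * m * vertexPt v n) = E at *
  have num : u2 v r y / (alpha2 r y * s2 v r y) * R1 v r y ^ (-(n + k)) *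
      R3 v r y ^ (-(n + k)) * (E * Complex.exp (2 * Real.pi * Complex.I * m * (2 * r)) *
        Complex.exp (-(Real.pi * Complex.I * m)) *
        theta4 (vertexPt v n - 2 * r) (modulus y)) =
      E * (u2 v r y / (alpha2 r y * s2 v r y) * R1 v r y ^ (-n) * R3 v r y ^ (-n) *
        theta4 (vertexPt v n - 2 * r) (modulus y)) := by
    generalize u2 v r y / (alpha2 r y * s2 v r y) = c
    generalize theta4 (vertexPt v n - 2 * r) (modulus y) = t
    generalize Complex.exp (-(Real.pi * Complex.I * m)) = σ at *
    generalize Complex.exp (2 * Real.pi * Complex.I * m * (2 * r)) = ε at *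
    linear_combination c * E * ε * σ * t * e1 +
      c * E * σ * t * R1 v r y ^ (-n) * R3 v r y ^ (-n) * he +
      c * E * t * R1 v r y ^ (-n) * R3 v r y ^ (-n) * hs
  rw [num, mul_left_comm (alpha2 r y), mul_div_mul_left _ _ hE]

theorem logDeriv_theta2_add_modulus (hy : 0 < y) (m : ℤ) {x : ℂ}
    (hx : theta2 x (modulus y) ≠ 0) :
    logDeriv (fun x => theta2 x (modulus y)) (x + m * modulus y) =
      logDeriv (fun x => theta2 x (modulus y)) x - 2 * Real.pi * Complex.I * m := by
  have hd := (differentiable_theta2 hy x).hasDerivAt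
  have he : HasDerivAt (fun x : ℂ => Complex.exp
      (Real.pi * y * m ^ 2 - 2 * Real.pi * Complex.I * m * x))
      (Complex.exp (Real.pi * y * m ^ 2 - 2 * Real.pi * Complex.I * m * x) *
        -(2 * Real.pi * Complex.I * m)) x := by
    have := (((hasDerivAt_id x).const_mul (2 * Real.pi * Complex.I * m)).const_sub
      (Real.pi * y * m ^ 2 : ℂ)).cexp
    simpa using this
  have hp := he.mul hd
  have hs : HasDerivAt (fun x => theta2 (x + m * modulus y) (modulus y))
      (deriv (fun x => theta2 x (modulus y)) (x + m * modulus y)) x :=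
    (differentiable_theta2 hy (x + m * modulus y)).hasDerivAt.comp_add_const x _
  have e := hs.unique (hp.congr_of_eventuallyEq (Filter.Eventually.of_forall fun x =>
    theta2_add_modulus x m))
  rw [logDeriv_apply, logDeriv_apply, e, theta2_add_modulus]
  have hE : Complex.exp
      (Real.pi * y * m ^ 2 - 2 * Real.pi * Complex.I * m * x) ≠ 0 := Complex.exp_ne_zero _
  generalize Complex.exp (Real.pi * y * m ^ 2 - 2 * Real.pi * Complex.I * m * x) = E at *
  field_simp
  ring

/-- The quasi-period factor adds `-2πim` to `ϑ₂'/ϑ₂`, and the increment `k - 2(kΔ₃ - 2πim)/(Δ₃ -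
Δ₁)` is `-Ξ`. -/
theorem axial_position_add_period {k : ℕ} {m : ℤ} (hy : 0 < y)
    (hr : ∀ j : ℤ, r ≠ (j : ℝ) / 2) (hv : ∀ j : ℤ, v ≠ y * j)
    (hkv : (k : ℝ) * v = m * y) (hΞ : closureXi k m v y r = 0) (n : ℤ) :
    ((n + k : ℤ) : ℂ) - 2 * logDeriv (tauF v r y (n + k)) 0 =
      n - 2 * logDeriv (tauF v r y n) 0 := by
  have hD := Delta3_sub_Delta1_ne_zero hy hr hv
  rw [closureXi, div_eq_zero_iff, or_iff_left hD] at hΞ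
  rw [logDeriv_tauF_zero hy hr, logDeriv_tauF_zero hy hr, vertexPt_add_period hkv,
    logDeriv_theta2_add_modulus hy m (theta2_vertexPt_ne_zero hy n)]
  generalize logDeriv (fun x => theta2 x (modulus y)) (vertexPt v n) = L at *
  push_cast
  field_simp
  linear_combination -hΞ

theorem thetaPlanarBinormal_add_period {k : ℕ} {m : ℤ} (hy : 0 < y)
    (hr : ∀ j : ℤ, r ≠ (j : ℝ) / 2) (hkv : (k : ℝ) * v = m * y)
    (hΛ : closureLambda k m v y r = 0) (n : ℤ) :
    thetaPlanarBinormal v r y (n + k) =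
      Complex.exp (-(Real.pi * Complex.I * m)) * thetaPlanarBinormal v r y n := by
  have h2 := theta2_vertexPt_add_period hkv n 0
  have h2' := theta2_vertexPt_add_period hkv n (2 * r)
  have he := exp_mul_of_closureLambda hΛ
  have n0 := mul_ne_zero (R1_ne_zero (v := v) hy hr) (R3_ne_zero (v := v) hy hr)
  have ha := alpha2_ne_zero hy hr
  have hn := theta2_vertexPt_ne_zero (v := v) hy n
  rw [sub_zero, sub_zero, mul_zero, Complex.exp_zero, mul_one] at h2
  have hE : Complex.exp
      (Real.pi * y * m ^ 2 - 2 * Real.pi * Complex.I * m * vertexPt v n) ≠ 0 :=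
    Complex.exp_ne_zero _
  rw [thetaPlanarBinormal, thetaPlanarBinormal, h2, h2', neg_add, zpow_add₀ n0, ← he]
  generalize Complex.exp
      (Real.pi * y * m ^ 2 - 2 * Real.pi * Complex.I * m * vertexPt v n) = E at *
  generalize (R1 v r y * R3 v r y) ^ (-(k : ℤ)) = ε at *
  generalize (R1 v r y * R3 v r y) ^ (-n) = ε' at *
  generalize Complex.exp (2 * Real.pi * Complex.I * m * (2 * r)) = ε'' at *
  generalize theta2 (vertexPt v n - 2 * r) (modulus y) = t at *
  field_simp

theorem thetaAxialBinormal_add_period {k : ℕ} {m : ℤ} (hy : 0 < y)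
    (hr : ∀ j : ℤ, r ≠ (j : ℝ) / 2) (hkv : (k : ℝ) * v = m * y) (n : ℤ) :
    thetaAxialBinormal v r y (n + k) =
      Complex.exp (-(Real.pi * Complex.I * m)) * thetaAxialBinormal v r y n := by
  have h2 := theta2_vertexPt_add_period hkv n 0
  have h4 := theta4_vertexPt_add_period hkv n 0
  have ha := alpha2_ne_zero hy hr
  have hn := theta2_vertexPt_ne_zero (v := v) hy n
  rw [sub_zero, sub_zero, mul_zero, Complex.exp_zero, mul_one] at h2 h4
  have hE : Complex.exp
      (Real.pi * y * m ^ 2 - 2 * Real.pi * Complex.I * m * vertexPt v n) ≠ 0 :=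
    Complex.exp_ne_zero _
  rw [thetaAxialBinormal, thetaAxialBinormal, h2, h4]
  generalize Complex.exp
      (Real.pi * y * m ^ 2 - 2 * Real.pi * Complex.I * m * vertexPt v n) = E at *
  generalize Complex.exp (-(Real.pi * Complex.I * m)) = σ at *
  generalize theta1 (2 * r) (modulus y) = t at *
  field_simp

theorem binormalVec_add_period {k : ℕ} {m : ℤ} (hy : 0 < y) (hr : ∀ j : ℤ, r ≠ (j : ℝ) / 2)
    (hkv : (k : ℝ) * v = m * y) (hΛ : closureLambda k m v y r = 0) (n : ℤ) :
    (∀ i, binormalVec (tauSmallF v r y (n + k) 0) (tauSmallG v r y (n + k) 0)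
        (rho v r y (n + k)) i =
      binormalVec (tauSmallF v r y n 0) (tauSmallG v r y n 0) (rho v r y n) i) ∨
    (∀ i, binormalVec (tauSmallF v r y (n + k) 0) (tauSmallG v r y (n + k) 0)
        (rho v r y (n + k)) i =
      -binormalVec (tauSmallF v r y n 0) (tauSmallG v r y n 0) (rho v r y n) i) := by
  have hp := thetaPlanarBinormal_add_period hy hr hkv hΛ n
  have hz := thetaAxialBinormal_add_period hy hr hkv n
  -- The planar and axial parts share the multiplier `e^{-πim} = ±1`, so one sign serves all
  -- components.
  rcases mul_self_eq_one_iff.1 (exp_neg_pi_mul_int_sq m) with h | h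
  · left
    intro i
    rw [h, one_mul] at hp hz
    fin_cases i
    · simp only [Fin.zero_eta, binormalVec_zero, planarBinormal_rho hy hr, hp]
    · simp only [Fin.mk_one, binormalVec_one, planarBinormal_rho hy hr, hp]
    · simp only [Fin.reduceFinMk, binormalVec_two_rho hy hr, hz]
  · right
    intro i
    rw [h, neg_one_mul] at hp hz
    fin_cases i
    · simp only [Fin.zero_eta, binormalVec_zero, planarBinormal_rho hy hr, hp, map_neg]
      ring
    · simp only [Fin.mk_one, binormalVec_one, planarBinormal_rho hy hr, hp, map_neg]
      ring
    · simp only [Fin.reduceFinMk, binormalVec_two_rho hy hr, hz]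

end

open scoped ComplexConjugate

/-- The real vector formed by the real parts of the components of a complex vector. -/
noncomputable def realVec (c : Fin 3 → ℂ) : E3 := WithLp.toLp 2 fun i => (c i).re

theorem ofReal_realVec {c : Fin 3 → ℂ} (h : ∀ i, conj (c i) = c i) (i : Fin 3) :
    ((realVec c i : ℝ) : ℂ) = c i :=
  ofReal_re_of_conj (h i)

theorem norm_eq_one_of_sum_sq {a : E3} (h : a 0 ^ 2 + a 1 ^ 2 + a 2 ^ 2 = 1) : ‖a‖ = 1 := by
  rw [EuclideanSpace.norm_eq, Fin.sum_univ_three]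
  simp only [Real.norm_eq_abs, sq_abs]
  rw [h, Real.sqrt_one]

theorem realVec_frame {f g ρ : ℂ} (hq : f * conj f + g * conj g ≠ 0)
    (hρ : 4 * (ρ * conj ρ) = 1) :
    (∑ i, realVec (tangentVec f g) i ^ 2 = 1 ∧ ∑ i, realVec (binormalVec f g ρ) i ^ 2 = 1) ∧
      ∑ i, realVec (normalVec f g ρ) i * realVec (binormalVec f g ρ) i = 0 ∧
      cross (realVec (normalVec f g ρ)) (realVec (binormalVec f g ρ)) =
        realVec (tangentVec f g) ∧
      frameMatrix (realVec (tangentVec f g)) (realVec (normalVec f g ρ))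
        (realVec (binormalVec f g ρ)) ∈ Matrix.specialOrthogonalGroup (Fin 3) ℝ := by
  have hT := ofReal_realVec (conj_tangentVec f g)
  have hN := ofReal_realVec (conj_normalVec f g ρ)
  have hB := ofReal_realVec (conj_binormalVec f g ρ)
  have tt := tangentVec_sq f g hq
  have nn := normalVec_sq f g ρ hq hρ
  have bb := binormalVec_sq f g ρ hq hρ
  have tn := tangentVec_dot_normalVec f g ρ hq
  have tb := tangentVec_dot_binormalVec f g ρ hq
  have nb := normalVec_dot_binormalVec f g ρ hq
  obtain ⟨c0, c1, c2⟩ := normalVec_cross_binormalVec f g ρ hq hρ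
  simp only [← hT, ← hN, ← hB] at tt nn bb tn tb nb c0 c1 c2
  norm_cast at tt nn bb tn tb nb c0 c1 c2
  refine ⟨⟨by rw [Fin.sum_univ_three, tt], by rw [Fin.sum_univ_three, bb]⟩,
    by rw [Fin.sum_univ_three, nb], ?_,
    frameMatrix_mem_specialOrthogonalGroup tt nn bb tn tb nb c0 c1 c2⟩
  ext i
  rw [cross, cross_apply]
  fin_cases i
  · simpa using c0
  · simpa using c1
  · simpa using c2

section

variable {y v r : ℝ}

/-! ### Unimodular phases and the signed torsion angle -/

theorem rho_norm (hy : 0 < y) (hr : ∀ j : ℤ, r ≠ (j : ℝ) / 2) (n : ℤ) :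
    4 * (rho v r y n * conj (rho v r y n)) = 1 := by
  have h := zpow_ne_zero n (div_ne_zero (R3_ne_zero (v := v) hy hr) (R1_ne_zero (v := v) hy hr))
  rw [conj_rho, rho]
  have hI := Complex.I_sq
  field_simp
  linear_combination -4 * hI

theorem tauSmall_norm_sq_ne_zero (hy : 0 < y) (hr : ∀ j : ℤ, r ≠ (j : ℝ) / 2) (n : ℤ) :
    tauSmallF v r y n 0 * conj (tauSmallF v r y n 0) +
        tauSmallG v r y n 0 * conj (tauSmallG v r y n 0) ≠ 0 := by
  rw [tauSmall_norm_sq hy hr]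
  exact mul_ne_zero (tauF_zero_ne_zero hy hr n) (tauF_zero_ne_zero hy hr (n + 1))

theorem conj_tauF_zero (hy : 0 < y) (hr : ∀ j : ℤ, r ≠ (j : ℝ) / 2) (n : ℤ) :
    conj (tauF v r y n 0) = tauF v r y n 0 := by
  obtain ⟨p, -, h⟩ := tauF_zero_pos (v := v) hy hr n
  rw [h, Complex.conj_ofReal]

/-- The signed torsion angle. -/
noncomputable def torsionAngle (v r y : ℝ) : ℝ := (R1 v r y * (R3 v r y)⁻¹).arg

theorem norm_R1_div_R3 (hy : 0 < y) (hr : ∀ j : ℤ, r ≠ (j : ℝ) / 2) :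
    ‖R1 v r y * (R3 v r y)⁻¹‖ = 1 := by
  have n1 := R1_ne_zero (v := v) hy hr
  have n3 := R3_ne_zero (v := v) hy hr
  have h := Complex.mul_conj (R1 v r y * (R3 v r y)⁻¹)
  rw [map_mul, map_inv₀, conj_R1, conj_R3, inv_inv, Complex.normSq_eq_norm_sq] at h
  have h' : ((‖R1 v r y * (R3 v r y)⁻¹‖ ^ 2 : ℝ) : ℂ) = 1 := by
    rw [← h]
    field_simp
  rw [← sq_eq_sq₀ (norm_nonneg _) zero_le_one, one_pow]
  exact_mod_cast h'

theorem exp_torsionAngle (hy : 0 < y) (hr : ∀ j : ℤ, r ≠ (j : ℝ) / 2) :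
    Complex.exp (torsionAngle v r y * Complex.I) = R1 v r y * (R3 v r y)⁻¹ := by
  have h := Complex.norm_mul_exp_arg_mul_I (R1 v r y * (R3 v r y)⁻¹)
  rwa [norm_R1_div_R3 hy hr, Complex.ofReal_one, one_mul] at h

theorem torsionAngle_eq_log (hy : 0 < y) (hr : ∀ j : ℤ, r ≠ (j : ℝ) / 2) :
    (torsionAngle v r y : ℂ) = 1 / Complex.I * Complex.log (R1 v r y * (R3 v r y)⁻¹) := by
  have hI := Complex.I_ne_zero
  rw [Complex.log, norm_R1_div_R3 hy hr, Real.log_one, torsionAngle]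
  field_simp
  simp

theorem abs_torsionAngle_mem (hy : 0 < y) (hr : ∀ j : ℤ, r ≠ (j : ℝ) / 2)
    (hv : ∀ j : ℤ, v ≠ y * j) : 0 < |torsionAngle v r y| ∧ |torsionAngle v r y| < Real.pi := by
  have h := exp_torsionAngle (v := v) hy hr
  have hne := R1_div_R3_sq_ne_one hy hr hv
  rw [← h] at hne
  constructor
  · rw [abs_pos]
    intro h0
    apply hne
    rw [h0]
    simp
  · refine lt_of_le_of_ne (Complex.abs_arg_le_pi _) fun h0 => ?_
    have hpi : torsionAngle v r y = Real.pi :=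
      ((abs_eq Real.pi_pos.le).1 h0).resolve_right (Complex.neg_pi_lt_arg _).ne'
    apply hne
    rw [hpi, Complex.exp_pi_mul_I]
    norm_num

theorem rho_succ (hy : 0 < y) (hr : ∀ j : ℤ, r ≠ (j : ℝ) / 2) (n : ℤ) :
    rho v r y (n + 1) = rho v r y n * Complex.exp (-(torsionAngle v r y) * Complex.I) := by
  have n1 := R1_ne_zero (v := v) hy hr
  have n3 := R3_ne_zero (v := v) hy hr
  rw [neg_mul, Complex.exp_neg, exp_torsionAngle hy hr, rho, rho,
    zpow_add_one₀ (div_ne_zero n3 n1), mul_inv, inv_inv]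
  ring

/-! ### The discrete curve and its frame -/

/-- The vertices of the curve. -/
noncomputable def curve (v r y : ℝ) (n : ℤ) : E3 :=
  realVec (positionVec n (tauH v r y n 0) (tauF v r y n 0) (logDeriv (tauF v r y n) 0))

/-- The tangent vectors of the curve. -/
noncomputable def tangent (v r y : ℝ) (n : ℤ) : E3 :=
  realVec (tangentVec (tauSmallF v r y n 0) (tauSmallG v r y n 0))

/-- The normal vectors of the curve. -/
noncomputable def normal (v r y : ℝ) (n : ℤ) : E3 :=
  realVec (normalVec (tauSmallF v r y n 0) (tauSmallG v r y n 0) (rho v r y n))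

/-- The binormal vectors of the curve. -/
noncomputable def binormal (v r y : ℝ) (n : ℤ) : E3 :=
  realVec (binormalVec (tauSmallF v r y n 0) (tauSmallG v r y n 0) (rho v r y n))

theorem ofReal_curve (hy : 0 < y) (hr : ∀ j : ℤ, r ≠ (j : ℝ) / 2) (n : ℤ) (i : Fin 3) :
    ((curve v r y n i : ℝ) : ℂ) =
      positionVec n (tauH v r y n 0) (tauF v r y n 0) (logDeriv (tauF v r y n) 0) i :=
  ofReal_realVec (conj_positionVec (conj_tauF_zero hy hr n) (conj_logDeriv_tauF_zero hy hr n)) i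

theorem ofReal_tangent (n : ℤ) (i : Fin 3) : ((tangent v r y n i : ℝ) : ℂ) =
    tangentVec (tauSmallF v r y n 0) (tauSmallG v r y n 0) i :=
  ofReal_realVec (conj_tangentVec _ _) i

theorem ofReal_normal (n : ℤ) (i : Fin 3) : ((normal v r y n i : ℝ) : ℂ) =
    normalVec (tauSmallF v r y n 0) (tauSmallG v r y n 0) (rho v r y n) i :=
  ofReal_realVec (conj_normalVec _ _ _) i

theorem ofReal_binormal (n : ℤ) (i : Fin 3) : ((binormal v r y n i : ℝ) : ℂ) =
    binormalVec (tauSmallF v r y n 0) (tauSmallG v r y n 0) (rho v r y n) i :=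
  ofReal_realVec (conj_binormalVec _ _ _) i

theorem curve_succ_sub (hy : 0 < y) (hr : ∀ j : ℤ, r ≠ (j : ℝ) / 2) (hv : ∀ j : ℤ, v ≠ y * j)
    (n : ℤ) : curve v r y (n + 1) - curve v r y n = tangent v r y n := by
  have hp := position_planar_step hy hr hv n
  have ha := position_axial_step hy hr hv n
  have hc := congrArg conj hp
  have hF := conj_tauF_zero (v := v) hy hr n
  have hF' := conj_tauF_zero (v := v) hy hr (n + 1)
  simp only [map_sub, map_div₀, map_mul, hF, hF', Complex.conj_conj] at hc
  ext i
  apply Complex.ofReal_injective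
  rw [PiLp.sub_apply, Complex.ofReal_sub, ofReal_curve hy hr, ofReal_curve hy hr, ofReal_tangent]
  fin_cases i
  · simp only [Fin.zero_eta, positionVec, tangentVec, tauSmall_norm_sq hy hr, Pi.smul_apply,
      smul_eq_mul, Matrix.cons_val]
    linear_combination hp + hc
  · simp only [Fin.mk_one, positionVec, tangentVec, tauSmall_norm_sq hy hr, Pi.smul_apply,
      smul_eq_mul, Matrix.cons_val]
    linear_combination (1 / Complex.I) * (hp - hc)
  · simp only [Fin.reduceFinMk, positionVec, tangentVec, tauSmall_norm_sq hy hr, Pi.smul_apply,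
      smul_eq_mul, Matrix.cons_val]
    linear_combination ha

theorem binormal_succ (hy : 0 < y) (hr : ∀ j : ℤ, r ≠ (j : ℝ) / 2) (n : ℤ) (i : Fin 3) :
    binormal v r y (n + 1) i = Real.sin (torsionAngle v r y) * normal v r y n i +
      Real.cos (torsionAngle v r y) * binormal v r y n i := by
  apply Complex.ofReal_injective
  rw [Complex.ofReal_add, Complex.ofReal_mul, Complex.ofReal_mul, ofReal_binormal, ofReal_binormal,
    ofReal_normal, binormalVec_rotate, ← rho_succ hy hr, binormalVec_rho_succ hy hr]

theorem tangent_dot_succ_ne (hy : 0 < y) (hr : ∀ j : ℤ, r ≠ (j : ℝ) / 2) (n : ℤ) :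
    tangent v r y n 0 * tangent v r y (n + 1) 0 + tangent v r y n 1 * tangent v r y (n + 1) 1 +
      tangent v r y n 2 * tangent v r y (n + 1) 2 ≠ -1 := by
  intro h
  have hq := tauSmall_norm_sq_ne_zero (v := v) hy hr n
  have hq' := tauSmall_norm_sq_ne_zero (v := v) hy hr (n + 1)
  have hd := tangentVec_dot _ _ _ _ hq hq'
  have hU := tauSmall_inner_ne_zero (v := v) hy hr n
  simp only [← ofReal_tangent] at hd
  norm_cast at hd
  rw [h] at hd
  push_cast at hd
  have h0 : 2 * ((conj (tauSmallF v r y n 0) * tauSmallF v r y (n + 1) 0 +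
      conj (tauSmallG v r y n 0) * tauSmallG v r y (n + 1) 0) *
      conj (conj (tauSmallF v r y n 0) * tauSmallF v r y (n + 1) 0 +
      conj (tauSmallG v r y n 0) * tauSmallG v r y (n + 1) 0)) /
        ((tauSmallF v r y n 0 * conj (tauSmallF v r y n 0) +
        tauSmallG v r y n 0 * conj (tauSmallG v r y n 0)) *
        (tauSmallF v r y (n + 1) 0 * conj (tauSmallF v r y (n + 1) 0) +
        tauSmallG v r y (n + 1) 0 * conj (tauSmallG v r y (n + 1) 0))) = 0 := by
    linear_combination -hd
  refine div_ne_zero (mul_ne_zero two_ne_zero (mul_ne_zero hU ?_)) (mul_ne_zero hq hq') h0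
  exact (map_ne_zero _).2 hU

theorem frame_mem (hy : 0 < y) (hr : ∀ j : ℤ, r ≠ (j : ℝ) / 2) (n : ℤ) :
    frameMatrix (tangent v r y n) (normal v r y n) (binormal v r y n) ∈
      Matrix.specialOrthogonalGroup (Fin 3) ℝ :=
  (realVec_frame (tauSmall_norm_sq_ne_zero hy hr n) (rho_norm hy hr n)).2.2.2

theorem hasConstantTorsion (hy : 0 < y) (hr : ∀ j : ℤ, r ≠ (j : ℝ) / 2)
    (hv : ∀ j : ℤ, v ≠ y * j) :
    HasConstantTorsion (curve v r y) (tangent v r y) (normal v r y) (binormal v r y)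
      (torsionAngle v r y) := by
  refine ⟨curve_succ_sub hy hr hv, frame_mem hy hr, ?_⟩
  choose κ hκ h using fun n : ℤ => exists_curvature_of_frames (frame_mem (v := v) hy hr n)
    (frame_mem (v := v) hy hr (n + 1)) (binormal_succ hy hr n) (tangent_dot_succ_ne hy hr n)
  -- The chosen angle is indexed by the edge `n`, whereas the Frenet equation attaches it to `n +
  -- 1`.
  refine ⟨fun n => κ (n - 1), fun n => hκ _, fun n => ?_⟩
  simp only [add_sub_cancel_right]
  exact h n

theorem norm_tangent (hy : 0 < y) (hr : ∀ j : ℤ, r ≠ (j : ℝ) / 2) (n : ℤ) :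
    ‖tangent v r y n‖ = 1 := by
  have h := (realVec_frame (tauSmall_norm_sq_ne_zero (v := v) hy hr n)
    (rho_norm (v := v) hy hr n)).1.1
  rw [Fin.sum_univ_three] at h
  exact norm_eq_one_of_sum_sq h

theorem sum_sq_binormal (hy : 0 < y) (hr : ∀ j : ℤ, r ≠ (j : ℝ) / 2) (n : ℤ) :
    binormal v r y n 0 ^ 2 + binormal v r y n 1 ^ 2 + binormal v r y n 2 ^ 2 = 1 := by
  have h := (realVec_frame (tauSmall_norm_sq_ne_zero (v := v) hy hr n)
    (rho_norm (v := v) hy hr n)).1.2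
  rwa [Fin.sum_univ_three] at h

theorem inner_binormal_succ (hy : 0 < y) (hr : ∀ j : ℤ, r ≠ (j : ℝ) / 2) (n : ℤ) :
    inner ℝ (binormal v r y n) (binormal v r y (n + 1)) = Real.cos (torsionAngle v r y) := by
  have h := (realVec_frame (tauSmall_norm_sq_ne_zero (v := v) hy hr n)
    (rho_norm (v := v) hy hr n)).2.1
  have hb := sum_sq_binormal (v := v) hy hr n
  rw [Fin.sum_univ_three] at h
  change normal v r y n 0 * binormal v r y n 0 + normal v r y n 1 * binormal v r y n 1 +
    normal v r y n 2 * binormal v r y n 2 = 0 at h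
  rw [PiLp.inner_apply, Fin.sum_univ_three]
  simp only [binormal_succ hy hr, RCLike.inner_apply, conj_trivial]
  linear_combination Real.sin (torsionAngle v r y) * h + Real.cos (torsionAngle v r y) * hb

/-- Only `sin λ Nₙ × Bₙ` survives, and `Nₙ × Bₙ = Tₙ`. Writing it as a difference of vertices makes
the balance sum telescope. -/
theorem cross_binormal_succ (hy : 0 < y) (hr : ∀ j : ℤ, r ≠ (j : ℝ) / 2)
    (hv : ∀ j : ℤ, v ≠ y * j) (n : ℤ) :
    cross (binormal v r y (n + 1)) (binormal v r y n) =
      Real.sin (torsionAngle v r y) • (curve v r y (n + 1) - curve v r y n) := by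
  have h : cross (normal v r y n) (binormal v r y n) = tangent v r y n :=
    (realVec_frame (tauSmall_norm_sq_ne_zero hy hr n) (rho_norm hy hr n)).2.2.1
  rw [curve_succ_sub hy hr hv, ← h]
  ext i
  rw [PiLp.smul_apply, cross, cross, cross_apply, cross_apply]
  simp only [binormal_succ hy hr]
  fin_cases i <;> simp <;> ring

/-! ### Closure of the curve and the Kaleidocycle -/

theorem curve_add_period {k : ℕ} {m : ℤ} (hy : 0 < y) (hr : ∀ j : ℤ, r ≠ (j : ℝ) / 2)
    (hv : ∀ j : ℤ, v ≠ y * j) (hkv : (k : ℝ) * v = m * y)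
    (hΛ : closureLambda k m v y r = 0) (hΞ : closureXi k m v y r = 0) (n : ℤ) :
    curve v r y (n + k) = curve v r y n := by
  have hp := tauH_div_tauF_add_period hy hr hkv hΛ n
  have ha := axial_position_add_period hy hr hv hkv hΞ n
  have hc := congrArg conj hp
  have hF := conj_tauF_zero (v := v) hy hr n
  have hF' := conj_tauF_zero (v := v) hy hr (n + k)
  simp only [map_div₀, hF, hF'] at hc
  ext i
  apply Complex.ofReal_injective
  rw [ofReal_curve hy hr, ofReal_curve hy hr]
  fin_cases i
  · simp only [Fin.zero_eta, positionVec, Matrix.cons_val, add_div, hp, hc]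
  · simp only [Fin.mk_one, positionVec, Matrix.cons_val, sub_div, hp, hc]
  · simp only [Fin.reduceFinMk, positionVec, Matrix.cons_val]
    exact ha

theorem binormal_add_period {k : ℕ} {m : ℤ} (hy : 0 < y) (hr : ∀ j : ℤ, r ≠ (j : ℝ) / 2)
    (hkv : (k : ℝ) * v = m * y) (hΛ : closureLambda k m v y r = 0) (n : ℤ) :
    binormal v r y (n + k) = binormal v r y n ∨ binormal v r y (n + k) = -binormal v r y n := by
  refine (binormalVec_add_period hy hr hkv hΛ n).imp (fun h => ?_) (fun h => ?_) <;>
  · ext i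
    apply Complex.ofReal_injective
    simp only [PiLp.neg_apply, Complex.ofReal_neg, ofReal_binormal, h]

theorem isKaleidocycle_binormal {k : ℕ} {m : ℤ} (hy : 0 < y) (hr : ∀ j : ℤ, r ≠ (j : ℝ) / 2)
    (hv : ∀ j : ℤ, v ≠ y * j) (hkv : (k : ℝ) * v = m * y)
    (hΛ : closureLambda k m v y r = 0) (hΞ : closureXi k m v y r = 0) :
    IsKaleidocycle k |torsionAngle v r y| (fun i : Fin (k + 1) => binormal v r y ((i : ℕ) : ℤ)) where
  angle_pos := (abs_torsionAngle_mem hy hr hv).1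
  angle_lt_pi := (abs_torsionAngle_mem hy hr hv).2
  unit i := norm_eq_one_of_sum_sq (sum_sq_binormal hy hr _)
  angle i := by
    rw [Real.cos_abs, ← inner_binormal_succ hy hr ((i : ℕ) : ℤ)]
    simp
  balance := by
    have h : ∀ i : Fin k, cross (binormal v r y ((i.succ : ℕ) : ℤ))
        (binormal v r y ((i.castSucc : ℕ) : ℤ)) =
        Real.sin (torsionAngle v r y) •
          (curve v r y ((((i : ℕ) + 1 : ℕ)) : ℤ) - curve v r y ((i : ℕ) : ℤ)) := by
      intro i
      have := cross_binormal_succ hy hr hv ((i : ℕ) : ℤ)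
      simpa using this
    rw [Finset.sum_congr rfl fun i _ => h i, ← Finset.smul_sum,
      Fin.sum_univ_eq_sum_range (fun i : ℕ => curve v r y ((i + 1 : ℕ) : ℤ) - curve v r y (i : ℤ)),
      Finset.sum_range_sub (fun i : ℕ => curve v r y (i : ℤ))]
    have := curve_add_period hy hr hv hkv hΛ hΞ 0
    rw [zero_add] at this
    rw [this, Nat.cast_zero, sub_self, smul_zero]
  ends := by
    have := binormal_add_period hy hr hkv hΛ 0
    simpa using this

/-- On `Λ = 0` the derivative of `Λ` is minus the numerator of `Ξ`, and the denominator `Δ₃ - Δ₁`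
does not vanish. -/
theorem closure_conditions_iff (k : ℕ) (m : ℤ) (hy : 0 < y) (hr : ∀ j : ℤ, r ≠ (j : ℝ) / 2)
    (hv : ∀ j : ℤ, v ≠ y * j) :
    (closureLambda k m v y r = 0 ∧ closureXi k m v y r = 0) ↔
      (closureLambda k m v y r = 0 ∧
        HasDerivAt (fun s : ℝ => closureLambda k m v y s) 0 r) := by
  refine and_congr_right fun hΛ => ?_
  have hD := Delta3_sub_Delta1_ne_zero hy hr hv
  have h := hasDerivAt_closureLambda (v := v) k m hy hr
  rw [hΛ, zero_add, one_mul] at h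
  rw [closureXi, div_eq_zero_iff, or_iff_left hD]
  constructor
  · intro h0
    refine h.congr_deriv ?_
    linear_combination -h0
  · intro h0
    linear_combination -(h.unique h0)

end

end Kaleidocycle

theorem mainTheorem2 (k : ℕ) (m : ℤ) (hm : m ≠ 0) (y v r : ℝ) (hy : 0 < y)
    (hr : ∀ j : ℤ, r ≠ (j : ℝ) / 2) (hv : ∀ j : ℤ, v ≠ y * j) (hkv : (k : ℝ) * v = m * y) :
    -- the two forms of the closure conditions are equivalent
    ((Kaleidocycle.closureLambda k m v y r = 0 ∧ Kaleidocycle.closureXi k m v y r = 0) ↔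
      (Kaleidocycle.closureLambda k m v y r = 0 ∧
        HasDerivAt (fun s : ℝ => Kaleidocycle.closureLambda k m v y s) 0 r)) ∧
    (Kaleidocycle.closureLambda k m v y r = 0 → Kaleidocycle.closureXi k m v y r = 0 →
      ∃ (lam : ℝ) (ρ : ℤ → ℂ) (γ T N B : ℤ → Kaleidocycle.E3),
        -- the torsion angle
        (lam : ℂ) = 1 / Complex.I *
          Complex.log (Kaleidocycle.R1 v r y * (Kaleidocycle.R3 v r y)⁻¹) ∧
        -- the value at `z = 0` of `(1/2) Gₙ / G̃ₙ` (a limit, as `G̃ₙ(0)` may vanish)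
        (∀ n, Tendsto (fun z : ℂ => 1 / 2 *
            (Kaleidocycle.tauG v r y n z / Kaleidocycle.tauGtilde v r y n z))
          (𝓝[≠] 0) (𝓝 (ρ n))) ∧
        -- the curve and the frame are given by the tau functions at `z = 0`
        (∀ n i, ((γ n i : ℝ) : ℂ) = Kaleidocycle.positionVec n (Kaleidocycle.tauH v r y n 0)
          (Kaleidocycle.tauF v r y n 0) (logDeriv (Kaleidocycle.tauF v r y n) 0) i) ∧
        (∀ n i, ((T n i : ℝ) : ℂ) = Kaleidocycle.tangentVec
          (Kaleidocycle.tauSmallF v r y n 0) (Kaleidocycle.tauSmallG v r y n 0) i) ∧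
        (∀ n i, ((N n i : ℝ) : ℂ) = Kaleidocycle.normalVec
          (Kaleidocycle.tauSmallF v r y n 0) (Kaleidocycle.tauSmallG v r y n 0) (ρ n) i) ∧
        (∀ n i, ((B n i : ℝ) : ℂ) = Kaleidocycle.binormalVec
          (Kaleidocycle.tauSmallF v r y n 0) (Kaleidocycle.tauSmallG v r y n 0) (ρ n) i) ∧
        -- unit segments, constant torsion angle, closedness, and the Kaleidocycle
        Kaleidocycle.IsUnitLength γ ∧
        Kaleidocycle.HasConstantTorsion γ T N B lam ∧
        Kaleidocycle.IsClosedWithPeriod γ k ∧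
        Kaleidocycle.IsKaleidocycle k |lam| (fun i : Fin (k + 1) => B ((i : ℕ) : ℤ))) := by

  refine ⟨Kaleidocycle.closure_conditions_iff k m hy hr hv, fun hΛ hΞ => ?_⟩
  refine ⟨Kaleidocycle.torsionAngle v r y, Kaleidocycle.rho v r y, Kaleidocycle.curve v r y,
    Kaleidocycle.tangent v r y, Kaleidocycle.normal v r y, Kaleidocycle.binormal v r y,
    Kaleidocycle.torsionAngle_eq_log hy hr, Kaleidocycle.tendsto_tauG_div_tauGtilde hy hr hv,
    Kaleidocycle.ofReal_curve hy hr, Kaleidocycle.ofReal_tangent, Kaleidocycle.ofReal_normal,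
    Kaleidocycle.ofReal_binormal, fun n => ?_, Kaleidocycle.hasConstantTorsion hy hr hv,
    Kaleidocycle.curve_add_period hy hr hv hkv hΛ hΞ,
    Kaleidocycle.isKaleidocycle_binormal hy hr hv hkv hΛ hΞ⟩
  rw [Kaleidocycle.curve_succ_sub hy hr hv]
  exact Kaleidocycle.norm_tangent hy hr n
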